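/- For integers $m\ge 1$ and $n\ge 0$ let $T_{m,n}$ be the (positive) torus link, the closure of the $m$-strand braid $(\sigma_1\sigma_2\cdots\sigma_{m-1})^n$ with all crossings positive, let $\mathcal H^{i,j}(T_{m,n})$ be its integral Khovanov homology in homological degree $i$ and quantum degree $j$, with the normalization in which the positive trefoil $T_{2,3}$ has Poincaré polynomial $q+q^3+t^2q^5+t^3q^9$, and put $$P(T_{m,n})(t,q)=\sum_{i,j\in\mathbb Z}t^iq^j\,\operatorname{rank}\mathcal H^{i,j}(T_{m,n}),\qquad P_{m,n}(t,q)=q^{-(m-1)n}P(T_{m,n})(t,q).$$ Then for every integer $m\ge 1$ there is a formal Laurent series $P_m^S(t,q)$ in $t$, with coefficients in $\mathbb Z[q,q^{-1}]$, such that $$P_m^S(t,q)=\lim_{n\to\infty}P_{m,n}(t,q),$$ where the limit is taken $t$-adically: for every $N$, for all sufficiently large $n$, the coefficients of $t^i$ in $P_{m,n}$ and $P_m^S$ agree for all $i\le N$. Furthermore, for every $n\ge m$ the coefficients of $t^i$ in $P_{m,n}(t,q)$ and in $P_m^S(t,q)$ coincide for all $i\le m+n-3$. -/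

import Mathlib

namespace Khovanov

/-- A braid word on `m` strands: a list of letters `(i, b)` with `i < m - 1`.  The letter `(i, true)`
is a positive crossing of the neighbouring strands `i`, `i + 1` (counted from `0`), and
`(i, false)` is a negative one.  The `k`-th letter lies between the levels `k` and `k + 1`, and all
strands are oriented in the direction of increasing level. -/
abbrev BraidWord (m : ℕ) := List (Fin (m - 1) × Bool)

section Diagram

variable {m : ℕ}

/-- The number of crossings. -/
abbrev BraidWord.crossings (w : BraidWord m) : ℕ := w.length

/-- The left one of the two strands that meet in the `k`-th crossing. -/
def leftStrand (w : BraidWord m) (k : Fin w.crossings) : Fin m :=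
  ⟨(w.get k).1.val, by have := (w.get k).1.isLt; omega⟩

/-- The right one of the two strands that meet in the `k`-th crossing. -/
def rightStrand (w : BraidWord m) (k : Fin w.crossings) : Fin m :=
  ⟨(w.get k).1.val + 1, by have := (w.get k).1.isLt; omega⟩

/-- Is the `k`-th crossing positive? -/
def isPositive (w : BraidWord m) (k : Fin w.crossings) : Bool := (w.get k).2

/-- Number of positive crossings. -/
def nPlus (w : BraidWord m) : ℕ :=
  (Finset.univ.filter fun k : Fin w.crossings => isPositive w k = true).card

/-- Number of negative crossings. -/
def nMinus (w : BraidWord m) : ℕ :=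
  (Finset.univ.filter fun k : Fin w.crossings => isPositive w k = false).card

/-- The points at which the strand positions meet the levels of the braid. -/
abbrev Point (w : BraidWord m) := Fin (w.crossings + 1) × Fin m

/-- A total resolution: `false` is the `0`-resolution and `true` the `1`-resolution of a crossing. -/
abbrev Resolution (w : BraidWord m) := Fin w.crossings → Bool

/-- The `0`-resolution of a positive crossing and the `1`-resolution of a negative one are the
oriented resolution (two parallel strands); the other two consist of a cap and a cup. -/
def isVertical (w : BraidWord m) (e : Resolution w) (k : Fin w.crossings) : Prop :=
  e k ≠ isPositive w k

/-- The arcs of the resolved closed braid diagram, each given by its two end points. -/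
inductive Arc (w : BraidWord m) (e : Resolution w) : Point w → Point w → Prop
  /-- the closing strands -/
  | closing (s : Fin m) : Arc w e (Fin.last _, s) (0, s)
  /-- a strand that passes by the `k`-th crossing -/
  | pass (k : Fin w.crossings) (s : Fin m) (hl : s ≠ leftStrand w k) (hr : s ≠ rightStrand w k) :
      Arc w e (k.castSucc, s) (k.succ, s)
  | verticalLeft (k : Fin w.crossings) (h : isVertical w e k) :
      Arc w e (k.castSucc, leftStrand w k) (k.succ, leftStrand w k)
  | verticalRight (k : Fin w.crossings) (h : isVertical w e k) :
      Arc w e (k.castSucc, rightStrand w k) (k.succ, rightStrand w k)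
  | cap (k : Fin w.crossings) (h : ¬ isVertical w e k) :
      Arc w e (k.castSucc, leftStrand w k) (k.castSucc, rightStrand w k)
  | cup (k : Fin w.crossings) (h : ¬ isVertical w e k) :
      Arc w e (k.succ, leftStrand w k) (k.succ, rightStrand w k)

/-- The circles of a total resolution: the connected components of the union of its arcs. -/
def Circles (w : BraidWord m) (e : Resolution w) : Type := Quot (Arc w e)

/-- The circle through a point. -/
def circleAt (w : BraidWord m) (e : Resolution w) (a : Point w) : Circles w e := Quot.mk _ a

instance (w : BraidWord m) (e : Resolution w) : Finite (Circles w e) :=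
  inferInstanceAs (Finite (Quot (Arc w e)))

noncomputable instance (w : BraidWord m) (e : Resolution w) : Fintype (Circles w e) :=
  Fintype.ofFinite _

end Diagram

/-- The basis `1 = X ^ 0`, `X = X ^ 1` of the module `V`, given by the exponent of `X`. -/
abbrev VBasis := Fin 2

/-- The degrees `deg 1 = 1`, `deg X = -1`. -/
def vDeg (a : VBasis) : ℤ := 1 - 2 * (a.val : ℤ)

/-- The coefficient of `c` in `m (a ⊗ b)`, where
`m (1 ⊗ 1) = 1`, `m (1 ⊗ X) = m (X ⊗ 1) = X`, `m (X ⊗ X) = 0`. -/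
def mulCoeff (a b c : VBasis) : ℤ := if c.val = a.val + b.val then 1 else 0

/-- The coefficient of `b ⊗ c` in `Δ a`, where
`Δ 1 = 1 ⊗ X + X ⊗ 1`, `Δ X = X ⊗ X`. -/
def comulCoeff (a b c : VBasis) : ℤ := if b.val + c.val = a.val + 1 then 1 else 0

section Complex

variable {m : ℕ}

/-- The standard basis of the direct sum over all total resolutions `e` of the modules `V_e`, the
tensor product of copies of `V` over the circles of `e`: a basis vector is a total resolution
together with a basis vector of `V` for each of its circles. -/
abbrev State (w : BraidWord m) := Σ e : Resolution w, (Circles w e → VBasis)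

/-- The homological degree `|e|` of a basis vector. -/
def homDegree {w : BraidWord m} (x : State w) : ℕ :=
  (Finset.univ.filter fun k => x.1 k = true).card

/-- The quantum degree in `V_e {|e|}` of a basis vector. -/
noncomputable def qDegree {w : BraidWord m} (x : State w) : ℤ :=
  (homDegree x : ℤ) + ∑ c, vDeg (x.2 c)

open Classical in
/-- The coefficient of `y` in the image of `x` under the map `V_e → V_e'` for `e'` obtained from `e`
by changing the `k`-th entry from `0` to `1`.  The bottom left end `a` and the top right end `b` of
the crossing lie on the two different arcs which replace the crossing, both for `e` and for `e'`.  If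
`a` and `b` are on different circles of `e`, these merge into one circle of `e'`, and the map is the
multiplication; otherwise the circle splits into the circles of `e'` through `a` and `b`, and
the map is the comultiplication.  It is the identity on the factors of the other circles. -/
noncomputable def edgeCoeff (w : BraidWord m) (k : Fin w.crossings) (x y : State w) : ℤ :=
  let a : Point w := (k.castSucc, leftStrand w k)
  let b : Point w := (k.succ, rightStrand w k)
  if ∀ p : Point w, circleAt w x.1 p ≠ circleAt w x.1 a → circleAt w x.1 p ≠ circleAt w x.1 b →
      y.2 (circleAt w y.1 p) = x.2 (circleAt w x.1 p) then
    if circleAt w x.1 a ≠ circleAt w x.1 b then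
      mulCoeff (x.2 (circleAt w x.1 a)) (x.2 (circleAt w x.1 b)) (y.2 (circleAt w y.1 a))
    else
      comulCoeff (x.2 (circleAt w x.1 a)) (y.2 (circleAt w y.1 a)) (y.2 (circleAt w y.1 b))
  else 0

/-- The coefficient of `y` in the differential of `x`: the sum of the edge maps with the signs
`(-1) ^ f`, where `f` is the number of `1`s before the changed entry. -/
noncomputable def diffCoeff (w : BraidWord m) (x y : State w) : ℤ :=
  ∑ k : Fin w.crossings,
    if x.1 k = false ∧ y.1 = Function.update x.1 k true then
      (-1) ^ (Finset.univ.filter fun l => l < k ∧ x.1 l = true).card * edgeCoeff w k x y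
    else 0

/-- The basis vectors of bidegree `(i, j)`. -/
abbrev StateOf (w : BraidWord m) (i j : ℤ) :=
  {x : State w // (homDegree x : ℤ) = i ∧ qDegree x = j}

noncomputable instance (w : BraidWord m) (i j : ℤ) : Fintype (StateOf w i j) := Fintype.ofFinite _

/-- The summand of quantum degree `j` of the unnormalized chain group `C^i`, as coordinate vectors
in the standard basis. -/
abbrev Chain (w : BraidWord m) (i j : ℤ) := StateOf w i j → ℤ

/-- The differential between the summands of quantum degree `j` of `C^i` and `C^i'`; it is meant for
`i' = i + 1` (and zero otherwise). -/
noncomputable def diff (w : BraidWord m) (i i' j : ℤ) : Chain w i j →ₗ[ℤ] Chain w i' j :=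
  (Matrix.of fun (y : StateOf w i' j) (x : StateOf w i j) => diffCoeff w x.1 y.1).mulVecLin

/-- The unnormalized homology `H^{i,j}(D) = ker d^i / im d^{i-1}` of the closure `D` of the braid. -/
abbrev Homology (w : BraidWord m) (i j : ℤ) : Type :=
  LinearMap.ker (diff w i (i + 1) j) ⧸
    (LinearMap.range (diff w (i - 1) i j)).submoduleOf (LinearMap.ker (diff w i (i + 1) j))

/-- The rank `dim_ℚ (ℚ ⊗ H)` of the normalized homology group `H^{i + n₋, j - n₊ + 2 n₋}(D)` in
bidegree `(i, j)`. -/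
noncomputable def khovanovRank (w : BraidWord m) (i j : ℤ) : ℕ :=
  Module.finrank ℚ
    (TensorProduct ℤ ℚ (Homology w (i + (nMinus w : ℤ)) (j - (nPlus w : ℤ) + 2 * (nMinus w : ℤ))))

/-- The sum that defines the Poincaré polynomial is finite. -/
theorem finite_support_khovanovRank (w : BraidWord m) :
    (Function.support fun p : ℤ × ℤ => khovanovRank w p.1 p.2).Finite := by
  have hfin : (Set.range fun x : State w =>
      ((homDegree x : ℤ) - (nMinus w : ℤ),
        qDegree x + (nPlus w : ℤ) - 2 * (nMinus w : ℤ))).Finite := Set.finite_range _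
  refine hfin.subset ?_
  rintro ⟨i, j⟩ h
  by_contra hx
  apply h
  have hempty : IsEmpty (StateOf w (i + (nMinus w : ℤ))
      (j - (nPlus w : ℤ) + 2 * (nMinus w : ℤ))) := by
    refine ⟨fun x => hx ⟨x.1, ?_⟩⟩
    have h1 := x.2.1
    have h2 := x.2.2
    simp only [Prod.mk.injEq]
    constructor <;> linarith
  have hsub : Subsingleton (Homology w (i + (nMinus w : ℤ))
      (j - (nPlus w : ℤ) + 2 * (nMinus w : ℤ))) :=
    (Submodule.mkQ_surjective _).subsingleton
  exact Module.finrank_zero_of_subsingleton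

/-- The Poincaré polynomial `∑ t^i q^j rank ℋ^{i,j}` of the closure of a braid, as a Laurent
polynomial in `t` whose coefficients are Laurent polynomials in `q`. -/
noncomputable def poincare (w : BraidWord m) : LaurentPolynomial (LaurentPolynomial ℤ) :=
  ∑ᶠ p : ℤ × ℤ, khovanovRank w p.1 p.2 •
    (LaurentPolynomial.T p.1 * LaurentPolynomial.C (LaurentPolynomial.T p.2))

end Complex

/-- The braid word `(σ₁ σ₂ ⋯ σ_{m-1})^n`, whose closure is the standard diagram of the torus link
`T_{m,n}`. -/
def torusBraid (m n : ℕ) : BraidWord m :=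
  (List.replicate n ((List.finRange (m - 1)).map fun i => (i, true))).flatten

/-- The normalized Poincaré polynomial `P_{m,n} = q^{-(m-1)n} P(T_{m,n})`. -/
noncomputable def torusPoincare (m n : ℕ) : LaurentPolynomial (LaurentPolynomial ℤ) :=
  LaurentPolynomial.C (LaurentPolynomial.T (-(((m : ℤ) - 1) * (n : ℤ)))) * poincare (torusBraid m n)

/-- The sequence `f` of Laurent polynomials in `t` converges `t`-adically to the formal Laurent
series `F` in `t`: for every `N`, the coefficients of all `t^i` with `i ≤ N` agree eventually. -/
def IsStableLimit {R : Type*} [Semiring R] (f : ℕ → LaurentPolynomial R) (F : LaurentSeries R) :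
    Prop :=
  ∀ N : ℤ, ∀ᶠ n in Filter.atTop, ∀ i : ℤ, i ≤ N → (f n).coeff i = F.coeff i

end Khovanov

/-! All crossings are positive, so the 0-resolution of a crossing is a pair of parallel strands.
Split the diagram of `T_{m,n+1}` into its first row of `m - 1` crossings and the diagram of
`T_{m,n}`. The resolutions that are 0 on the whole first row span a quotient complex which is the
complex of `T_{m,n}`, with the same homological and unnormalized quantum degrees; all other
resolutions span a subcomplex. For `n ≥ m` this subcomplex is exact in degrees at most `m + n - 2`,
so the unnormalized integral homology of the two diagrams agrees in degrees at most `m + n - 3`. The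
factor `q^{-(m-1)n}` cancels the shift by `n₊`, so each coefficient of `P_{m,n}` is constant from
some `n` on, with the stated range.

For the exactness, filter the subcomplex by the position of the last 1 in the first row. In each
layer that crossing is replaced by a cap and a cup, and the cup is pushed through the remaining rows
by two moves, both instances of Gaussian elimination over `ℤ`. If the cup meets one crossing of a
neighbouring index and then one of its own index, exactness reduces to the case where the former is
1-resolved and the latter 0-resolved: the cup has moved one place sideways
(`khExactOn_of_triangle`). If it meets a crossing of its own index directly, exactness reduces to
the case where that crossing is 1-resolved (`khExactOn_of_kink`). Every move fixes one more
1-resolution, and a complex with `r` fixed 1-resolutions is zero below degree `r`.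

It remains to count moves (`partialExact_of_rows`). In each row the cup moves one place to the left.
At the left edge it meets a kink, after which it can be swept along an entire row to the right edge.
The kink and the sweep use up two rows and produce `m` fixed 1-resolutions. The condition `n ≥ m`
ensures that a cup starting at any position has time for this once, and the total is at least `m + n
- 1`.

Two facts about the cube of resolutions underlie this. Changing a crossing always merges two circles
or splits one, because the circles are the cycles of a permutation that gets multiplied by a
transposition (`next_flip`). The differential squares to zero, because edge maps are quotient maps
or multiplications by `X_a + X_b` on monomials (`edgeForm_comm`). -/

namespace Khovanov

/-! ### Exact subquotients of complexes with a basis -/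

section BasedComplex

variable {S : Type*} {D : S → S → ℤ} {deg : S → ℤ}

/-- The subquotient spanned by the basis vectors satisfying `p` of the complex with basis `S` and
matrix `D` is exact in degree `i`. -/
def ExactOn [Fintype S] (D : S → S → ℤ) (deg : S → ℤ) (p : S → Prop) (i : ℤ) : Prop :=
  ∀ f : S → ℤ, (∀ x, f x ≠ 0 → p x ∧ deg x = i) → (∀ y, p y → ∑ x, f x * D x y = 0) →
    ∃ g : S → ℤ, (∀ x, g x ≠ 0 → p x ∧ deg x = i - 1) ∧ ∀ y, p y → ∑ x, g x * D x y = f y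

/-- The set of basis vectors satisfying `p` spans a subquotient. -/
def IsInterval (D : S → S → ℤ) (p : S → Prop) : Prop :=
  ∀ x y z, p x → p y → D x z ≠ 0 → D z y ≠ 0 → p z

/-- The hypothesis `hs` makes `s` a subcomplex of `p`. This lemma and the next allow elimination
steps to be nested. -/
theorem IsInterval.sub {p s : S → Prop} (hp : IsInterval D p)
    (hs : ∀ x y, p x → p y → s x → D x y ≠ 0 → s y) : IsInterval D fun x => p x ∧ s x :=
  fun x y z hx hy hxz hzy =>
    have hz := hp x y z hx.1 hy.1 hxz hzy
    ⟨hz, hs x z hx.1 hz hx.2 hxz⟩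

theorem IsInterval.quotient {p s : S → Prop} (hp : IsInterval D p)
    (hs : ∀ x y, p x → p y → s x → D x y ≠ 0 → s y) : IsInterval D fun x => p x ∧ ¬ s x :=
  fun x y z hx hy hxz hzy =>
    have hz := hp x y z hx.1 hy.1 hxz hzy
    ⟨hz, fun h => hy.2 (hs z y hz hy.1 h hzy)⟩

variable [Fintype S]

open Classical in
-- Truncating the image of `g` to `p` loses nothing that could return to `p`, since every basis
-- vector between two elements of `p` is in `p`. So the differential of the subquotient also squares
-- to zero.
theorem IsInterval.sum_eq_zero {p : S → Prop} (hp : IsInterval D p)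
    (hsq : ∀ x y, ∑ z, D x z * D z y = 0) {g : S → ℤ} (hg : ∀ x, g x ≠ 0 → p x) {y : S} (hy : p y) :
    ∑ x, (if p x then ∑ z, g z * D z x else 0) * D x y = 0 := by
  have h1 : ∀ x, (if p x then ∑ z, g z * D z x else 0) * D x y = ∑ z, g z * (D z x * D x y) := by
    intro x
    split_ifs with hx
    · rw [Finset.sum_mul]
      exact Finset.sum_congr rfl fun z _ => mul_assoc _ _ _
    · rw [zero_mul]
      refine (Finset.sum_eq_zero fun z _ => ?_).symm
      by_contra h
      have h2 := left_ne_zero_of_mul h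
      have h3 := right_ne_zero_of_mul h
      exact hx (hp z y x (hg z h2) hy (left_ne_zero_of_mul h3) (right_ne_zero_of_mul h3))
  rw [Finset.sum_congr rfl fun x _ => h1 x, Finset.sum_comm]
  refine Finset.sum_eq_zero fun z _ => ?_
  rw [← Finset.mul_sum, hsq, mul_zero]

open Classical in
/-- An extension of exact subquotients is exact. -/
theorem ExactOn.extension {p : S → Prop} (s : S → Prop) {i : ℤ} (hp : IsInterval D p)
    (hsq : ∀ x y, ∑ z, D x z * D z y = 0) (hdeg : ∀ x y, D x y ≠ 0 → deg y = deg x + 1)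
    (hs : ∀ x y, p x → p y → s x → D x y ≠ 0 → s y)
    (h1 : ExactOn D deg (fun x => p x ∧ ¬ s x) i) (h2 : ExactOn D deg (fun x => p x ∧ s x) i) :
    ExactOn D deg p i := by
  intro f hf hcf
  -- Solve the equation in the quotient first. The remaining defect `f - d g₁` is a cycle of the
  -- subcomplex, where `h2` applies.
  obtain ⟨g₁, hg₁, hg₁f⟩ := h1 (fun x => if s x then 0 else f x)
    (fun x hx => by
      simp only [ne_eq, ite_eq_left_iff, Classical.not_imp] at hx
      exact ⟨⟨(hf x hx.2).1, hx.1⟩, (hf x hx.2).2⟩)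
    (fun y hy => by
      refine Eq.trans (Finset.sum_congr rfl fun x _ => ?_) (hcf y hy.1)
      by_cases hx : s x
      · rw [if_pos hx, zero_mul]
        by_contra h
        have h' := Ne.symm h
        exact hy.2 (hs x y (hf x (left_ne_zero_of_mul h')).1 hy.1 hx (right_ne_zero_of_mul h'))
      · rw [if_neg hx])
  have hg₁p : ∀ x, g₁ x ≠ 0 → p x := fun x hx => (hg₁ x hx).1.1
  obtain ⟨g₂, hg₂, hg₂f⟩ := h2 (fun y => f y - if p y then ∑ x, g₁ x * D x y else 0)
    (fun y hy => by
      have hpy : p y := by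
        by_contra h
        rw [if_neg h, sub_zero] at hy
        exact h (hf y hy).1
      rw [if_pos hpy] at hy
      refine ⟨⟨hpy, ?_⟩, ?_⟩
      · by_contra h
        rw [hg₁f y ⟨hpy, h⟩, if_neg h, sub_self] at hy
        exact hy rfl
      · by_cases h0 : f y = 0
        · rw [h0, zero_sub, neg_ne_zero] at hy
          obtain ⟨x, -, hx⟩ := Finset.exists_ne_zero_of_sum_ne_zero hy
          rw [hdeg x y (right_ne_zero_of_mul hx), (hg₁ x (left_ne_zero_of_mul hx)).2]
          ring
        · exact (hf y h0).2)
    (fun y hy => by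
      simp only [sub_mul, Finset.sum_sub_distrib]
      rw [hcf y hy.1, hp.sum_eq_zero hsq hg₁p hy.1, sub_zero])
  refine ⟨fun x => g₁ x + g₂ x, fun x hx => ?_, fun y hy => ?_⟩
  · by_cases h0 : g₁ x = 0
    · have : g₂ x ≠ 0 := by
        simpa [h0] using hx
      exact ⟨(hg₂ x this).1.1, (hg₂ x this).2⟩
    · exact ⟨(hg₁ x h0).1.1, (hg₁ x h0).2⟩
  · simp only [add_mul, Finset.sum_add_distrib]
    by_cases hsy : s y
    · rw [hg₂f y ⟨hy, hsy⟩, if_pos hy]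
      ring
    · rw [hg₁f y ⟨hy, hsy⟩, if_neg hsy]
      have : ∑ x, g₂ x * D x y = 0 := by
        refine Finset.sum_eq_zero fun x _ => ?_
        by_contra h
        have hx := (hg₂ x (left_ne_zero_of_mul h)).1
        exact hsy (hs x y hx.1 hy hx.2 (right_ne_zero_of_mul h))
      rw [this, add_zero]

/-- The mapping cone of an isomorphism given by a perfect matching of the bases is exact. -/
theorem ExactOn.of_matching {p : S → Prop} (s : S → Prop) (i : ℤ) (hp : IsInterval D p)
    (hsq : ∀ x y, ∑ z, D x z * D z y = 0) (hdeg : ∀ x y, D x y ≠ 0 → deg y = deg x + 1)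
    (h1 : ∀ x, p x → ¬ s x → ∃ y, (p y ∧ s y ∧ IsUnit (D x y)) ∧
      ∀ y', p y' → s y' → D x y' ≠ 0 → y' = y)
    (h2 : ∀ y, p y → s y → ∃ x, (p x ∧ ¬ s x ∧ IsUnit (D x y)) ∧
      ∀ x', p x' → ¬ s x' → D x' y ≠ 0 → x' = x) :
    ExactOn D deg p i := by
  classical
  intro f hf hcf
  choose! τ hτ hτu using h1
  -- A unit of `ℤ` is its own inverse, so this chain solves `d g = f` on the half `s`.
  let g : S → ℤ := fun x => if p x ∧ ¬ s x then D x (τ x) * f (τ x) else 0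
  have hg : ∀ x, g x ≠ 0 → (p x ∧ ¬ s x) ∧ f (τ x) ≠ 0 := by
    intro x hx
    by_cases h : p x ∧ ¬ s x
    · refine ⟨h, fun h0 => hx ?_⟩
      simp [g, h0]
    · exact absurd (if_neg h) hx
  have hgs : ∀ y, p y → s y → ∑ x, g x * D x y = f y := by
    intro y hy hsy
    obtain ⟨x, ⟨hx, hxs, hxy⟩, hxu⟩ := h2 y hy hsy
    have hτx : τ x = y := (hτu x hx hxs y hy hsy hxy.ne_zero).symm
    rw [Finset.sum_eq_single x]
    · simp only [g]
      rw [if_pos ⟨hx, hxs⟩, hτx]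
      have := Int.isUnit_mul_self hxy
      linear_combination f y * this
    · intro x' _ hx'
      by_contra h
      have h3 := (hg x' (left_ne_zero_of_mul h)).1
      exact hx' (hxu x' h3.1 h3.2 (right_ne_zero_of_mul h))
    · simp
  refine ⟨g, fun x hx => ?_, fun y hy => ?_⟩
  · obtain ⟨⟨hx1, hx2⟩, hx3⟩ := hg x hx
    refine ⟨hx1, ?_⟩
    have e1 := hdeg x (τ x) (hτ x hx1 hx2).2.2.ne_zero
    have e2 := (hf _ hx3).2
    omega
  · by_cases hsy : s y
    · exact hgs y hy hsy
    -- On the other half, `d g - f` is a cycle that vanishes on `s`. Its component at `y` is the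
    -- only one that reaches `τ y`, and does so with a unit coefficient, hence it is zero.
    obtain ⟨hpt, hst, hu⟩ := hτ y hy hsy
    have key := hp.sum_eq_zero hsq (fun x hx => (hg x hx).1.1) hpt
    have hcz := hcf _ hpt
    have hsub : ∑ x, ((if p x then ∑ z, g z * D z x else 0) - f x) * D x (τ y) = 0 := by
      simp only [sub_mul, Finset.sum_sub_distrib]
      rw [key, hcz, sub_zero]
    rw [Finset.sum_eq_single y] at hsub
    · rw [if_pos hy] at hsub
      have := (mul_eq_zero.1 hsub).resolve_right hu.ne_zero
      linarith
    · intro x _ hxy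
      by_cases hpx : p x
      · rw [if_pos hpx]
        by_cases hsx : s x
        · rw [hgs x hpx hsx, sub_self, zero_mul]
        · by_contra h
          have hD := right_ne_zero_of_mul h
          obtain ⟨x0, -, hx0⟩ := h2 (τ y) hpt hst
          exact hxy ((hx0 x hpx hsx hD).trans (hx0 y hy hsy hu.ne_zero).symm)
      · rw [if_neg hpx]
        by_cases h0 : f x = 0
        · simp [h0]
        · exact absurd (hf x h0).1 hpx
    · simp

theorem ExactOn.of_isEmpty {p : S → Prop} {i : ℤ} (h : ∀ x, p x → deg x ≠ i) :
    ExactOn D deg p i := by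
  intro f hf _
  have hf0 : ∀ x, f x = 0 := fun x => by
    by_contra hx
    exact h x (hf x hx).1 (hf x hx).2
  exact ⟨0, fun x hx => absurd rfl hx, fun y _ => by simp [hf0]⟩

/-- A direct summand of an exact complex is exact. -/
theorem ExactOn.summand {p : S → Prop} (s : S → Prop) {i : ℤ} (h : ExactOn D deg p i)
    (hs : ∀ x y, p x → p y → D x y ≠ 0 → (s x ↔ s y)) :
    ExactOn D deg (fun x => p x ∧ s x) i := by
  classical
  intro f hf hcf
  obtain ⟨g, hg, hgf⟩ := h f (fun x hx => ⟨(hf x hx).1.1, (hf x hx).2⟩) (fun y hy => by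
    by_cases hsy : s y
    · exact hcf y ⟨hy, hsy⟩
    · refine Finset.sum_eq_zero fun x _ => ?_
      by_contra h0
      have hx := (hf x (left_ne_zero_of_mul h0)).1
      exact hsy ((hs x y hx.1 hy (right_ne_zero_of_mul h0)).1 hx.2))
  refine ⟨fun x => if s x then g x else 0, fun x hx => ?_, fun y hy => ?_⟩
  · beta_reduce at hx
    by_cases hsx : s x
    · rw [if_pos hsx] at hx
      exact ⟨⟨(hg x hx).1, hsx⟩, (hg x hx).2⟩
    · exact absurd (if_neg hsx) hx
  · rw [← hgf y hy.1]
    refine Finset.sum_congr rfl fun x _ => ?_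
    beta_reduce
    by_cases hsx : s x
    · rw [if_pos hsx]
    · rw [if_neg hsx, zero_mul]
      by_contra h0
      have h0 := Ne.symm h0
      exact hsx ((hs x y (hg x (left_ne_zero_of_mul h0)).1 hy.1 (right_ne_zero_of_mul h0)).2 hy.2)

theorem ExactOn.congr {p p' : S → Prop} {i : ℤ} (h : ExactOn D deg p i) (hpp : ∀ x, p x ↔ p' x) :
    ExactOn D deg p' i := by
  have : p = p' := funext fun x => propext (hpp x)
  exact this ▸ h

end BasedComplex

end Khovanov

namespace Khovanov

/-! ### Cycles of a permutation multiplied by a transposition -/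

section SwapCycles

open Equiv Equiv.Perm

variable {α : Type*} [Finite α] [DecidableEq α]

/-- From `a` the product jumps to `f b` and then follows the `f`-cycle of `b`, which avoids `a`,
until it reaches `b` for the first time. -/
theorem sameCycle_mul_swap_of_not_sameCycle (f : Perm α) {a b : α} (h : ¬ SameCycle f a b) :
    SameCycle (f * swap a b) a b := by
  classical
  have hex : ∃ n, 0 < n ∧ (f ^ n) b = b :=
    ⟨orderOf f, orderOf_pos f, by rw [pow_orderOf_eq_one]; rfl⟩
  obtain ⟨h0, hn⟩ := Nat.find_spec hex
  set n := Nat.find hex with hndef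
  have key : ∀ j, j < n → ((f * swap a b) ^ (j + 1)) a = (f ^ (j + 1)) b := by
    intro j
    induction j with
    | zero => intro _; simp
    | succ j ih =>
      intro hj
      rw [pow_succ', Perm.mul_apply, ih (by omega), Perm.mul_apply, swap_apply_of_ne_of_ne,
        pow_succ' f (j + 1), Perm.mul_apply]
      · intro hab
        exact h (SameCycle.symm ⟨(j + 1 : ℕ), by rw [zpow_natCast]; exact hab⟩)
      · intro hb
        exact Nat.find_min hex hj ⟨by omega, hb⟩
  refine ⟨(n : ℕ), ?_⟩
  rw [zpow_natCast]
  obtain ⟨j, hj⟩ : ∃ j, n = j + 1 := ⟨n - 1, by omega⟩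
  rw [hj, key j (by omega), ← hj, hn]

/-- If `n` is the least positive number with `f^n a = b`, the forward orbit of `b` under the product
stays among `f a, …, f^n a`, because the swap sends it from `b` back to `f a`. None of these points
is `a`. -/
theorem not_sameCycle_mul_swap_of_sameCycle (f : Perm α) {a b : α} (hab : a ≠ b)
    (h : SameCycle f a b) : ¬ SameCycle (f * swap a b) a b := by
  classical
  have hex : ∃ n, 0 < n ∧ (f ^ n) a = b := by
    obtain ⟨i, hi, -, h⟩ := h.exists_pow_eq''
    exact ⟨i, hi, h⟩
  obtain ⟨h0, hn⟩ := Nat.find_spec hex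
  set n := Nat.find hex with hndef
  have hmin : ∀ j, 0 < j → j < n → (f ^ j) a ≠ b := fun j hj hjn hb =>
    Nat.find_min hex hjn ⟨hj, hb⟩
  have hmina : ∀ j, 0 < j → j ≤ n → (f ^ j) a ≠ a := by
    intro j hj hjn ha
    rcases hjn.lt_or_eq with hlt | rfl
    · refine hmin (n - j) (by omega) (by omega) ?_
      have : (f ^ (n - j + j)) a = b := by rw [Nat.sub_add_cancel hjn]; exact hn
      rwa [pow_add, Perm.mul_apply, ha] at this
    · exact hab (ha.symm.trans hn)
  have key : ∀ i : ℕ, ∃ j, 0 < j ∧ j ≤ n ∧ ((f * swap a b) ^ i) b = (f ^ j) a := by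
    intro i
    induction i with
    | zero => exact ⟨n, h0, le_rfl, by simpa using hn.symm⟩
    | succ i ih =>
      obtain ⟨j, hj0, hjn, hj⟩ := ih
      rw [pow_succ', Perm.mul_apply, hj]
      rcases hjn.lt_or_eq with hlt | rfl
      · refine ⟨j + 1, by omega, by omega, ?_⟩
        rw [Perm.mul_apply, swap_apply_of_ne_of_ne (hmina j hj0 hjn) (hmin j hj0 hlt), pow_succ',
          Perm.mul_apply]
      · refine ⟨1, by omega, by omega, ?_⟩
        rw [hn, Perm.mul_apply, swap_apply_right, pow_one]
  intro hs
  obtain ⟨i, -, -, hi⟩ := hs.symm.exists_pow_eq''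
  obtain ⟨j, hj0, hjn, hj⟩ := key i
  exact hmina j hj0 hjn (hj.symm.trans hi)

end SwapCycles

/-! ### Circles of a resolution as cycles of a permutation -/

section Circles

variable {m : ℕ} (w : BraidWord m)

/-- The bottom left end of a crossing. -/
abbrev bottomLeft (k : Fin w.crossings) : Point w := (k.castSucc, leftStrand w k)

/-- The top right end of a crossing. -/
abbrev topRight (k : Fin w.crossings) : Point w := (k.succ, rightStrand w k)

/-- Two points lie on the same circle. -/
def Conn (e : Resolution w) (p q : Point w) : Prop := circleAt w e p = circleAt w e q

variable {w}

theorem Conn.refl (e : Resolution w) (p : Point w) : Conn w e p p := rfl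

theorem Conn.symm {e : Resolution w} {p q : Point w} (h : Conn w e p q) : Conn w e q p := Eq.symm h

theorem Conn.trans {e : Resolution w} {p q r : Point w} (h : Conn w e p q) (h' : Conn w e q r) :
    Conn w e p r := Eq.trans h h'

theorem Conn.of_arc {e : Resolution w} {p q : Point w} (h : Arc w e p q) : Conn w e p q :=
  Quot.sound h

theorem Conn.rec_equivalence {e : Resolution w} {r : Point w → Point w → Prop} (hr : Equivalence r)
    (h : ∀ p q, Arc w e p q → r p q) {p q : Point w} (hpq : Conn w e p q) : r p q := by
  have h1 := Quot.eqvGen_exact hpq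
  induction h1 with
  | rel _ _ h' => exact h _ _ h'
  | refl _ => exact hr.refl _
  | symm _ _ _ ih => exact hr.symm (ih (Quot.eqvGen_sound ‹_›))
  | trans _ _ _ _ _ ih1 ih2 =>
    exact hr.trans (ih1 (Quot.eqvGen_sound ‹_›)) (ih2 (Quot.eqvGen_sound ‹_›))

/-- A set of points closed under arcs is a union of circles. -/
theorem Conn.mem_iff {e : Resolution w} {Z : Point w → Prop}
    (h : ∀ p q, Arc w e p q → (Z p ↔ Z q)) {p q : Point w} (hpq : Conn w e p q) : Z p ↔ Z q :=
  Conn.rec_equivalence (r := fun p q => Z p ↔ Z q)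
    ⟨fun _ => Iff.rfl, fun h => h.symm, fun h h' => h.trans h'⟩ h hpq

open Classical in
/-- Orient the strands alternately, upwards those of the parity of `β`.  The other starting point of
an oriented arc at the crossing next to a given starting point, if that crossing is a cap and a cup;
otherwise the point itself. -/
noncomputable def mate (e : Resolution w) (β : ℕ) (p : Point w) : Point w :=
  if p.2.val % 2 = β % 2 then
    Fin.lastCases (motive := fun _ => Point w) p (fun k =>
      if ¬ isVertical w e k ∧ (p.2 = leftStrand w k ∨ p.2 = rightStrand w k) then
        (k.succ, Equiv.swap (leftStrand w k) (rightStrand w k) p.2) else p) p.1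
  else
    Fin.cases (motive := fun _ => Point w) p (fun k =>
      if ¬ isVertical w e k ∧ (p.2 = leftStrand w k ∨ p.2 = rightStrand w k) then
        (k.castSucc, Equiv.swap (leftStrand w k) (rightStrand w k) p.2) else p) p.1

theorem swap_parity {k : Fin w.crossings} {s : Fin m} (h : s = leftStrand w k ∨ s = rightStrand w k)
    (β : ℕ) : (Equiv.swap (leftStrand w k) (rightStrand w k) s).val % 2 = β % 2 ↔
      ¬ s.val % 2 = β % 2 := by
  rcases h with rfl | rfl
  · rw [Equiv.swap_apply_left]
    simp only [leftStrand, rightStrand]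
    omega
  · rw [Equiv.swap_apply_right]
    simp only [leftStrand, rightStrand]
    omega

theorem swap_mem {k : Fin w.crossings} {s : Fin m}
    (h : s = leftStrand w k ∨ s = rightStrand w k) :
    Equiv.swap (leftStrand w k) (rightStrand w k) s = leftStrand w k ∨
      Equiv.swap (leftStrand w k) (rightStrand w k) s = rightStrand w k := by
  rcases h with rfl | rfl <;> simp

theorem mate_involutive (e : Resolution w) (β : ℕ) : Function.Involutive (mate e β) := by
  rintro ⟨t, s⟩
  by_cases hs : s.val % 2 = β % 2
  · cases t using Fin.lastCases with
    | last => simp [mate, hs]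
    | cast k =>
      by_cases hc : ¬ isVertical w e k ∧ (s = leftStrand w k ∨ s = rightStrand w k)
      · have h1 : mate e β (k.castSucc, s) =
            (k.succ, Equiv.swap (leftStrand w k) (rightStrand w k) s) := by
          simp only [mate, if_pos hs, Fin.lastCases_castSucc, if_pos hc]
        rw [h1]
        have h2 := (swap_parity hc.2 β).not.2 (not_not.2 hs)
        have h3 := swap_mem hc.2
        simp only [mate, if_neg h2, Fin.cases_succ]
        rw [if_pos ⟨hc.1, h3⟩, Equiv.swap_apply_self]
      · have h1 : mate e β (k.castSucc, s) = (k.castSucc, s) := by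
          simp only [mate, if_pos hs, Fin.lastCases_castSucc, if_neg hc]
        rw [h1, h1]
  · cases t using Fin.cases with
    | zero => simp [mate, hs]
    | succ k =>
      by_cases hc : ¬ isVertical w e k ∧ (s = leftStrand w k ∨ s = rightStrand w k)
      · have h1 : mate e β (k.succ, s) =
            (k.castSucc, Equiv.swap (leftStrand w k) (rightStrand w k) s) := by
          simp only [mate, if_neg hs, Fin.cases_succ, if_pos hc]
        rw [h1]
        have h2 := (swap_parity hc.2 β).2 hs
        have h3 := swap_mem hc.2
        simp only [mate, if_pos h2, Fin.lastCases_castSucc]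
        rw [if_pos ⟨hc.1, h3⟩, Equiv.swap_apply_self]
      · have h1 : mate e β (k.succ, s) = (k.succ, s) := by
          simp only [mate, if_neg hs, Fin.cases_succ, if_neg hc]
        rw [h1, h1]

/-- Following the alternately oriented circles. -/
noncomputable def next (e : Resolution w) (β : ℕ) : Equiv.Perm (Point w) :=
  Equiv.prodCongrLeft (fun s : Fin m =>
    if s.val % 2 = β % 2 then finRotate (w.crossings + 1) else (finRotate (w.crossings + 1)).symm) *
  (mate_involutive e β).toPerm

section next

variable (e : Resolution w) {β : ℕ} {s : Fin m} (k : Fin w.crossings)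

theorem finRotate_castSucc' {n : ℕ} (k : Fin n) : finRotate (n + 1) k.castSucc = k.succ := by
  rw [finRotate_apply, Fin.coeSucc_eq_succ]

theorem next_last (hs : s.val % 2 = β % 2) : next e β (Fin.last _, s) = (0, s) := by
  simp [next, mate, hs, Equiv.prodCongrLeft]

theorem next_zero (hs : ¬ s.val % 2 = β % 2) : next e β (0, s) = (Fin.last _, s) := by
  simp only [next, mate, hs, Equiv.Perm.mul_apply, Function.Involutive.coe_toPerm, if_false,
    Fin.cases_zero, Equiv.prodCongrLeft_apply, Prod.mk.injEq, and_true, Equiv.symm_apply_eq,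
    finRotate_last]

open Classical in
theorem next_castSucc (hs : s.val % 2 = β % 2) : next e β (k.castSucc, s) =
    if ¬ isVertical w e k ∧ (s = leftStrand w k ∨ s = rightStrand w k) then
      (k.castSucc, Equiv.swap (leftStrand w k) (rightStrand w k) s) else (k.succ, s) := by
  by_cases hc : ¬ isVertical w e k ∧ (s = leftStrand w k ∨ s = rightStrand w k)
  · have h1 : mate e β (k.castSucc, s) =
        (k.succ, Equiv.swap (leftStrand w k) (rightStrand w k) s) := by
      simp only [mate, if_pos hs, Fin.lastCases_castSucc, if_pos hc]
    have h2 := (swap_parity hc.2 β).not.2 (not_not.2 hs)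
    rw [if_pos hc, next, Equiv.Perm.mul_apply, Function.Involutive.coe_toPerm, h1,
      Equiv.prodCongrLeft_apply, if_neg h2]
    simp only [Prod.mk.injEq, and_true, Equiv.symm_apply_eq, finRotate_castSucc']
  · have h1 : mate e β (k.castSucc, s) = (k.castSucc, s) := by
      simp only [mate, if_pos hs, Fin.lastCases_castSucc, if_neg hc]
    rw [if_neg hc, next, Equiv.Perm.mul_apply, Function.Involutive.coe_toPerm, h1,
      Equiv.prodCongrLeft_apply, if_pos hs]
    simp only [finRotate_castSucc']

open Classical in
theorem next_succ (hs : ¬ s.val % 2 = β % 2) : next e β (k.succ, s) =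
    if ¬ isVertical w e k ∧ (s = leftStrand w k ∨ s = rightStrand w k) then
      (k.succ, Equiv.swap (leftStrand w k) (rightStrand w k) s) else (k.castSucc, s) := by
  by_cases hc : ¬ isVertical w e k ∧ (s = leftStrand w k ∨ s = rightStrand w k)
  · have h1 : mate e β (k.succ, s) =
        (k.castSucc, Equiv.swap (leftStrand w k) (rightStrand w k) s) := by
      simp only [mate, if_neg hs, Fin.cases_succ, if_pos hc]
    have h2 := (swap_parity hc.2 β).2 hs
    rw [if_pos hc, next, Equiv.Perm.mul_apply, Function.Involutive.coe_toPerm, h1,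
      Equiv.prodCongrLeft_apply, if_pos h2]
    simp only [finRotate_castSucc']
  · have h1 : mate e β (k.succ, s) = (k.succ, s) := by
      simp only [mate, if_neg hs, Fin.cases_succ, if_neg hc]
    rw [if_neg hc, next, Equiv.Perm.mul_apply, Function.Involutive.coe_toPerm, h1,
      Equiv.prodCongrLeft_apply, if_neg hs]
    simp only [Prod.mk.injEq, and_true, Equiv.symm_apply_eq, finRotate_castSucc']

end next

theorem conn_next (e : Resolution w) (β : ℕ) (p : Point w) : Conn w e p (next e β p) := by
  obtain ⟨t, s⟩ := p
  by_cases hs : s.val % 2 = β % 2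
  · cases t using Fin.lastCases with
    | last => rw [next_last e hs]; exact .of_arc (.closing s)
    | cast k =>
      rw [next_castSucc e k hs]
      split_ifs with hc
      · obtain ⟨hv, rfl | rfl⟩ := hc
        · rw [Equiv.swap_apply_left]; exact .of_arc (.cap k hv)
        · rw [Equiv.swap_apply_right]; exact (Conn.of_arc (.cap k hv)).symm
      · by_cases hl : s = leftStrand w k
        · subst hl; exact .of_arc (.verticalLeft k (by tauto))
        · by_cases hr : s = rightStrand w k
          · subst hr; exact .of_arc (.verticalRight k (by tauto))
          · exact .of_arc (.pass k s hl hr)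
  · cases t using Fin.cases with
    | zero => rw [next_zero e hs]; exact (Conn.of_arc (.closing s)).symm
    | succ k =>
      rw [next_succ e k hs]
      split_ifs with hc
      · obtain ⟨hv, rfl | rfl⟩ := hc
        · rw [Equiv.swap_apply_left]; exact .of_arc (.cup k hv)
        · rw [Equiv.swap_apply_right]; exact (Conn.of_arc (.cup k hv)).symm
      · by_cases hl : s = leftStrand w k
        · subst hl; exact (Conn.of_arc (.verticalLeft k (by tauto))).symm
        · by_cases hr : s = rightStrand w k
          · subst hr; exact (Conn.of_arc (.verticalRight k (by tauto))).symm
          · exact (Conn.of_arc (.pass k s hl hr)).symm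

theorem next_of_arc {e : Resolution w} (β : ℕ) {p q : Point w} (h : Arc w e p q) :
    next e β p = q ∨ next e β q = p := by
  classical
  have hpar : ∀ k, (leftStrand w k).val % 2 = β % 2 ↔ ¬ (rightStrand w k).val % 2 = β % 2 := by
    intro k; simp only [leftStrand, rightStrand]; omega
  have up : ∀ (k : Fin w.crossings) (s : Fin m),
      ¬ (¬ isVertical w e k ∧ (s = leftStrand w k ∨ s = rightStrand w k)) →
      next e β (k.castSucc, s) = (k.succ, s) ∨ next e β (k.succ, s) = (k.castSucc, s) := by
    intro k s hc
    by_cases hs : s.val % 2 = β % 2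
    · left; rw [next_castSucc e k hs, if_neg hc]
    · right; rw [next_succ e k hs, if_neg hc]
  cases h with
  | closing s =>
    by_cases hs : s.val % 2 = β % 2
    · exact .inl (next_last e hs)
    · exact .inr (next_zero e hs)
  | pass k s hl hr => exact up k s (by tauto)
  | verticalLeft k h => exact up k _ (by tauto)
  | verticalRight k h => exact up k _ (by tauto)
  | cap k h =>
    by_cases hs : (leftStrand w k).val % 2 = β % 2
    · left
      rw [next_castSucc e k hs, if_pos ⟨h, .inl rfl⟩, Equiv.swap_apply_left]
    · right
      rw [next_castSucc e k (not_not.1 ((hpar k).not.1 hs)), if_pos ⟨h, .inr rfl⟩,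
        Equiv.swap_apply_right]
  | cup k h =>
    by_cases hs : (leftStrand w k).val % 2 = β % 2
    · right
      rw [next_succ e k ((hpar k).1 hs), if_pos ⟨h, .inr rfl⟩, Equiv.swap_apply_right]
    · left
      rw [next_succ e k hs, if_pos ⟨h, .inl rfl⟩, Equiv.swap_apply_left]

/-- Neighbouring strands are oriented oppositely, so both resolutions of every crossing respect the
orientation, and each circle becomes one cycle. As the orientation does not depend on the
resolution, the permutations of different resolutions can be compared. -/
theorem conn_iff_sameCycle (e : Resolution w) (β : ℕ) (p q : Point w) :
    Conn w e p q ↔ Equiv.Perm.SameCycle (next e β) p q := by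
  constructor
  · refine Conn.rec_equivalence (Equiv.Perm.SameCycle.equivalence _) ?_
    intro p q h
    rcases next_of_arc β h with h | h
    · rw [← h]; exact ⟨1, by simp⟩
    · rw [← h]; exact Equiv.Perm.SameCycle.symm ⟨1, by simp⟩
  · intro h
    obtain ⟨i, -, -, hi⟩ := h.exists_pow_eq''
    subst hi
    clear h
    induction i with
    | zero => exact Conn.refl _ _
    | succ i ih =>
      rw [pow_succ', Equiv.Perm.mul_apply]
      exact ih.trans (conn_next _ _ _)

/-- The other resolution of the `k`-th crossing. -/
def flip (e : Resolution w) (k : Fin w.crossings) : Resolution w := Function.update e k (!e k)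

theorem flip_of_ne (e : Resolution w) {k l : Fin w.crossings} (h : l ≠ k) : flip e k l = e l :=
  Function.update_of_ne h _ _

@[simp] theorem flip_self (e : Resolution w) (k : Fin w.crossings) : flip e k k = !e k :=
  Function.update_self _ _ _

@[simp] theorem flip_flip (e : Resolution w) (k : Fin w.crossings) : flip (flip e k) k = e := by
  funext l
  by_cases h : l = k
  · subst h; simp
  · rw [flip_of_ne _ h, flip_of_ne _ h]

theorem isVertical_flip_self (e : Resolution w) (k : Fin w.crossings) :
    isVertical w (flip e k) k ↔ ¬ isVertical w e k := by
  simp only [isVertical, flip_self]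
  cases e k <;> cases isPositive w k <;> simp

theorem isVertical_flip_of_ne (e : Resolution w) {k l : Fin w.crossings} (h : l ≠ k) :
    isVertical w (flip e k) l ↔ isVertical w e l := by
  simp only [isVertical, flip_of_ne e h]

theorem bottomLeft_ne_topRight (k : Fin w.crossings) : bottomLeft w k ≠ topRight w k := by
  intro h
  have := congrArg (fun p : Point w => p.1.val) h
  simp at this

/-- When the left strand of the crossing points upwards, `bottomLeft` and `topRight` are the two
points from which the oriented circles enter the crossing. Changing its resolution exchanges their
successors and nothing else. -/
theorem next_flip (e : Resolution w) (k : Fin w.crossings) :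
    next (flip e k) (leftStrand w k).val =
      next e (leftStrand w k).val * Equiv.swap (bottomLeft w k) (topRight w k) := by
  classical
  have hR : ¬ (rightStrand w k).val % 2 = (leftStrand w k).val % 2 := by
    simp only [leftStrand, rightStrand]; omega
  have ha : ∀ e : Resolution w, next e (leftStrand w k).val (bottomLeft w k) =
      if isVertical w e k then (k.succ, leftStrand w k) else (k.castSucc, rightStrand w k) := by
    intro e
    rw [next_castSucc e k rfl]
    by_cases h : isVertical w e k <;> simp [h]
  have hb : ∀ e : Resolution w, next e (leftStrand w k).val (topRight w k) =
      if isVertical w e k then (k.castSucc, rightStrand w k) else (k.succ, leftStrand w k) := by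
    intro e
    rw [next_succ e k hR]
    by_cases h : isVertical w e k <;> simp [h]
  ext1 p
  rw [Equiv.Perm.mul_apply]
  by_cases hpa : p = bottomLeft w k
  · rw [hpa, Equiv.swap_apply_left, ha, hb]
    by_cases h : isVertical w e k <;> simp [isVertical_flip_self, h]
  by_cases hpb : p = topRight w k
  · rw [hpb, Equiv.swap_apply_right, ha, hb]
    by_cases h : isVertical w e k <;> simp [isVertical_flip_self, h]
  rw [Equiv.swap_apply_of_ne_of_ne hpa hpb]
  obtain ⟨t, s⟩ := p
  by_cases hs : s.val % 2 = (leftStrand w k).val % 2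
  · cases t using Fin.lastCases with
    | last => rw [next_last _ hs, next_last _ hs]
    | cast l =>
      rw [next_castSucc _ _ hs, next_castSucc _ _ hs]
      by_cases hl : l = k
      · subst hl
        have h1 : s ≠ leftStrand w l := fun h => hpa (by rw [h])
        have h2 : s ≠ rightStrand w l := fun h => hR (h ▸ hs)
        simp [h1, h2]
      · simp only [isVertical_flip_of_ne e hl]
  · cases t using Fin.cases with
    | zero => rw [next_zero _ hs, next_zero _ hs]
    | succ l =>
      rw [next_succ _ _ hs, next_succ _ _ hs]
      by_cases hl : l = k
      · subst hl
        have h1 : s ≠ leftStrand w l := fun h => hs (by rw [h])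
        have h2 : s ≠ rightStrand w l := fun h => hpb (by rw [h])
        simp [h1, h2]
      · simp only [isVertical_flip_of_ne e hl]

/-- Changing the resolution of a crossing merges two circles or splits one. -/
theorem conn_flip_iff (e : Resolution w) (k : Fin w.crossings) :
    Conn w (flip e k) (bottomLeft w k) (topRight w k) ↔
      ¬ Conn w e (bottomLeft w k) (topRight w k) := by
  rw [conn_iff_sameCycle _ (leftStrand w k).val, conn_iff_sameCycle _ (leftStrand w k).val,
    next_flip]
  constructor
  · intro h h'
    exact not_sameCycle_mul_swap_of_sameCycle _ (bottomLeft_ne_topRight k) h' h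
  · exact sameCycle_mul_swap_of_not_sameCycle _

/-- The two points lie on the same circle once the circles at the `k`-th crossing are joined. -/
def ConnJoin (w : BraidWord m) (e : Resolution w) (k : Fin w.crossings) (p q : Point w) : Prop :=
  Conn w e p q ∨
    (Conn w e p (bottomLeft w k) ∨ Conn w e p (topRight w k)) ∧
      (Conn w e q (bottomLeft w k) ∨ Conn w e q (topRight w k))

theorem connJoin_equivalence (e : Resolution w) (k : Fin w.crossings) :
    Equivalence (ConnJoin w e k) where
  refl p := .inl (.refl _ _)
  symm := by
    rintro p q (h | h)
    · exact .inl h.symm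
    · exact .inr ⟨h.2, h.1⟩
  trans := by
    rintro p q r (h | ⟨h1, h2⟩) (h' | ⟨h1', h2'⟩)
    · exact .inl (h.trans h')
    · exact .inr ⟨h1'.imp h.trans h.trans, h2'⟩
    · exact .inr ⟨h1, h2.imp h'.symm.trans h'.symm.trans⟩
    · exact .inr ⟨h1, h2'⟩

/-- In either resolution, each of the two arcs at the crossing contains exactly one of the two
chosen ends. -/
theorem conn_corner (e : Resolution w) (k : Fin w.crossings) (t : Fin (w.crossings + 1))
    (s : Fin m) (ht : t = k.castSucc ∨ t = k.succ) (hs : s = leftStrand w k ∨ s = rightStrand w k) :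
    Conn w e (t, s) (bottomLeft w k) ∨ Conn w e (t, s) (topRight w k) := by
  by_cases h : isVertical w e k
  · rcases hs with rfl | rfl
    · left
      rcases ht with rfl | rfl
      · exact .refl _ _
      · exact (Conn.of_arc (.verticalLeft k h)).symm
    · right
      rcases ht with rfl | rfl
      · exact .of_arc (.verticalRight k h)
      · exact .refl _ _
  · rcases ht with rfl | rfl
    · left
      rcases hs with rfl | rfl
      · exact .refl _ _
      · exact (Conn.of_arc (.cap k h)).symm
    · right
      rcases hs with rfl | rfl
      · exact .of_arc (.cup k h)
      · exact .refl _ _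

theorem connJoin_of_conn_flip {e : Resolution w} {k : Fin w.crossings} {p q : Point w}
    (h : Conn w (flip e k) p q) : ConnJoin w e k p q := by
  refine Conn.rec_equivalence (connJoin_equivalence e k) ?_ h
  have hc : ∀ t s t' s', (t = k.castSucc ∨ t = k.succ) → (s = leftStrand w k ∨ s = rightStrand w k) →
      (t' = k.castSucc ∨ t' = k.succ) → (s' = leftStrand w k ∨ s' = rightStrand w k) →
      ConnJoin w e k (t, s) (t', s') := fun t s t' s' h1 h2 h3 h4 =>
    .inr ⟨conn_corner e k t s h1 h2, conn_corner e k t' s' h3 h4⟩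
  intro p q hpq
  cases hpq with
  | closing s => exact .inl (.of_arc (.closing s))
  | pass l s hl hr => exact .inl (.of_arc (.pass l s hl hr))
  | verticalLeft l hv =>
    by_cases hlk : l = k
    · subst hlk; apply hc <;> simp
    · exact .inl (.of_arc (.verticalLeft l ((isVertical_flip_of_ne e hlk).1 hv)))
  | verticalRight l hv =>
    by_cases hlk : l = k
    · subst hlk; apply hc <;> simp
    · exact .inl (.of_arc (.verticalRight l ((isVertical_flip_of_ne e hlk).1 hv)))
  | cap l hv =>
    by_cases hlk : l = k
    · subst hlk; apply hc <;> simp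
    · exact .inl (.of_arc (.cap l ((isVertical_flip_of_ne e hlk).not.1 hv)))
  | cup l hv =>
    by_cases hlk : l = k
    · subst hlk; apply hc <;> simp
    · exact .inl (.of_arc (.cup l ((isVertical_flip_of_ne e hlk).not.1 hv)))

theorem connJoin_iff_of_conn {e : Resolution w} {k : Fin w.crossings}
    (h : Conn w e (bottomLeft w k) (topRight w k)) {p q : Point w} :
    ConnJoin w e k p q ↔ Conn w e p q := by
  refine ⟨?_, .inl⟩
  rintro (h' | ⟨h1, h2⟩)
  · exact h'
  · have h1' : Conn w e p (topRight w k) := h1.elim (fun h' => h'.trans h) id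
    have h2' : Conn w e q (topRight w k) := h2.elim (fun h' => h'.trans h) id
    exact h1'.trans h2'.symm

/-- Merging two circles. -/
theorem conn_flip_of_not_conn {e : Resolution w} {k : Fin w.crossings}
    (h : ¬ Conn w e (bottomLeft w k) (topRight w k)) {p q : Point w} :
    Conn w (flip e k) p q ↔ ConnJoin w e k p q := by
  refine ⟨connJoin_of_conn_flip, ?_⟩
  have h' := (conn_flip_iff e k).2 h
  -- Read the change backwards: in `flip e k` the two ends are already connected, so joining their
  -- circles adds nothing there.
  have hsub : ∀ {p q}, Conn w e p q → Conn w (flip e k) p q := by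
    intro p q hpq
    rw [← connJoin_iff_of_conn h']
    apply connJoin_of_conn_flip
    rwa [flip_flip]
  rintro (h1 | ⟨h1, h2⟩)
  · exact hsub h1
  · rw [← connJoin_iff_of_conn h']
    exact .inr ⟨h1.imp hsub hsub, h2.imp hsub hsub⟩

theorem Conn.flip {e : Resolution w} {k : Fin w.crossings}
    (h : ¬ Conn w e (bottomLeft w k) (topRight w k)) {p q : Point w} (hpq : Conn w e p q) :
    Conn w (flip e k) p q :=
  (conn_flip_of_not_conn h).2 (.inl hpq)

theorem exists_circleAt {e : Resolution w} (c : Circles w e) : ∃ p, circleAt w e p = c :=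
  Quot.exists_rep c

/-- The circles other than the one through `bottomLeft` correspond bijectively to the circles after
the merge; the merged circle is the image of the one through `topRight`. -/
theorem card_circles_flip {e : Resolution w} {k : Fin w.crossings}
    (h : ¬ Conn w e (bottomLeft w k) (topRight w k)) :
    Fintype.card (Circles w e) = Fintype.card (Circles w (flip e k)) + 1 := by
  classical
  let F : Circles w e → Circles w (flip e k) :=
    Quot.lift (circleAt w (flip e k)) fun p q hpq => Conn.flip h (Conn.of_arc hpq)
  have hF : ∀ p, F (circleAt w e p) = circleAt w (flip e k) p := fun _ => rfl
  let G : {c // c ≠ circleAt w e (bottomLeft w k)} → Circles w (flip e k) := fun c => F c.1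
  have hG : Function.Bijective G := by
    constructor
    · rintro ⟨c, hc⟩ ⟨c', hc'⟩ hcc
      obtain ⟨p, rfl⟩ := exists_circleAt c
      obtain ⟨q, rfl⟩ := exists_circleAt c'
      rw [Subtype.mk.injEq]
      rcases (conn_flip_of_not_conn h).1 (show Conn w (flip e k) p q from hcc) with h' | ⟨h1, h2⟩
      · exact h'
      · exact (h1.resolve_left hc).trans (h2.resolve_left hc').symm
    · intro c
      obtain ⟨p, rfl⟩ := exists_circleAt c
      by_cases hp : Conn w e p (bottomLeft w k)
      · refine ⟨⟨circleAt w e (topRight w k), fun h' => h (Eq.symm h')⟩, ?_⟩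
        exact (conn_flip_of_not_conn h).2 (.inr ⟨.inr (.refl _ _), .inl hp⟩)
      · exact ⟨⟨circleAt w e p, hp⟩, rfl⟩
  have h1 := Fintype.card_of_bijective hG
  have h2 : Fintype.card {c // c ≠ circleAt w e (bottomLeft w k)} =
      Fintype.card (Circles w e) - 1 := Set.card_ne_eq _
  have h3 : 0 < Fintype.card (Circles w e) := Fintype.card_pos_iff.2 ⟨circleAt w e (bottomLeft w k)⟩
  omega

end Circles

end Khovanov

namespace Khovanov

/-! ### Basis states as monomials, and the square of the differential -/

section States

variable {m : ℕ} {w : BraidWord m}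

noncomputable instance (w : BraidWord m) : Fintype (State w) := Fintype.ofFinite _

/-- The label of the circle through a point. -/
def label (x : State w) (p : Point w) : VBasis := x.2 (circleAt w x.1 p)

theorem label_congr (x : State w) {p q : Point w} (h : Conn w x.1 p q) : label x p = label x q :=
  congrArg x.2 h

theorem state_ext {x y : State w} (h : x.1 = y.1) (hl : ∀ p, label x p = label y p) : x = y := by
  obtain ⟨e, f⟩ := x
  obtain ⟨e', g⟩ := y
  dsimp only at h
  subst h
  congr 1
  funext c
  obtain ⟨p, rfl⟩ := exists_circleAt c
  exact hl p

/-- A function on the circles given by a function on the points. -/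
def liftCircles {β : Type*} (e : Resolution w) (f : Point w → β)
    (h : ∀ p q, Conn w e p q → f p = f q) : Circles w e → β :=
  Quot.lift f fun p q hpq => h p q (Conn.of_arc hpq)

/-- The basis vector with given labels. -/
def mkState (e : Resolution w) (f : Point w → VBasis) (h : ∀ p q, Conn w e p q → f p = f q) :
    State w :=
  ⟨e, liftCircles e f h⟩

@[simp] theorem label_mkState (e : Resolution w) (f : Point w → VBasis) (h) (p : Point w) :
    label (mkState e f h) p = f p := rfl

open Classical in
/-- The number of points of `T` on the circle through `p`. -/
noncomputable def cnt (e : Resolution w) (T : Multiset (Point w)) (p : Point w) : ℕ :=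
  T.countP fun q => Conn w e q p

open Classical in
theorem cnt_cons (e : Resolution w) (q : Point w) (T : Multiset (Point w)) (p : Point w) :
    cnt e (q ::ₘ T) p = cnt e T p + if Conn w e q p then 1 else 0 :=
  Multiset.countP_cons _ _ _

theorem cnt_congr (e : Resolution w) (T : Multiset (Point w)) {p q : Point w}
    (h : Conn w e p q) : cnt e T p = cnt e T q := by
  classical
  exact Multiset.countP_congr rfl fun r _ =>
    propext ⟨fun h' => Conn.trans h' h, fun h' => Conn.trans h' h.symm⟩

section flip

variable {e : Resolution w} {k : Fin w.crossings}

theorem cnt_flip_of_not_conn (h : ¬ Conn w e (bottomLeft w k) (topRight w k))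
    (T : Multiset (Point w)) {p : Point w} (ha : ¬ Conn w e p (bottomLeft w k))
    (hb : ¬ Conn w e p (topRight w k)) : cnt (flip e k) T p = cnt e T p := by
  classical
  refine Multiset.countP_congr rfl fun q _ => ?_
  rw [conn_flip_of_not_conn h, ConnJoin]
  simp [ha, hb]

theorem cnt_flip_bottomLeft (h : ¬ Conn w e (bottomLeft w k) (topRight w k))
    (T : Multiset (Point w)) : cnt (flip e k) T (bottomLeft w k) =
      cnt e T (bottomLeft w k) + cnt e T (topRight w k) := by
  classical
  induction T using Multiset.induction_on with
  | empty => simp [cnt]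
  | cons q T ih =>
    rw [cnt_cons, cnt_cons, cnt_cons, ih]
    have h1 : Conn w (flip e k) q (bottomLeft w k) ↔
        Conn w e q (bottomLeft w k) ∨ Conn w e q (topRight w k) := by
      rw [conn_flip_of_not_conn h, ConnJoin]
      have := Conn.refl e (bottomLeft w k)
      tauto
    by_cases ha : Conn w e q (bottomLeft w k)
    · have hb : ¬ Conn w e q (topRight w k) := fun hb => h (ha.symm.trans hb)
      rw [if_pos (h1.2 (.inl ha)), if_pos ha, if_neg hb]
      omega
    · by_cases hb : Conn w e q (topRight w k)
      · rw [if_pos (h1.2 (.inr hb)), if_neg ha, if_pos hb]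
        omega
      · rw [if_neg (by tauto), if_neg ha, if_neg hb]
        omega

theorem cnt_flip_topRight (h : ¬ Conn w e (bottomLeft w k) (topRight w k))
    (T : Multiset (Point w)) : cnt (flip e k) T (topRight w k) =
      cnt e T (bottomLeft w k) + cnt e T (topRight w k) := by
  rw [← cnt_flip_bottomLeft h, cnt_congr _ _ ((conn_flip_iff e k).2 h)]

theorem cnt_le_cnt_flip (h : ¬ Conn w e (bottomLeft w k) (topRight w k))
    (T : Multiset (Point w)) (p : Point w) : cnt e T p ≤ cnt (flip e k) T p := by
  by_cases ha : Conn w e p (bottomLeft w k)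
  · rw [cnt_congr _ _ ha, cnt_congr _ _ (ha.flip h), cnt_flip_bottomLeft h]
    omega
  by_cases hb : Conn w e p (topRight w k)
  · rw [cnt_congr _ _ hb, cnt_congr _ _ (hb.flip h), cnt_flip_topRight h]
    omega
  exact (cnt_flip_of_not_conn h T ha hb).ge

end flip

/-- The monomial `T` represents the basis vector `x`. -/
def Represents (x : State w) (T : Multiset (Point w)) : Prop :=
  ∀ p, cnt x.1 T p = (label x p).val

theorem exists_represents_of_cnt_le {e : Resolution w} {T : Multiset (Point w)}
    (h : ∀ p, cnt e T p ≤ 1) : ∃ x : State w, x.1 = e ∧ Represents x T :=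
  ⟨mkState e (fun p => ⟨cnt e T p, by have := h p; omega⟩)
    (fun p q hpq => by simp only [cnt_congr e T hpq]), rfl, fun _ => rfl⟩

theorem Represents.cnt_le {x : State w} {T : Multiset (Point w)} (h : Represents x T)
    (p : Point w) : cnt x.1 T p ≤ 1 := by
  have := (label x p).isLt
  rw [h p]
  omega

theorem Represents.unique {x y : State w} {T : Multiset (Point w)} (h : Represents x T)
    (h' : Represents y T) (he : x.1 = y.1) : x = y :=
  state_ext he fun p => Fin.ext (by rw [← h p, ← h' p, he])

theorem sum_cnt (e : Resolution w) (T : Multiset (Point w)) (F : Circles w e → ℕ)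
    (hF : ∀ p, F (circleAt w e p) = cnt e T p) : ∑ c, F c = T.card := by
  classical
  induction T using Multiset.induction_on generalizing F with
  | empty =>
    refine Finset.sum_eq_zero fun c _ => ?_
    obtain ⟨p, rfl⟩ := exists_circleAt c
    simp [hF, cnt]
  | cons q T ih =>
    have h1 : ∀ c, F c = liftCircles e (cnt e T) (fun p q h => cnt_congr e T h) c + if circleAt w e q = c then 1 else 0 := by
      intro c
      obtain ⟨p, rfl⟩ := exists_circleAt c
      rw [hF, cnt_cons]
      rfl
    rw [Finset.sum_congr rfl fun c _ => h1 c, Finset.sum_add_distrib, ih _ fun _ => rfl]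
    simp

theorem Represents.qDegree_eq {x : State w} {T : Multiset (Point w)} (h : Represents x T) :
    qDegree x = (homDegree x : ℤ) + Fintype.card (Circles w x.1) - 2 * T.card := by
  rw [qDegree, ← sum_cnt x.1 T (fun c => (x.2 c).val) (fun p => (h p).symm)]
  simp only [vDeg, Finset.sum_sub_distrib, ← Finset.mul_sum, Nat.cast_sum]
  simp
  ring

theorem exists_represents (x : State w) : ∃ T, Represents x T := by
  classical
  choose r hr using fun c : Circles w x.1 => exists_circleAt c
  refine ⟨(Finset.univ.filter fun c => x.2 c = 1).val.map r, fun p => ?_⟩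
  rw [cnt, Multiset.countP_map]
  have h1 : ∀ c : Circles w x.1, Conn w x.1 (r c) p ↔ c = circleAt w x.1 p := by
    intro c
    rw [Conn, hr]
  simp only [h1]
  rw [label, ← Finset.filter_val, Finset.card_val, Finset.filter_filter]
  have h2 : (Finset.univ.filter fun c => x.2 c = 1 ∧ c = circleAt w x.1 p) =
      if x.2 (circleAt w x.1 p) = 1 then {circleAt w x.1 p} else ∅ := by
    ext c
    split_ifs with h
    · simp only [Finset.mem_filter, Finset.mem_univ, true_and, Finset.mem_singleton]
      exact ⟨fun h' => h'.2, fun h' => ⟨h' ▸ h, h'⟩⟩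
    · simp only [Finset.mem_filter, Finset.mem_univ, true_and, Finset.notMem_empty, iff_false]
      exact fun h' => h (h'.2 ▸ h'.1)
  rw [h2]
  generalize x.2 (circleAt w x.1 p) = v
  fin_cases v <;> simp

open Classical in
/-- The coefficient of the basis vector `y` in the monomial `T`. -/
noncomputable def monomialCoeff (y : State w) (T : Multiset (Point w)) : ℤ :=
  if Represents y T then 1 else 0

theorem monomialCoeff_congr (y : State w) (T : Multiset (Point w)) {p q : Point w}
    (h : Conn w y.1 p q) : monomialCoeff y (p ::ₘ T) = monomialCoeff y (q ::ₘ T) := by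
  classical
  have : Represents y (p ::ₘ T) ↔ Represents y (q ::ₘ T) := by
    refine forall_congr' fun r => ?_
    have h1 : Conn w y.1 p r ↔ Conn w y.1 q r := ⟨h.symm.trans, h.trans⟩
    rw [cnt_cons, cnt_cons]
    simp only [h1]
  simp only [monomialCoeff, this]

open Classical in
theorem edgeCoeff_of_not_conn {x y : State w} {k : Fin w.crossings}
    (h : ¬ Conn w x.1 (bottomLeft w k) (topRight w k)) : edgeCoeff w k x y =
      if (∀ p, ¬ Conn w x.1 p (bottomLeft w k) → ¬ Conn w x.1 p (topRight w k) →
        label y p = label x p) ∧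
        (label y (bottomLeft w k)).val =
          (label x (bottomLeft w k)).val + (label x (topRight w k)).val then 1 else 0 := by
  have h' : circleAt w x.1 (bottomLeft w k) ≠ circleAt w x.1 (topRight w k) := h
  simp only [edgeCoeff]
  rw [if_pos h', ite_and]
  rfl

open Classical in
theorem edgeCoeff_of_conn {x y : State w} {k : Fin w.crossings}
    (h : Conn w x.1 (bottomLeft w k) (topRight w k)) : edgeCoeff w k x y =
      if (∀ p, ¬ Conn w x.1 p (bottomLeft w k) → label y p = label x p) ∧
        (label y (bottomLeft w k)).val + (label y (topRight w k)).val =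
          (label x (bottomLeft w k)).val + 1 then 1 else 0 := by
  have h' : ¬ circleAt w x.1 (bottomLeft w k) ≠ circleAt w x.1 (topRight w k) := not_not.2 h
  simp only [edgeCoeff]
  rw [if_neg h', ite_and]
  have h2 : (∀ p : Point w, circleAt w x.1 p ≠ circleAt w x.1 (bottomLeft w k) →
      circleAt w x.1 p ≠ circleAt w x.1 (topRight w k) →
      y.2 (circleAt w y.1 p) = x.2 (circleAt w x.1 p)) ↔
      ∀ p, ¬ Conn w x.1 p (bottomLeft w k) → label y p = label x p := by
    refine forall_congr' fun p => ⟨fun H hp => H hp fun hq => hp (Eq.trans hq h.symm),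
      fun H hp _ => H hp⟩
  simp only [bottomLeft, topRight] at h2 ⊢
  simp only [h2]
  rfl

/-- The module `V_e` is the ring generated by variables `X_p`, one for each point, with `X_p = X_q`
for points on a common circle and `X_p² = 0`. A monomial is a multiset of points. Merging circles is
a quotient map of these rings, so it keeps the monomial. -/
theorem edgeCoeff_merge {x y : State w} {k : Fin w.crossings} (hy : y.1 = flip x.1 k)
    (h : ¬ Conn w x.1 (bottomLeft w k) (topRight w k)) {T : Multiset (Point w)}
    (hT : Represents x T) : edgeCoeff w k x y = monomialCoeff y T := by
  classical
  rw [edgeCoeff_of_not_conn h, monomialCoeff]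
  refine if_congr ⟨fun ⟨h1, h2⟩ p => ?_, fun hr => ⟨fun p hpa hpb => ?_, ?_⟩⟩ rfl rfl
  · by_cases ha : Conn w x.1 p (bottomLeft w k)
    · have ha' : Conn w y.1 p (bottomLeft w k) := hy ▸ ha.flip h
      rw [label_congr y ha', cnt_congr _ _ ha', h2, hy, cnt_flip_bottomLeft h, hT, hT]
    by_cases hb : Conn w x.1 p (topRight w k)
    · have hb' : Conn w y.1 p (bottomLeft w k) :=
        hy ▸ (hb.flip h).trans ((conn_flip_iff _ _).2 h).symm
      rw [label_congr y hb', cnt_congr _ _ hb', h2, hy, cnt_flip_bottomLeft h, hT, hT]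
    rw [h1 p ha hb, hy, cnt_flip_of_not_conn h T ha hb, hT]
  · exact Fin.ext (by rw [← hr p, ← hT p, hy, cnt_flip_of_not_conn h T hpa hpb])
  · rw [← hr, hy, cnt_flip_bottomLeft h, hT, hT]

/-- Splitting is multiplication by `X_a + X_b`, where `a` and `b` are the two ends of the crossing:
`1` goes to `X_a + X_b`, and `X`, lifted to `X_a` or to `X_b`, goes to `X_a X_b`. -/
theorem edgeCoeff_split {x y : State w} {k : Fin w.crossings} (hx : x.1 = flip y.1 k)
    (h : ¬ Conn w y.1 (bottomLeft w k) (topRight w k)) {T : Multiset (Point w)}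
    (hT : Represents x T) : edgeCoeff w k x y =
      monomialCoeff y (bottomLeft w k ::ₘ T) + monomialCoeff y (topRight w k ::ₘ T) := by
  classical
  have hx' : Conn w x.1 (bottomLeft w k) (topRight w k) := hx ▸ (conn_flip_iff _ _).2 h
  have hsum : (label x (bottomLeft w k)).val =
      cnt y.1 T (bottomLeft w k) + cnt y.1 T (topRight w k) := by
    rw [← hT, hx, cnt_flip_bottomLeft h]
  have hba : ¬ Conn w y.1 (topRight w k) (bottomLeft w k) := fun h' => h h'.symm
  have hrep : ∀ q, (Conn w y.1 q (bottomLeft w k) ∨ Conn w y.1 q (topRight w k)) →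
      (Represents y (q ::ₘ T) ↔ (∀ p, ¬ Conn w x.1 p (bottomLeft w k) → label y p = label x p) ∧
      cnt y.1 (q ::ₘ T) (bottomLeft w k) = (label y (bottomLeft w k)).val ∧
      cnt y.1 (q ::ₘ T) (topRight w k) = (label y (topRight w k)).val) := by
    intro q hq
    have hoff : ∀ p, ¬ Conn w x.1 p (bottomLeft w k) →
        cnt y.1 (q ::ₘ T) p = (label x p).val := by
      intro p hp
      have ha : ¬ Conn w y.1 p (bottomLeft w k) := fun h' => hp (hx ▸ h'.flip h)
      have hb : ¬ Conn w y.1 p (topRight w k) := fun h' =>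
        hp ((hx ▸ h'.flip h : Conn w x.1 p (topRight w k)).trans hx'.symm)
      have hqp : ¬ Conn w y.1 q p := fun h' =>
        hq.elim (fun h1 => ha (h'.symm.trans h1)) (fun h1 => hb (h'.symm.trans h1))
      rw [cnt_cons, if_neg hqp, ← hT, hx, cnt_flip_of_not_conn h T ha hb, add_zero]
    refine ⟨fun hr => ⟨fun p hp => Fin.ext ?_, hr _, hr _⟩, fun ⟨h1, h2, h3⟩ p => ?_⟩
    · rw [← hoff p hp, hr p]
    · by_cases hp : Conn w x.1 p (bottomLeft w k)
      · rw [hx, conn_flip_of_not_conn h] at hp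
        have hp' : Conn w y.1 p (bottomLeft w k) ∨ Conn w y.1 p (topRight w k) :=
          hp.elim .inl fun h' => h'.1
        rcases hp' with hp' | hp' <;> rw [cnt_congr _ _ hp', label_congr y hp'] <;> assumption
      · rw [h1 p hp, hoff p hp]
  have hra := hrep (bottomLeft w k) (.inl (.refl _ _))
  have hrb := hrep (topRight w k) (.inr (.refl _ _))
  rw [cnt_cons, cnt_cons, if_pos (.refl _ _), if_neg h] at hra
  rw [cnt_cons, cnt_cons, if_neg hba, if_pos (.refl _ _)] at hrb
  rw [edgeCoeff_of_conn hx', monomialCoeff, monomialCoeff]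
  simp only [hra, hrb]
  have l1 := (label x (bottomLeft w k)).isLt
  have l2 := (label y (bottomLeft w k)).isLt
  have l3 := (label y (topRight w k)).isLt
  by_cases hoff : ∀ p, ¬ Conn w x.1 p (bottomLeft w k) → label y p = label x p
  · simp only [eq_true hoff, true_and]
    split_ifs <;> first | rfl | omega
  · simp only [eq_false hoff, false_and, if_false, add_zero]

open Classical in
/-- The value of a linear form on the image of a monomial under an edge map out of `e`. -/
noncomputable def edgeForm (e : Resolution w) (k : Fin w.crossings)
    (φ : Multiset (Point w) → ℤ) (T : Multiset (Point w)) : ℤ :=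
  if Conn w e (bottomLeft w k) (topRight w k) then
    φ (bottomLeft w k ::ₘ T) + φ (topRight w k ::ₘ T) else φ T

theorem edgeCoeff_eq_edgeForm {x y : State w} {k : Fin w.crossings} (hy : y.1 = flip x.1 k)
    {T : Multiset (Point w)} (hT : Represents x T) :
    edgeCoeff w k x y = edgeForm x.1 k (monomialCoeff y) T := by
  rw [edgeForm]
  split_ifs with h
  · refine edgeCoeff_split (by rw [hy, flip_flip]) ?_ hT
    rw [hy, conn_flip_iff]
    exact not_not.2 h
  · exact edgeCoeff_merge hy h hT

open Classical in
-- This extends `edgeCoeff_eq_edgeForm` to monomials that are zero in `V_e` because two of their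
-- points share a circle: their images are zero as well. Edge maps can then be composed at the level
-- of monomials, without representing the intermediate states.
theorem sum_monomialCoeff_mul_edgeCoeff (e : Resolution w) (k : Fin w.crossings) {z : State w}
    (hz : z.1 = flip e k) (T : Multiset (Point w)) :
    ∑ y : State w, (if y.1 = e then monomialCoeff y T * edgeCoeff w k y z else 0) =
      edgeForm e k (monomialCoeff z) T := by
  by_cases hex : ∃ x : State w, x.1 = e ∧ Represents x T
  · obtain ⟨x, rfl, hx⟩ := hex
    rw [Finset.sum_eq_single x]
    · rw [if_pos rfl, monomialCoeff, if_pos hx, one_mul, edgeCoeff_eq_edgeForm hz hx]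
    · intro y _ hyx
      split_ifs with hy
      · rw [monomialCoeff, if_neg fun h => hyx (h.unique hx hy), zero_mul]
      · rfl
    · simp
  · rw [Finset.sum_eq_zero]
    · have hT : ¬ ∀ p, cnt e T p ≤ 1 := fun h => hex (exists_represents_of_cnt_le h)
      symm
      rw [edgeForm]
      split_ifs with h
      · have hz' : ¬ Conn w z.1 (bottomLeft w k) (topRight w k) := by
          rw [hz, conn_flip_iff]; exact not_not.2 h
        have he : e = flip z.1 k := by rw [hz, flip_flip]
        have main : ∀ q, (q = bottomLeft w k ∨ q = topRight w k) → ¬ Represents z (q ::ₘ T) := by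
          intro q hq hr
          have hab : cnt z.1 T (bottomLeft w k) + cnt z.1 T (topRight w k) ≤ 1 := by
            have h1 := hr.cnt_le (bottomLeft w k)
            have h2 := hr.cnt_le (topRight w k)
            rw [cnt_cons] at h1 h2
            rcases hq with rfl | rfl
            · rw [if_pos (.refl _ _)] at h1; omega
            · rw [if_pos (.refl _ _)] at h2; omega
          refine hT fun p => ?_
          by_cases ha : Conn w z.1 p (bottomLeft w k)
          · rw [he, cnt_congr _ _ (ha.flip hz'), cnt_flip_bottomLeft hz']; exact hab
          by_cases hb : Conn w z.1 p (topRight w k)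
          · rw [he, cnt_congr _ _ (hb.flip hz'), cnt_flip_topRight hz']; exact hab
          rw [he, cnt_flip_of_not_conn hz' T ha hb]
          have := hr.cnt_le p
          rw [cnt_cons] at this
          omega
        rw [monomialCoeff, monomialCoeff, if_neg (main _ (.inl rfl)), if_neg (main _ (.inr rfl)),
          add_zero]
      · rw [monomialCoeff, if_neg]
        intro hr
        refine hT fun p => (cnt_le_cnt_flip h T p).trans ?_
        rw [← hz]
        exact hr.cnt_le p
    · intro y _
      split_ifs with hy
      · rw [monomialCoeff, if_neg fun h => hex ⟨y, hy, h⟩, zero_mul]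
      · rfl

theorem flip_comm (e : Resolution w) (k l : Fin w.crossings) :
    flip (flip e k) l = flip (flip e l) k := by
  by_cases hkl : k = l
  · rw [hkl]
  funext j
  by_cases hk : j = k
  · subst hk
    rw [flip_of_ne _ hkl, flip_self, flip_self, flip_of_ne _ hkl]
  · by_cases hl : j = l
    · subst hl
      rw [flip_self, flip_of_ne _ hk, flip_of_ne _ hk, flip_self]
    · rw [flip_of_ne _ hl, flip_of_ne _ hk, flip_of_ne _ hk, flip_of_ne _ hl]

open Classical in
theorem card_flip (e : Resolution w) (k : Fin w.crossings) :
    (Fintype.card (Circles w (flip e k)) : ℤ) = Fintype.card (Circles w e) +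
      if Conn w e (bottomLeft w k) (topRight w k) then 1 else -1 := by
  split_ifs with h
  · have := card_circles_flip (e := flip e k) (k := k) (by rw [conn_flip_iff]; exact not_not.2 h)
    rw [flip_flip] at this
    omega
  · have := card_circles_flip h
    omega

/-- The number of circles of `z` is the same along both paths, which rules out the inconsistent
patterns of merges and splits. Of the others, those where the two composites are not literally equal
are the three treated below. -/
theorem edgeForm_comm (e : Resolution w) (k l : Fin w.crossings) {z : State w}
    (hz : z.1 = flip (flip e k) l) (T : Multiset (Point w)) :
    edgeForm e k (edgeForm (flip e k) l (monomialCoeff z)) T =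
      edgeForm e l (edgeForm (flip e l) k (monomialCoeff z)) T := by
  classical
  have hz' : z.1 = flip (flip e l) k := hz.trans (flip_comm e k l)
  have c1 := card_flip e k
  have c2 := card_flip e l
  have c3 := card_flip (flip e k) l
  have c4 := card_flip (flip e l) k
  rw [flip_comm e k l] at c3
  have f1 := conn_flip_iff (flip e k) l
  have f2 := conn_flip_iff (flip e l) k
  rw [← hz] at f1
  rw [← hz'] at f2
  have g1 := conn_flip_iff e k
  have g2 := conn_flip_iff e l
  simp only [edgeForm]
  by_cases sk : Conn w e (bottomLeft w k) (topRight w k) <;>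
  by_cases sl : Conn w e (bottomLeft w l) (topRight w l) <;>
  by_cases sl' : Conn w (flip e k) (bottomLeft w l) (topRight w l) <;>
  by_cases sk' : Conn w (flip e l) (bottomLeft w k) (topRight w k) <;>
  simp only [sk, sl, sl', sk', if_true, if_false] at c1 c2 c3 c4 ⊢ <;>
  try (exfalso; omega)
  -- Two splits in either order: multiplications commute.
  · rw [Multiset.cons_swap (bottomLeft w l), Multiset.cons_swap (bottomLeft w l),
      Multiset.cons_swap (topRight w l), Multiset.cons_swap (topRight w l)]
    ring
  -- A split followed by a merge, in both orders: all four ends lie on one circle of `z`, so both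
  -- composites are multiplication by `2X`.
  · have hab := f2.2 sk'
    have hcd := f1.2 sl'
    have hk1 : ¬ Conn w (flip e k) (bottomLeft w k) (topRight w k) := by tauto
    have hj : ConnJoin w (flip e k) k (bottomLeft w l) (topRight w l) := by
      apply connJoin_of_conn_flip; rwa [flip_flip]
    have hc : Conn w z.1 (bottomLeft w k) (bottomLeft w l) := by
      rcases (hj.resolve_left sl').1 with h | h
      · exact (hz ▸ h.flip sl' : Conn w z.1 _ _).symm
      · exact hab.trans (hz ▸ h.flip sl' : Conn w z.1 _ _).symm
    rw [monomialCoeff_congr z T hc, monomialCoeff_congr z T (hab.symm.trans hc),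
      monomialCoeff_congr z T hcd]
  -- A merge followed by a split, in both orders: the ends of `k` and the ends of `l` lie on the
  -- same two circles of `z`.
  · have hab : ¬ Conn w z.1 (bottomLeft w k) (topRight w k) := by tauto
    have hcd : ¬ Conn w z.1 (bottomLeft w l) (topRight w l) := by tauto
    have hj : ConnJoin w z.1 l (bottomLeft w k) (topRight w k) := by
      apply connJoin_of_conn_flip; rw [hz, flip_flip]; exact g1.2 sk
    obtain ⟨h1, h2⟩ := hj.resolve_left hab
    rcases h1 with h1 | h1
    · have h2 := h2.resolve_left fun h => hab (h1.trans h.symm)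
      rw [monomialCoeff_congr z T h1, monomialCoeff_congr z T h2]
    · have h2 := h2.resolve_right fun h => hab (h1.trans h.symm)
      rw [monomialCoeff_congr z T h1, monomialCoeff_congr z T h2, add_comm]

open Classical in
theorem sum_edgeCoeff_mul_edgeCoeff {x z : State w} (k l : Fin w.crossings)
    (hz : z.1 = flip (flip x.1 k) l) {T : Multiset (Point w)} (hT : Represents x T) :
    ∑ y : State w, (if y.1 = flip x.1 k then edgeCoeff w k x y * edgeCoeff w l y z else 0) =
      edgeForm x.1 k (edgeForm (flip x.1 k) l (monomialCoeff z)) T := by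
  have h1 : ∀ y : State w,
      (if y.1 = flip x.1 k then edgeCoeff w k x y * edgeCoeff w l y z else 0) =
      if y.1 = flip x.1 k then
        edgeForm x.1 k (monomialCoeff y) T * edgeCoeff w l y z else 0 := by
    intro y
    split_ifs with hy
    · rw [edgeCoeff_eq_edgeForm hy hT]
    · rfl
  rw [Finset.sum_congr rfl fun y _ => h1 y]
  have h2 := sum_monomialCoeff_mul_edgeCoeff (flip x.1 k) l hz
  by_cases h : Conn w x.1 (bottomLeft w k) (topRight w k)
  · rw [show ∀ φ, edgeForm x.1 k φ T = φ (bottomLeft w k ::ₘ T) + φ (topRight w k ::ₘ T) from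
      fun φ => if_pos h, ← h2, ← h2, ← Finset.sum_add_distrib]
    refine Finset.sum_congr rfl fun y _ => ?_
    rw [edgeForm, if_pos h]
    split_ifs <;> ring
  · rw [show ∀ φ, edgeForm x.1 k φ T = φ T from fun φ => if_neg h, ← h2]
    refine Finset.sum_congr rfl fun y _ => ?_
    rw [edgeForm, if_neg h]

/-- The sign of the `k`-th edge map out of `e`. -/
def edgeSign (e : Resolution w) (k : Fin w.crossings) : ℤ :=
  (-1) ^ (Finset.univ.filter fun l => l < k ∧ e l = true).card

theorem edgeSign_flip {e : Resolution w} {k l : Fin w.crossings} (hk : e k = false) :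
    edgeSign (flip e k) l = if k < l then - edgeSign e l else edgeSign e l := by
  split_ifs with hkl
  · have : (Finset.univ.filter fun j => j < l ∧ flip e k j = true) =
        insert k (Finset.univ.filter fun j => j < l ∧ e j = true) := by
      ext j
      by_cases hj : j = k
      · subst hj; simp [hkl, hk]
      · simp [hj, flip_of_ne e hj]
    rw [edgeSign, edgeSign, this, Finset.card_insert_of_notMem (by simp [hk]), pow_succ]
    ring
  · have : (Finset.univ.filter fun j => j < l ∧ flip e k j = true) =
        (Finset.univ.filter fun j => j < l ∧ e j = true) := by
      refine Finset.filter_congr fun j _ => and_congr_right fun hj => ?_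
      rw [flip_of_ne e (by rintro rfl; exact hkl hj)]
    rw [edgeSign, edgeSign, this]

open Classical in
/-- The contribution of the `k`-th edge map to the differential. -/
noncomputable def edgeTerm (k : Fin w.crossings) (x y : State w) : ℤ :=
  if x.1 k = false ∧ y.1 = flip x.1 k then edgeSign x.1 k * edgeCoeff w k x y else 0

theorem diffCoeff_eq_sum (x y : State w) : diffCoeff w x y = ∑ k, edgeTerm k x y := by
  refine Finset.sum_congr rfl fun k _ => ?_
  rw [edgeTerm]
  refine if_congr (and_congr_right fun h => ?_) rfl rfl
  rw [flip, h]
  rfl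

open Classical in
theorem sum_edgeTerm_mul_edgeTerm (x z : State w) (k l : Fin w.crossings) :
    ∑ y, edgeTerm k x y * edgeTerm l y z =
      if x.1 k = false ∧ flip x.1 k l = false ∧ z.1 = flip (flip x.1 k) l then
        edgeSign x.1 k * edgeSign (flip x.1 k) l *
          ∑ y : State w, (if y.1 = flip x.1 k then edgeCoeff w k x y * edgeCoeff w l y z else 0)
      else 0 := by
  split_ifs with h
  · rw [Finset.mul_sum]
    refine Finset.sum_congr rfl fun y _ => ?_
    rw [edgeTerm, edgeTerm]
    by_cases hy : y.1 = flip x.1 k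
    · rw [if_pos ⟨h.1, hy⟩, if_pos hy, hy, if_pos h.2]
      ring
    · rw [if_neg fun h' => hy h'.2, if_neg hy]
      ring
  · refine Finset.sum_eq_zero fun y _ => ?_
    rw [edgeTerm, edgeTerm]
    by_cases hy : x.1 k = false ∧ y.1 = flip x.1 k
    · rw [hy.2, if_neg (c := flip x.1 k l = false ∧ z.1 = flip (flip x.1 k) l)
        fun h' => h ⟨hy.1, h'⟩, mul_zero]
    · rw [if_neg hy, zero_mul]

/-- Each face of the cube commutes without signs by `edgeForm_comm`, and changing the earlier
crossing reverses the sign of the later edge. For `k = l` both sides vanish, as a crossing can be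
changed only once. -/
theorem sum_edgeTerm_antisymm (x z : State w) (k l : Fin w.crossings) :
    ∑ y, edgeTerm k x y * edgeTerm l y z = - ∑ y, edgeTerm l x y * edgeTerm k y z := by
  classical
  rw [sum_edgeTerm_mul_edgeTerm, sum_edgeTerm_mul_edgeTerm]
  by_cases hkl : k = l
  · subst hkl
    have : ∀ q : Prop, ¬ (x.1 k = false ∧ flip x.1 k k = false ∧ q) := by
      rintro q ⟨h1, h2, -⟩
      simp [h1] at h2
    rw [if_neg (this _)]
    simp
  rw [flip_of_ne _ fun h => hkl h.symm, flip_of_ne _ hkl]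
  by_cases h : x.1 k = false ∧ x.1 l = false ∧ z.1 = flip (flip x.1 k) l
  · obtain ⟨hk, hl, hz⟩ := h
    have hz' := hz.trans (flip_comm _ _ _)
    obtain ⟨T, hT⟩ := exists_represents x
    rw [if_pos ⟨hk, hl, hz⟩, if_pos ⟨hl, hk, hz'⟩, sum_edgeCoeff_mul_edgeCoeff k l hz hT,
      sum_edgeCoeff_mul_edgeCoeff l k hz' hT, edgeForm_comm _ _ _ hz, edgeSign_flip hk,
      edgeSign_flip hl]
    rcases lt_or_gt_of_ne hkl with h | h
    · rw [if_pos h, if_neg h.not_gt]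
      ring
    · rw [if_pos h, if_neg h.not_gt]
      ring
  · rw [if_neg h, if_neg, neg_zero]
    rw [flip_comm] at h
    tauto

/-- The Khovanov differential squares to zero. -/
theorem diffCoeff_sq (x z : State w) : ∑ y, diffCoeff w x y * diffCoeff w y z = 0 := by
  have h1 : ∑ y, diffCoeff w x y * diffCoeff w y z =
      ∑ k, ∑ l, ∑ y, edgeTerm k x y * edgeTerm l y z := by
    simp only [diffCoeff_eq_sum, Finset.sum_mul_sum]
    rw [Finset.sum_comm]
    exact Finset.sum_congr rfl fun k _ => Finset.sum_comm
  have h2 : ∑ k, ∑ l, ∑ y, edgeTerm k x y * edgeTerm l y z =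
      - ∑ k, ∑ l, ∑ y, edgeTerm k x y * edgeTerm l y z := by
    conv_lhs => rw [Finset.sum_comm]
    rw [← Finset.sum_neg_distrib]
    refine Finset.sum_congr rfl fun k _ => ?_
    rw [← Finset.sum_neg_distrib]
    exact Finset.sum_congr rfl fun l _ => sum_edgeTerm_antisymm _ _ _ _
  rw [h1]
  omega

theorem exists_edge_of_diffCoeff_ne_zero {x y : State w} (h : diffCoeff w x y ≠ 0) :
    ∃ k, x.1 k = false ∧ y.1 = flip x.1 k ∧ edgeCoeff w k x y ≠ 0 := by
  rw [diffCoeff_eq_sum] at h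
  obtain ⟨k, -, hk⟩ := Finset.exists_ne_zero_of_sum_ne_zero h
  rw [edgeTerm] at hk
  split_ifs at hk with hc
  · exact ⟨k, hc.1, hc.2, right_ne_zero_of_mul hk⟩
  · exact absurd rfl hk

theorem diffCoeff_of_edge {x y : State w} {k : Fin w.crossings} (hk : x.1 k = false)
    (hy : y.1 = flip x.1 k) : diffCoeff w x y = edgeSign x.1 k * edgeCoeff w k x y := by
  rw [diffCoeff_eq_sum, Finset.sum_eq_single k]
  · rw [edgeTerm, if_pos ⟨hk, hy⟩]
  · intro l _ hl
    rw [edgeTerm, if_neg]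
    rintro ⟨hl1, hl2⟩
    have := congrFun (hy.symm.trans hl2) k
    rw [flip_self, flip_of_ne _ hl.symm] at this
    simp at this
  · simp

theorem homDegree_of_edge {x y : State w} {k : Fin w.crossings} (hk : x.1 k = false)
    (hy : y.1 = flip x.1 k) : homDegree y = homDegree x + 1 := by
  have : (Finset.univ.filter fun j => y.1 j = true) =
      insert k (Finset.univ.filter fun j => x.1 j = true) := by
    ext j
    rw [hy]
    by_cases hj : j = k
    · subst hj; simp [hk]
    · simp [hj, flip_of_ne _ hj]
  rw [homDegree, homDegree, this, Finset.card_insert_of_notMem (by simp [hk])]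

theorem homDegree_of_diffCoeff_ne_zero {x y : State w} (h : diffCoeff w x y ≠ 0) :
    (homDegree y : ℤ) = homDegree x + 1 := by
  obtain ⟨k, hk, hy, -⟩ := exists_edge_of_diffCoeff_ne_zero h
  rw [homDegree_of_edge hk hy]
  rfl

/-- The homological degree rises by one. A merge compensates by losing a circle; a split gains a
circle and a factor `X`, which counts `-2`. -/
theorem qDegree_of_diffCoeff_ne_zero {x y : State w} (h : diffCoeff w x y ≠ 0) :
    qDegree y = qDegree x := by
  classical
  obtain ⟨k, hk, hy, he⟩ := exists_edge_of_diffCoeff_ne_zero h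
  obtain ⟨T, hT⟩ := exists_represents x
  have hd := homDegree_of_edge hk hy
  have hc := card_flip x.1 k
  rw [← hy] at hc
  rw [edgeCoeff_eq_edgeForm hy hT, edgeForm] at he
  rw [hT.qDegree_eq]
  split_ifs at he hc with hs
  · by_cases h1 : Represents y (bottomLeft w k ::ₘ T)
    · rw [h1.qDegree_eq, Multiset.card_cons]; push_cast; omega
    · by_cases h2 : Represents y (topRight w k ::ₘ T)
      · rw [h2.qDegree_eq, Multiset.card_cons]; push_cast; omega
      · rw [monomialCoeff, monomialCoeff, if_neg h1, if_neg h2] at he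
        exact absurd rfl he
  · by_cases h1 : Represents y T
    · rw [h1.qDegree_eq]; omega
    · rw [monomialCoeff, if_neg h1] at he
      exact absurd rfl he

theorem le_of_diffCoeff_ne_zero {x y : State w} (h : diffCoeff w x y ≠ 0) {k : Fin w.crossings}
    (hk : x.1 k = true) : y.1 k = true := by
  obtain ⟨l, hl, hy, -⟩ := exists_edge_of_diffCoeff_ne_zero h
  rw [hy, flip_of_ne, hk]
  rintro rfl
  rw [hl] at hk
  exact absurd hk (by simp)

end States

end Khovanov

namespace Khovanov

/-! ### Local simplifications by Gaussian elimination -/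

section Moves

variable {m : ℕ} {w : BraidWord m}

/-- The labels of two states agree away from the circle of `e` through `o`. -/
def AgreeOff (e : Resolution w) (o : Point w) (x y : State w) : Prop :=
  ∀ p, ¬ Conn w e p o → label y p = label x p

/-- One of `o`, `o'` is the bottom left end of a crossing and the other its top right end. -/
def IsEndPair (w : BraidWord m) (k : Fin w.crossings) (o o' : Point w) : Prop :=
  (o = bottomLeft w k ∧ o' = topRight w k) ∨ (o = topRight w k ∧ o' = bottomLeft w k)

section Matching

variable {e : Resolution w} {k : Fin w.crossings} {o o' : Point w}

theorem IsEndPair.not_conn (ho : IsEndPair w k o o')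
    (h : ¬ Conn w e (bottomLeft w k) (topRight w k)) : ¬ Conn w e o' o := by
  rcases ho with ⟨rfl, rfl⟩ | ⟨rfl, rfl⟩
  · exact fun h' => h h'.symm
  · exact h

theorem IsEndPair.conn_flip (ho : IsEndPair w k o o')
    (h : ¬ Conn w e (bottomLeft w k) (topRight w k)) : Conn w (flip e k) o o' := by
  have := (conn_flip_iff e k).2 h
  rcases ho with ⟨rfl, rfl⟩ | ⟨rfl, rfl⟩
  · exact this
  · exact this.symm

theorem IsEndPair.conn_flip_cases (ho : IsEndPair w k o o')
    (h : ¬ Conn w e (bottomLeft w k) (topRight w k)) {p q : Point w}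
    (hpq : Conn w (flip e k) p q) :
    Conn w e p q ∨ (Conn w e p o ∨ Conn w e p o') ∧ (Conn w e q o ∨ Conn w e q o') := by
  rw [conn_flip_of_not_conn h, ConnJoin] at hpq
  rcases ho with ⟨rfl, rfl⟩ | ⟨rfl, rfl⟩
  · exact hpq
  · exact hpq.imp_right fun h => ⟨h.1.symm, h.2.symm⟩

/-- The component of `Δ` with `X` on the circle through `o` is `a ↦ X ⊗ a`: the label passes
unchanged to the other circle. -/
theorem edgeCoeff_split_of_label (ho : IsEndPair w k o o') {x y : State w} (hx : x.1 = flip y.1 k)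
    (h : ¬ Conn w y.1 (bottomLeft w k) (topRight w k)) (hy : label y o = 1)
    [Decidable (AgreeOff y.1 o x y)] :
    edgeCoeff w k x y = if AgreeOff y.1 o x y then 1 else 0 := by
  classical
  have hx' : Conn w x.1 (bottomLeft w k) (topRight w k) := hx ▸ (conn_flip_iff _ _).2 h
  rw [edgeCoeff_of_conn hx']
  have hxo' : (label x (bottomLeft w k)).val = (label x o').val := by
    rcases ho with ⟨rfl, rfl⟩ | ⟨rfl, rfl⟩
    · rw [label_congr x hx']
    · rfl
  have hyo' : (label y (bottomLeft w k)).val + (label y (topRight w k)).val =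
      (label y o').val + 1 := by
    rcases ho with ⟨rfl, rfl⟩ | ⟨rfl, rfl⟩ <;> rw [hy]
    · exact add_comm _ _
    · rfl
  refine if_congr ⟨fun ⟨h1, h2⟩ p hp => ?_, fun H => ⟨fun p hp => H p fun hpo => hp ?_, ?_⟩⟩ rfl rfl
  · by_cases hpx : Conn w x.1 p (bottomLeft w k)
    · have hpo : Conn w (flip y.1 k) p o := by
        rw [← hx]
        rcases ho with ⟨rfl, rfl⟩ | ⟨rfl, rfl⟩
        · exact hpx
        · exact hpx.trans hx'
      have hpo' : Conn w y.1 p o' := by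
        rcases ho.conn_flip_cases h hpo with h' | h'
        · exact absurd h' hp
        · exact h'.1.resolve_left hp
      have hpo'' : Conn w x.1 p o' := hx ▸ hpo'.flip h
      rw [label_congr y hpo', label_congr x hpo'']
      exact Fin.ext (by omega)
    · exact h1 p hpx
  · have hpo' : Conn w x.1 p o := hx ▸ hpo.flip h
    rcases ho with ⟨rfl, rfl⟩ | ⟨rfl, rfl⟩
    · exact hpo'
    · exact hpo'.trans hx'.symm
  · rw [hyo', hxo', H o' (ho.not_conn h)]

/-- Label `0` is the exponent of the unit `1`, and multiplication by `1` leaves the other label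
unchanged. -/
theorem edgeCoeff_merge_of_label (ho : IsEndPair w k o o') {x y : State w} (hy : y.1 = flip x.1 k)
    (h : ¬ Conn w x.1 (bottomLeft w k) (topRight w k)) (hx : label x o = 0)
    [Decidable (AgreeOff x.1 o x y)] :
    edgeCoeff w k x y = if AgreeOff x.1 o x y then 1 else 0 := by
  classical
  rw [edgeCoeff_of_not_conn h]
  have hy' : Conn w y.1 (bottomLeft w k) (topRight w k) := hy ▸ (conn_flip_iff _ _).2 h
  have hyo' : (label y (bottomLeft w k)).val = (label y o').val := by
    rcases ho with ⟨rfl, rfl⟩ | ⟨rfl, rfl⟩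
    · rw [label_congr y hy']
    · rfl
  have hxo' : (label x (bottomLeft w k)).val + (label x (topRight w k)).val = (label x o').val := by
    rcases ho with ⟨rfl, rfl⟩ | ⟨rfl, rfl⟩ <;> rw [hx]
    · exact zero_add _
    · rfl
  refine if_congr ⟨fun ⟨h1, h2⟩ p hp => ?_, fun H => ⟨fun p hpa hpb => H p ?_, ?_⟩⟩ rfl rfl
  · by_cases hpo' : Conn w x.1 p o'
    · have hpo'' : Conn w y.1 p o' := hy ▸ hpo'.flip h
      rw [label_congr y hpo'', label_congr x hpo']
      exact Fin.ext (by omega)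
    · rcases ho with ⟨rfl, rfl⟩ | ⟨rfl, rfl⟩
      · exact h1 p hp hpo'
      · exact h1 p hpo' hp
  · rcases ho with ⟨rfl, rfl⟩ | ⟨rfl, rfl⟩
    · exact hpa
    · exact hpb
  · rw [hyo', hxo', H o' (ho.not_conn h)]

/-- A state can be extended by a label on an additional circle. -/
theorem exists_addCircle
    (h : ¬ Conn w e (bottomLeft w k) (topRight w k)) {y : State w} (hy : y.1 = flip e k)
    (v : VBasis) : ∃ x : State w, x.1 = e ∧ label x o = v ∧ AgreeOff e o x y := by
  classical
  refine ⟨mkState e (fun p => if Conn w e p o then v else label y p) fun p q hpq => ?_, rfl, ?_, ?_⟩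
  · have h1 : Conn w e p o ↔ Conn w e q o := ⟨hpq.symm.trans, hpq.trans⟩
    have h2 : Conn w y.1 p q := hy ▸ hpq.flip h
    simp only [h1, label_congr y h2]
  · rw [label_mkState, if_pos (.refl _ _)]
  · intro p hp
    rw [label_mkState, if_neg hp]

theorem addCircle_unique {x x' y : State w} (hx : x.1 = e) (hx' : x'.1 = e)
    (hxx : label x o = label x' o) (h : AgreeOff e o x y) (h' : AgreeOff e o x' y) : x = x' := by
  refine state_ext (hx.trans hx'.symm) fun p => ?_
  by_cases hp : Conn w e p o
  · rw [label_congr x (hx ▸ hp), label_congr x' (hx' ▸ hp), hxx]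
  · rw [← h p hp, ← h' p hp]

/-- A circle that is merged with another one can be forgotten. -/
theorem exists_removeCircle (ho : IsEndPair w k o o')
    (h : ¬ Conn w e (bottomLeft w k) (topRight w k)) {x : State w} (hx : x.1 = e) :
    ∃ y : State w, y.1 = flip e k ∧ AgreeOff e o x y := by
  classical
  refine ⟨mkState (flip e k) (fun p => if Conn w e p o then label x o' else label x p)
    fun p q hpq => ?_, rfl, ?_⟩
  · rcases ho.conn_flip_cases h hpq with h' | ⟨h1, h2⟩
    · have h1 : Conn w e p o ↔ Conn w e q o := ⟨h'.symm.trans, h'.trans⟩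
      have h2 : Conn w x.1 p q := hx ▸ h'
      simp only [h1, label_congr x h2]
    · have main : ∀ r, (Conn w e r o ∨ Conn w e r o') →
          (if Conn w e r o then label x o' else label x r) = label x o' := by
        intro r hr
        split_ifs with hro
        · rfl
        · exact label_congr x (hx ▸ hr.resolve_left hro)
      simp only [main p h1, main q h2]
  · intro p hp
    rw [label_mkState, if_neg hp]

theorem removeCircle_unique (ho : IsEndPair w k o o')
    (h : ¬ Conn w e (bottomLeft w k) (topRight w k)) {x y y' : State w}
    (hy : y.1 = flip e k) (hy' : y'.1 = flip e k) (hxy : AgreeOff e o x y)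
    (hxy' : AgreeOff e o x y') : y = y' := by
  refine state_ext (hy.trans hy'.symm) fun p => ?_
  by_cases hp : Conn w e p o
  · have h1 : Conn w (flip e k) p o' := (hp.flip h).trans (ho.conn_flip h)
    have h2 := ho.not_conn h
    rw [label_congr y (hy ▸ h1), label_congr y' (hy' ▸ h1), hxy o' h2, hxy' o' h2]
  · rw [hxy p hp, hxy' p hp]

theorem isUnit_edgeSign (e : Resolution w) (k : Fin w.crossings) : IsUnit (edgeSign e k) :=
  (isUnit_neg_one).pow _

theorem isUnit_diffCoeff {x y : State w} (hk : x.1 k = false) (hy : y.1 = flip x.1 k)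
    (h : edgeCoeff w k x y = 1) : IsUnit (diffCoeff w x y) := by
  rw [diffCoeff_of_edge hk hy, h, mul_one]
  exact isUnit_edgeSign _ _

theorem edgeCoeff_ne_zero {x y : State w} (hk : x.1 k = false) (hy : y.1 = flip x.1 k)
    (h : diffCoeff w x y ≠ 0) : edgeCoeff w k x y ≠ 0 := by
  rw [diffCoeff_of_edge hk hy] at h
  exact right_ne_zero_of_mul h

theorem eq_flip_of_diffCoeff_ne_zero {x y : State w} (h : diffCoeff w x y ≠ 0)
    (hx : x.1 k = false) (hy : y.1 k = true) : y.1 = flip x.1 k := by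
  obtain ⟨l, hl, hxy, -⟩ := exists_edge_of_diffCoeff_ne_zero h
  by_cases hkl : k = l
  · rw [hkl, hxy]
  · rw [hxy, flip_of_ne _ hkl, hx] at hy
    exact absurd hy (by simp)

/-- Together with `split_matching_left`: a split, followed by projection to the states with `X` on
the circle through `o`, is up to signs a bijection of basis vectors. -/
theorem split_matching_right (ho : IsEndPair w k o o') {x : State w} (hk : x.1 k = false)
    (h : ¬ Conn w (flip x.1 k) (bottomLeft w k) (topRight w k)) :
    ∃ y : State w, y.1 = flip x.1 k ∧ label y o = 1 ∧ IsUnit (diffCoeff w x y) ∧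
      ∀ y' : State w, y'.1 = flip x.1 k → label y' o = 1 → diffCoeff w x y' ≠ 0 → y' = y := by
  classical
  obtain ⟨y, hy, hyo, hxy⟩ := exists_addCircle h (y := x) (by rw [flip_flip]) 1
  have hx : ∀ y : State w, y.1 = flip x.1 k → x.1 = flip y.1 k := fun y hy => by rw [hy, flip_flip]
  have key : ∀ y : State w, y.1 = flip x.1 k → label y o = 1 → edgeCoeff w k x y ≠ 0 →
      AgreeOff (flip x.1 k) o y x := by
    intro y hy hyo hne p hp
    rw [edgeCoeff_split_of_label ho (hx y hy) (hy ▸ h) hyo] at hne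
    split_ifs at hne with ha
    · exact (ha p (hy ▸ hp)).symm
    · exact absurd rfl hne
  refine ⟨y, hy, hyo, isUnit_diffCoeff hk hy ?_, fun y' hy' hyo' hD => ?_⟩
  · rw [edgeCoeff_split_of_label ho (hx y hy) (hy ▸ h) hyo, if_pos]
    exact fun p hp => (hxy p (hy ▸ hp)).symm
  · exact addCircle_unique hy' hy (hyo'.trans hyo.symm)
      (key y' hy' hyo' (edgeCoeff_ne_zero hk hy' hD)) hxy

theorem split_matching_left (ho : IsEndPair w k o o') {y : State w} (hk : y.1 k = true)
    (h : ¬ Conn w y.1 (bottomLeft w k) (topRight w k)) (hyo : label y o = 1) :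
    ∃ x : State w, x.1 = flip y.1 k ∧ IsUnit (diffCoeff w x y) ∧
      ∀ x' : State w, x'.1 = flip y.1 k → diffCoeff w x' y ≠ 0 → x' = x := by
  classical
  obtain ⟨x, hx, hxy⟩ := exists_removeCircle ho h (x := y) rfl
  have hxk : ∀ x : State w, x.1 = flip y.1 k → x.1 k = false := by
    intro x hx
    rw [hx, flip_self, hk]
    rfl
  have hy : ∀ x : State w, x.1 = flip y.1 k → y.1 = flip x.1 k := fun x hx => by rw [hx, flip_flip]
  refine ⟨x, hx, isUnit_diffCoeff (hxk x hx) (hy x hx) ?_, fun x' hx' hD => ?_⟩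
  · rw [edgeCoeff_split_of_label ho hx h hyo, if_pos]
    exact fun p hp => (hxy p hp).symm
  · have hne := edgeCoeff_ne_zero (hxk x' hx') (hy x' hx') hD
    rw [edgeCoeff_split_of_label ho hx' h hyo] at hne
    split_ifs at hne with ha
    · exact removeCircle_unique ho h hx' hx (x := y) (fun p hp => (ha p hp).symm) hxy
    · exact absurd rfl hne

/-- Together with `merge_matching_left`: a merge, restricted to the states with `1` on the circle
through `o`, is up to signs a bijection of basis vectors. -/
theorem merge_matching_right (ho : IsEndPair w k o o') {x : State w} (hk : x.1 k = false)
    (h : ¬ Conn w x.1 (bottomLeft w k) (topRight w k)) (hxo : label x o = 0) :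
    ∃ y : State w, y.1 = flip x.1 k ∧ IsUnit (diffCoeff w x y) ∧
      ∀ y' : State w, y'.1 = flip x.1 k → diffCoeff w x y' ≠ 0 → y' = y := by
  classical
  obtain ⟨y, hy, hxy⟩ := exists_removeCircle ho h (x := x) rfl
  refine ⟨y, hy, isUnit_diffCoeff hk hy ?_, fun y' hy' hD => ?_⟩
  · rw [edgeCoeff_merge_of_label ho hy h hxo, if_pos hxy]
  · have hne := edgeCoeff_ne_zero hk hy' hD
    rw [edgeCoeff_merge_of_label ho hy' h hxo] at hne
    split_ifs at hne with ha
    · exact removeCircle_unique ho h hy' hy ha hxy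
    · exact absurd rfl hne

theorem merge_matching_left (ho : IsEndPair w k o o') {y : State w} (hk : y.1 k = true)
    (h : ¬ Conn w (flip y.1 k) (bottomLeft w k) (topRight w k)) :
    ∃ x : State w, x.1 = flip y.1 k ∧ label x o = 0 ∧ IsUnit (diffCoeff w x y) ∧
      ∀ x' : State w, x'.1 = flip y.1 k → label x' o = 0 → diffCoeff w x' y ≠ 0 → x' = x := by
  classical
  obtain ⟨x, hx, hxo, hxy⟩ := exists_addCircle h (y := y) (by rw [flip_flip]) 0
  have hxk : ∀ x : State w, x.1 = flip y.1 k → x.1 k = false := by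
    intro x hx
    rw [hx, flip_self, hk]
    rfl
  have hy : ∀ x : State w, x.1 = flip y.1 k → y.1 = flip x.1 k := fun x hx => by rw [hx, flip_flip]
  refine ⟨x, hx, hxo, isUnit_diffCoeff (hxk x hx) (hy x hx) ?_, fun x' hx' hxo' hD => ?_⟩
  · rw [edgeCoeff_merge_of_label ho (hy x hx) (hx ▸ h) hxo, if_pos]
    rw [hx]
    exact hxy
  · have hne := edgeCoeff_ne_zero (hxk x' hx') (hy x' hx') hD
    rw [edgeCoeff_merge_of_label ho (hy x' hx') (hx' ▸ h) hxo'] at hne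
    split_ifs at hne with ha
    · rw [hx'] at ha
      exact addCircle_unique hx' hx (hxo'.trans hxo.symm) ha hxy
    · exact absurd rfl hne

/-- A circle that does not meet the changed crossing keeps its label. -/
theorem label_eq_of_edgeCoeff_ne_zero {x y : State w} (h : edgeCoeff w k x y ≠ 0)
    (ha : ¬ Conn w x.1 o (bottomLeft w k)) (hb : ¬ Conn w x.1 o (topRight w k)) :
    label y o = label x o := by
  simp only [edgeCoeff] at h
  by_contra hne
  rw [if_neg fun H => hne (H o ha hb)] at h
  exact h rfl

end Matching

/-- A partial resolution: `none` stands for an unresolved crossing. -/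
abbrev PartialResolution (w : BraidWord m) := Fin w.crossings → Option Bool

/-- The total resolution `e` extends the partial resolution `ρ`. -/
def Extends (ρ : PartialResolution w) (e : Resolution w) : Prop := ∀ k b, ρ k = some b → e k = b

/-- The part of quantum degree `j` of the complex of a partially resolved diagram. -/
def IsStateOf (ρ : PartialResolution w) (j : ℤ) (x : State w) : Prop :=
  Extends ρ x.1 ∧ qDegree x = j

/-- Exactness in homological degree `i` and quantum degree `j` of a subquotient of the Khovanov
complex. -/
def KhExactOn (w : BraidWord m) (p : State w → Prop) (i : ℤ) : Prop :=
  ExactOn (diffCoeff w) (fun x => (homDegree x : ℤ)) p i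

theorem isInterval_isStateOf (ρ : PartialResolution w) (j : ℤ) :
    IsInterval (diffCoeff w) (IsStateOf ρ j) := by
  intro x y z hx hy hxz hzy
  refine ⟨fun k b hb => ?_, (qDegree_of_diffCoeff_ne_zero hxz).trans hx.2⟩
  cases b with
  | true => exact le_of_diffCoeff_ne_zero hxz (hx.1 k true hb)
  | false =>
    have h := hy.1 k false hb
    by_contra hz
    rw [le_of_diffCoeff_ne_zero hzy (by simpa using hz)] at h
    exact absurd h (by simp)

theorem Extends.flip {ρ : PartialResolution w} {e : Resolution w} (h : Extends ρ e)
    {k : Fin w.crossings} (hk : ρ k = none) : Extends ρ (flip e k) := by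
  intro l b hb
  rw [flip_of_ne, h l b hb]
  rintro rfl
  rw [hk] at hb
  exact absurd hb (by simp)

theorem IsStateOf.of_edge_right {ρ : PartialResolution w} {j : ℤ} {x y : State w}
    {k : Fin w.crossings} (hx : IsStateOf ρ j x) (hk : ρ k = none) (hy : y.1 = flip x.1 k)
    (h : diffCoeff w x y ≠ 0) : IsStateOf ρ j y :=
  ⟨hy ▸ hx.1.flip hk, (qDegree_of_diffCoeff_ne_zero h).trans hx.2⟩

theorem IsStateOf.of_edge_left {ρ : PartialResolution w} {j : ℤ} {x y : State w}
    {k : Fin w.crossings} (hy : IsStateOf ρ j y) (hk : ρ k = none) (hx : x.1 = flip y.1 k)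
    (h : diffCoeff w x y ≠ 0) : IsStateOf ρ j x :=
  ⟨hx ▸ hy.1.flip hk, (qDegree_of_diffCoeff_ne_zero h).symm.trans hy.2⟩

theorem isStateOf_update {ρ : PartialResolution w} {j : ℤ} {k : Fin w.crossings} (hk : ρ k = none)
    (b : Bool) (x : State w) :
    IsStateOf (Function.update ρ k (some b)) j x ↔ IsStateOf ρ j x ∧ x.1 k = b := by
  constructor
  · rintro ⟨h1, h2⟩
    refine ⟨⟨fun l c hl => h1 l c ?_, h2⟩, h1 k b (Function.update_self _ _ _)⟩
    rw [Function.update_of_ne, hl]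
    rintro rfl
    rw [hk] at hl
    exact absurd hl (by simp)
  · rintro ⟨⟨h1, h2⟩, h3⟩
    refine ⟨fun l c hl => ?_, h2⟩
    by_cases hlk : l = k
    · subst hlk
      rw [Function.update_self, Option.some.injEq] at hl
      rw [h3, hl]
    · rw [Function.update_of_ne hlk] at hl
      exact h1 l c hl

theorem homDegree_rel {x y : State w} (h : diffCoeff w x y ≠ 0) :
    (fun x : State w => (homDegree x : ℤ)) y = (fun x : State w => (homDegree x : ℤ)) x + 1 :=
  homDegree_of_diffCoeff_ne_zero h

theorem vBasis_eq_one {v : VBasis} (h : v ≠ 0) : v = 1 := by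
  fin_cases v <;> simp at h ⊢

/-- Removing a kink whose `1`-resolution splits off a circle. -/
theorem khExactOn_of_kink {ρ : PartialResolution w} {k : Fin w.crossings} (hk : ρ k = none)
    (hkink : ∀ e, Extends ρ e → e k = true → ¬ Conn w e (bottomLeft w k) (topRight w k) ∧
      ∀ l, ρ l = none → l ≠ k →
        ¬ Conn w e (bottomLeft w k) (bottomLeft w l) ∧ ¬ Conn w e (bottomLeft w k) (topRight w l))
    {i j : ℤ} (h : KhExactOn w (IsStateOf (Function.update ρ k (some true)) j) i) :
    KhExactOn w (IsStateOf ρ j) i := by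
  have hp := isInterval_isStateOf ρ j
  have ho : IsEndPair w k (bottomLeft w k) (topRight w k) := .inl ⟨rfl, rfl⟩
  have hlab : ∀ x y, IsStateOf ρ j x → IsStateOf ρ j y → x.1 k = true → diffCoeff w x y ≠ 0 →
      label y (bottomLeft w k) = label x (bottomLeft w k) := by
    intro x y hx hy hxk hD
    obtain ⟨l, hl, hxy, he⟩ := exists_edge_of_diffCoeff_ne_zero hD
    have hlk : l ≠ k := by
      rintro rfl
      rw [hxk] at hl
      exact absurd hl (by simp)
    have hρl : ρ l = none := by
      by_contra hne
      obtain ⟨b, hb⟩ := Option.ne_none_iff_exists'.1 hne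
      have h1 := hx.1 l b hb
      have h2 := hy.1 l b hb
      rw [hxy, flip_self, h1] at h2
      exact absurd h2 (by simp)
    have := (hkink x.1 hx.1 hxk).2 l hρl hlk
    exact label_eq_of_edgeCoeff_ne_zero he this.1 this.2
  have hs : ∀ x y, IsStateOf ρ j x → IsStateOf ρ j y →
      (x.1 k = true ∧ label x (bottomLeft w k) = 0) → diffCoeff w x y ≠ 0 →
      (y.1 k = true ∧ label y (bottomLeft w k) = 0) := fun x y hx hy hsx hD =>
    ⟨le_of_diffCoeff_ne_zero hD hsx.1, (hlab x y hx hy hsx.1 hD).trans hsx.2⟩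
  -- The circle split off at `k` meets no other unresolved crossing, so its label is constant within
  -- the 1-resolved part. The states labelled `1` there form a subcomplex that is a direct summand
  -- of the 1-resolved complex, hence exact. In the quotient, splitting matches the 0-resolved
  -- states with those labelled `X`.
  refine ExactOn.extension (fun x => x.1 k = true ∧ label x (bottomLeft w k) = 0) hp diffCoeff_sq
    (fun x y => homDegree_rel) hs ?_ ?_
  · refine ExactOn.of_matching (fun x => x.1 k = true) i (hp.quotient hs) diffCoeff_sq
      (fun x y => homDegree_rel) ?_ ?_
    · rintro x ⟨hx, -⟩ hxk
      replace hxk : x.1 k = false := by simpa using hxk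
      have hf := (hkink (flip x.1 k) (hx.1.flip hk) (by simp [hxk])).1
      obtain ⟨y, hy, hyo, hu, huniq⟩ := split_matching_right ho hxk hf
      refine ⟨y, ⟨⟨hx.of_edge_right hk hy hu.ne_zero, fun h' => ?_⟩, by simp [hy, hxk], hu⟩, ?_⟩
      · rw [hyo] at h'
        exact absurd h'.2 (by simp)
      · rintro y' ⟨hy', hn⟩ hyk hD
        exact huniq y' (eq_flip_of_diffCoeff_ne_zero hD hxk hyk)
          (vBasis_eq_one fun h0 => hn ⟨hyk, h0⟩) hD
    · rintro y ⟨hy, hn⟩ hyk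
      obtain ⟨x, hx, hu, huniq⟩ := split_matching_left ho hyk (hkink y.1 hy.1 hyk).1
        (vBasis_eq_one fun h0 => hn ⟨hyk, h0⟩)
      have hxk : x.1 k = false := by simp [hx, hyk]
      refine ⟨x, ⟨⟨hy.of_edge_left hk hx hu.ne_zero, fun h' => ?_⟩, by simp [hxk], hu⟩, ?_⟩
      · rw [hxk] at h'
        exact absurd h'.1 (by simp)
      · rintro x' ⟨hx', -⟩ hxk' hD
        refine huniq x' ?_ hD
        rw [eq_flip_of_diffCoeff_ne_zero hD (by simpa using hxk') hyk, flip_flip]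
  · refine (ExactOn.summand (fun x => label x (bottomLeft w k) = 0) h ?_).congr ?_
    · intro x y hx hy hD
      rw [isStateOf_update hk] at hx hy
      rw [hlab x y hx.1 hy.1 hx.2 hD]
    · intro x
      rw [isStateOf_update hk, and_assoc]

/-- Pulling a strand across a cap. -/
theorem khExactOn_of_triangle {ρ : PartialResolution w} {k l : Fin w.crossings} (hkl : k ≠ l)
    (hk : ρ k = none) (hl : ρ l = none) {o o' : Point w} (ho : IsEndPair w l o o')
    (hcirc : ∀ e, Extends ρ e → e k = true → e l = false →
      ¬ Conn w e (bottomLeft w k) (topRight w k) ∧ ¬ Conn w e (bottomLeft w l) (topRight w l) ∧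
      Conn w e (bottomLeft w k) o ∧
      ∀ l', ρ l' = none → l' ≠ k → l' ≠ l →
        ¬ Conn w e (bottomLeft w k) (bottomLeft w l') ∧ ¬ Conn w e (bottomLeft w k) (topRight w l'))
    {i j : ℤ} (h : KhExactOn w
      (IsStateOf (Function.update (Function.update ρ k (some false)) l (some true)) j) i) :
    KhExactOn w (IsStateOf ρ j) i := by
  have hp := isInterval_isStateOf ρ j
  have hok : IsEndPair w k (bottomLeft w k) (topRight w k) := .inl ⟨rfl, rfl⟩
  have hs : ∀ x y, IsStateOf ρ j x → IsStateOf ρ j y →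
      (x.1 k = true ∧ (x.1 l = true ∨ label x (bottomLeft w k) = 0)) → diffCoeff w x y ≠ 0 →
      (y.1 k = true ∧ (y.1 l = true ∨ label y (bottomLeft w k) = 0)) := by
    rintro x y hx hy ⟨hxk, hsx⟩ hD
    refine ⟨le_of_diffCoeff_ne_zero hD hxk, ?_⟩
    by_cases hyl : y.1 l = true
    · exact .inl hyl
    have hxl : x.1 l = false := by
      by_contra hne
      exact hyl (le_of_diffCoeff_ne_zero hD (by simpa using hne))
    right
    rw [← hsx.resolve_left (by simp [hxl])]
    obtain ⟨l', hl', hxy, he⟩ := exists_edge_of_diffCoeff_ne_zero hD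
    have hlk : l' ≠ k := by
      rintro rfl
      rw [hxk] at hl'
      exact absurd hl' (by simp)
    have hll : l' ≠ l := by
      rintro rfl
      rw [hxy, flip_self, hxl] at hyl
      exact hyl rfl
    have hρl : ρ l' = none := by
      by_contra hne
      obtain ⟨b, hb⟩ := Option.ne_none_iff_exists'.1 hne
      have h1 := hx.1 l' b hb
      have h2 := hy.1 l' b hb
      rw [hxy, flip_self, h1] at h2
      exact absurd h2 (by simp)
    have := (hcirc x.1 hx.1 hxk hxl).2.2.2 l' hρl hlk hll
    exact label_eq_of_edgeCoeff_ne_zero he this.1 this.2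
  have hs2 : ∀ x y, (IsStateOf ρ j x ∧
        ¬ (x.1 k = true ∧ (x.1 l = true ∨ label x (bottomLeft w k) = 0))) →
      (IsStateOf ρ j y ∧ ¬ (y.1 k = true ∧ (y.1 l = true ∨ label y (bottomLeft w k) = 0))) →
      (x.1 k = false ∧ x.1 l = true) → diffCoeff w x y ≠ 0 → (y.1 k = false ∧ y.1 l = true) := by
    rintro x y hx ⟨hy, hn⟩ ⟨hxk, hxl⟩ hD
    have hyl := le_of_diffCoeff_ne_zero hD hxl
    refine ⟨?_, hyl⟩
    by_contra hyk
    exact hn ⟨by simpa using hyk, .inl hyl⟩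
  -- Let `C_{ab}` consist of the states with values `a` at `k` and `b` at `l`. In `C₁₀` there is a
  -- circle that meets no unresolved crossings other than `k` and `l`. The part of `C₁₀` with label
  -- `1` on it, together with `C₁₁`, is a subcomplex, made contractible by the merge at `l`. In the
  -- quotient `C₀₁` is a subcomplex, and the split at `k` matches `C₀₀` with the part of `C₁₀`
  -- labelled `X`. Only `C₀₁` survives.
  refine ExactOn.extension (fun x => x.1 k = true ∧ (x.1 l = true ∨ label x (bottomLeft w k) = 0))
    hp diffCoeff_sq (fun x y => homDegree_rel) hs ?_ ?_
  · refine ExactOn.extension (fun x => x.1 k = false ∧ x.1 l = true) (hp.quotient hs) diffCoeff_sq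
      (fun x y => homDegree_rel) hs2 ?_ ?_
    · refine ExactOn.of_matching (fun x => x.1 k = true) i ((hp.quotient hs).quotient hs2)
        diffCoeff_sq (fun x y => homDegree_rel) ?_ ?_
      · rintro x ⟨⟨hx, -⟩, hn⟩ hxk
        replace hxk : x.1 k = false := by simpa using hxk
        have hxl : x.1 l = false := by
          by_contra hne
          exact hn ⟨hxk, by simpa using hne⟩
        have hf := (hcirc (flip x.1 k) (hx.1.flip hk) (by simp [hxk])
          (by rw [flip_of_ne _ hkl.symm, hxl])).1
        obtain ⟨y, hy, hyo, hu, huniq⟩ := split_matching_right hok hxk hf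
        have hyl : y.1 l = false := by rw [hy, flip_of_ne _ hkl.symm, hxl]
        have hyk : y.1 k = true := by simp [hy, hxk]
        refine ⟨y, ⟨⟨⟨hx.of_edge_right hk hy hu.ne_zero, fun h' => ?_⟩, fun h' => ?_⟩,
          hyk, hu⟩, ?_⟩
        · rw [hyo, hyl] at h'
          exact absurd h'.2 (by simp)
        · rw [hyl] at h'
          exact absurd h'.2 (by simp)
        · rintro y' ⟨⟨hy', hn'⟩, -⟩ hyk' hD
          exact huniq y' (eq_flip_of_diffCoeff_ne_zero hD hxk hyk')
            (vBasis_eq_one fun h0 => hn' ⟨hyk', .inr h0⟩) hD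
      · rintro y ⟨⟨hy, hn⟩, -⟩ hyk
        have hyl : y.1 l = false := by
          by_contra hne
          exact hn ⟨hyk, .inl (by simpa using hne)⟩
        obtain ⟨x, hx, hu, huniq⟩ := split_matching_left hok hyk (hcirc y.1 hy.1 hyk hyl).1
          (vBasis_eq_one fun h0 => hn ⟨hyk, .inr h0⟩)
        have hxk : x.1 k = false := by simp [hx, hyk]
        have hxl : x.1 l = false := by rw [hx, flip_of_ne _ hkl.symm, hyl]
        refine ⟨x, ⟨⟨⟨hy.of_edge_left hk hx hu.ne_zero, fun h' => ?_⟩, fun h' => ?_⟩,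
          by simp [hxk], hu⟩, ?_⟩
        · rw [hxk] at h'
          exact absurd h'.1 (by simp)
        · rw [hxl] at h'
          exact absurd h'.2 (by simp)
        · rintro x' - hxk' hD
          refine huniq x' ?_ hD
          rw [eq_flip_of_diffCoeff_ne_zero hD (by simpa using hxk') hyk, flip_flip]
    · refine ExactOn.congr h fun x => ?_
      rw [isStateOf_update (by rw [Function.update_of_ne hkl.symm, hl]), isStateOf_update hk]
      constructor
      · rintro ⟨⟨h1, h2⟩, h3⟩
        exact ⟨⟨h1, by simp [h2]⟩, h2, h3⟩
      · rintro ⟨⟨h1, -⟩, h2, h3⟩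
        exact ⟨⟨h1, h2⟩, h3⟩
  · refine ExactOn.of_matching (fun x => x.1 l = true) i (hp.sub hs)
      diffCoeff_sq (fun x y => homDegree_rel) ?_ ?_
    · rintro x ⟨hx, hxk, hxo⟩ hxl
      replace hxl : x.1 l = false := by simpa using hxl
      replace hxo := hxo.resolve_left (by simp [hxl])
      obtain ⟨-, hf, hco, -⟩ := hcirc x.1 hx.1 hxk hxl
      rw [label_congr x hco] at hxo
      obtain ⟨y, hy, hu, huniq⟩ := merge_matching_right ho hxl hf hxo
      have hyl : y.1 l = true := by simp [hy, hxl]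
      refine ⟨y, ⟨⟨hx.of_edge_right hl hy hu.ne_zero, le_of_diffCoeff_ne_zero hu.ne_zero hxk,
        .inl hyl⟩, hyl, hu⟩, ?_⟩
      rintro y' - hyl' hD
      exact huniq y' (eq_flip_of_diffCoeff_ne_zero hD hxl hyl') hD
    · rintro y ⟨hy, hyk, -⟩ hyl
      have hek : (flip y.1 l) k = true := by rw [flip_of_ne _ hkl, hyk]
      have hel : (flip y.1 l) l = false := by simp [hyl]
      obtain ⟨-, hf, hco, -⟩ := hcirc (flip y.1 l) (hy.1.flip hl) hek hel
      obtain ⟨x, hx, hxo, hu, huniq⟩ := merge_matching_left ho hyl hf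
      have hxk : x.1 k = true := by rw [hx, hek]
      have hxl : x.1 l = false := by rw [hx, hel]
      rw [← hx] at hco
      refine ⟨x, ⟨⟨hy.of_edge_left hl hx hu.ne_zero, hxk, .inr ?_⟩, by simp [hxl], hu⟩, ?_⟩
      · rw [label_congr x hco, hxo]
      · rintro x' ⟨hx', hxk', hxo'⟩ hxl' hD
        replace hxl' : x'.1 l = false := by simpa using hxl'
        have hx1 : x'.1 = flip y.1 l := by
          rw [eq_flip_of_diffCoeff_ne_zero hD hxl' hyl, flip_flip]
        refine huniq x' hx1 ?_ hD
        rw [← label_congr x' (hcirc x'.1 hx'.1 hxk' hxl').2.2.1]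
        exact hxo'.resolve_left (by simp [hxl'])

end Moves

end Khovanov

namespace Khovanov

/-! ### The circle enclosed by a cup and a cap -/

section Strip

variable {m : ℕ} {w : BraidWord m}

/-- All crossings of the braid word are positive. -/
def AllPositive (w : BraidWord m) : Prop := ∀ k : Fin w.crossings, (w.get k).2 = true

/-- The strands of the two letters do not meet. -/
def Far (i j : ℕ) : Prop := i + 2 ≤ j ∨ j + 2 ≤ i

theorem AllPositive.isVertical_iff (hw : AllPositive w) (e : Resolution w) (k : Fin w.crossings) :
    isVertical w e k ↔ e k = false := by
  rw [isVertical, isPositive, hw k]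
  simp

@[simp] theorem leftStrand_val (k : Fin w.crossings) : (leftStrand w k).val = (w.get k).1.val := rfl

@[simp] theorem rightStrand_val (k : Fin w.crossings) :
    (rightStrand w k).val = (w.get k).1.val + 1 := rfl

/-- The points of the circle between a cup and a cap in the same position. -/
def InStrip (k₀ k : Fin w.crossings) (p : Point w) : Prop :=
  k₀.val < p.1.val ∧ p.1.val ≤ k.val ∧
    (p.2.val = (w.get k).1.val ∨ p.2.val = (w.get k).1.val + 1)

/-- The strands between the crossings `k₀` and `k` are not connected to the other ones. -/
structure IsFreeStrip (e : Resolution w) (k₀ k : Fin w.crossings) : Prop where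
  lt : k₀ < k
  index_eq : (w.get k₀).1.val = (w.get k).1.val
  not_vertical_left : ¬ isVertical w e k₀
  not_vertical_right : ¬ isVertical w e k
  between : ∀ t, k₀ < t → t < k → Far (w.get t).1.val (w.get k).1.val ∨ isVertical w e t

namespace IsFreeStrip

variable {e : Resolution w} {k₀ k : Fin w.crossings} (h : IsFreeStrip e k₀ k)

include h

/-- An arc could leave the strip only at `k₀`, at `k`, or at a crossing between them that shares a
strand with it. The first two close the strip off by a cup and a cap, and the last kind is resolved
vertically. -/
theorem inStrip_iff_of_arc {p q : Point w} (hpq : Arc w e p q) :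
    InStrip k₀ k p ↔ InStrip k₀ k q := by
  have hlt : k₀.val < k.val := h.lt
  have hk := k.isLt
  have side : ∀ (l : Fin w.crossings) (s : Fin m),
      ((s ≠ leftStrand w l ∧ s ≠ rightStrand w l) ∨ isVertical w e l) →
      (InStrip k₀ k (l.castSucc, s) ↔ InStrip k₀ k (l.succ, s)) := by
    intro l s hl
    have h1 : l = k → ¬ (s.val = (w.get k).1.val ∨ s.val = (w.get k).1.val + 1) := by
      rintro rfl
      rcases hl with ⟨hl, hr⟩ | hv
      · rintro (hs | hs)
        · exact hl (Fin.ext hs)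
        · exact hr (Fin.ext hs)
      · exact absurd hv h.not_vertical_right
    have h2 : l = k₀ → ¬ (s.val = (w.get k).1.val ∨ s.val = (w.get k).1.val + 1) := by
      rintro rfl
      rw [← h.index_eq]
      rcases hl with ⟨hl, hr⟩ | hv
      · rintro (hs | hs)
        · exact hl (Fin.ext hs)
        · exact hr (Fin.ext hs)
      · exact absurd hv h.not_vertical_left
    rw [Fin.ext_iff] at h1 h2
    simp only [InStrip, Fin.val_castSucc, Fin.val_succ]
    by_cases hs : s.val = (w.get k).1.val ∨ s.val = (w.get k).1.val + 1
    · have h1' : l.val ≠ k.val := fun h' => h1 h' hs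
      have h2' : l.val ≠ k₀.val := fun h' => h2 h' hs
      simp only [hs, and_true]
      omega
    · simp only [hs, and_false]
  have turn : ∀ (l : Fin w.crossings) (t : Fin (w.crossings + 1)), ¬ isVertical w e l →
      ((t.val = l.val ∧ l ≠ k₀) ∨ (t.val = l.val + 1 ∧ l ≠ k)) →
      (InStrip k₀ k (t, leftStrand w l) ↔ InStrip k₀ k (t, rightStrand w l)) := by
    intro l t hl ht
    simp only [InStrip, leftStrand_val, rightStrand_val]
    by_cases hin : k₀.val < t.val ∧ t.val ≤ k.val
    · by_cases hl1 : l = k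
      · subst hl1; simp [hin]
      by_cases hl2 : l = k₀
      · subst hl2
        have hidx := h.index_eq
        constructor <;> intro hc <;> omega
      have hl1' := Fin.val_ne_of_ne hl1
      have hl2' := Fin.val_ne_of_ne hl2
      have hf := (h.between l (Fin.lt_def.2 (by omega)) (Fin.lt_def.2 (by omega))).resolve_right hl
      rw [Far] at hf
      omega
    · constructor
      · rintro ⟨h1, h2, -⟩; exact absurd ⟨h1, h2⟩ hin
      · rintro ⟨h1, h2, -⟩; exact absurd ⟨h1, h2⟩ hin
  cases hpq with
  | closing s =>
    simp only [InStrip, Fin.val_last, Fin.val_zero]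
    omega
  | pass l s hl hr => exact side l s (.inl ⟨hl, hr⟩)
  | verticalLeft l hv => exact side l _ (.inr hv)
  | verticalRight l hv => exact side l _ (.inr hv)
  | cap l hv =>
    by_cases hl : l = k₀
    · subst hl
      simp [InStrip]
    · exact turn l _ hv (.inl ⟨rfl, hl⟩)
  | cup l hv =>
    by_cases hl : l = k
    · subst hl
      simp [InStrip]
    · exact turn l _ hv (.inr ⟨rfl, hl⟩)

theorem inStrip_iff_of_conn {p q : Point w} (hpq : Conn w e p q) :
    InStrip k₀ k p ↔ InStrip k₀ k q :=
  Conn.mem_iff (fun _ _ => h.inStrip_iff_of_arc) hpq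

theorem inStrip_bottomLeft : InStrip k₀ k (bottomLeft w k) := by
  have hlt : k₀.val < k.val := h.lt
  simp [InStrip, hlt]

theorem not_conn_of_not_inStrip {p : Point w} (hp : ¬ InStrip k₀ k p) :
    ¬ Conn w e (bottomLeft w k) p :=
  fun hc => hp ((h.inStrip_iff_of_conn hc).1 h.inStrip_bottomLeft)

theorem conn_succ {t : Fin w.crossings} (h1 : k₀ < t) (h2 : t < k) {s : Fin m}
    (hs : s.val = (w.get k).1.val ∨ s.val = (w.get k).1.val + 1) :
    Conn w e (t.castSucc, s) (t.succ, s) := by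
  by_cases hl : s = leftStrand w t
  · subst hl
    refine .of_arc (.verticalLeft t ((h.between t h1 h2).resolve_left ?_))
    rw [Far]
    rw [leftStrand_val] at hs
    omega
  by_cases hr : s = rightStrand w t
  · subst hr
    refine .of_arc (.verticalRight t ((h.between t h1 h2).resolve_left ?_))
    rw [Far]
    rw [rightStrand_val] at hs
    omega
  exact .of_arc (.pass t s hl hr)

theorem conn_top {s : Fin m} (hs : s.val = (w.get k).1.val ∨ s.val = (w.get k).1.val + 1)
    (d : ℕ) : ∀ t : Fin (w.crossings + 1), k₀.val < t.val → t.val + d = k.val →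
      Conn w e (t, s) (k.castSucc, s) := by
  induction d with
  | zero =>
    intro t _ ht
    rw [show t = k.castSucc from Fin.ext ht]
    exact .refl _ _
  | succ d ih =>
    intro t h1 h2
    have hk := k.isLt
    let t' : Fin w.crossings := ⟨t.val, by omega⟩
    have := h.conn_succ (t := t') h1 (Fin.lt_def.2 (show t.val < k.val by omega)) hs
    exact this.trans (ih t'.succ (by simp only [Fin.val_succ, t']; omega)
      (by simp only [Fin.val_succ, t']; omega))

theorem conn_of_inStrip {p : Point w} (hp : InStrip k₀ k p) : Conn w e (bottomLeft w k) p := by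
  obtain ⟨t, s⟩ := p
  obtain ⟨h1, h2, hs⟩ := hp
  have h3 := h.conn_top hs (k.val - t.val) t h1 (by dsimp only at h2; omega)
  refine Conn.trans ?_ h3.symm
  rcases hs with hs | hs
  · rw [show s = leftStrand w k from Fin.ext hs]
    exact .refl _ _
  · rw [show s = rightStrand w k from Fin.ext hs]
    exact .of_arc (.cap k h.not_vertical_right)

end IsFreeStrip

theorem not_inStrip_of_far {k₀ k l : Fin w.crossings}
    (hl : k₀ < l → l < k → Far (w.get l).1.val (w.get k).1.val) (h₀ : l ≠ k₀) (h : l ≠ k) :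
    ¬ InStrip k₀ k (bottomLeft w l) ∧ ¬ InStrip k₀ k (topRight w l) := by
  have h₀' := Fin.val_ne_of_ne h₀
  have h' := Fin.val_ne_of_ne h
  rw [Fin.lt_def, Fin.lt_def, Far] at hl
  simp only [InStrip, leftStrand_val, rightStrand_val, Fin.val_castSucc, Fin.val_succ]
  constructor <;> intro hc <;> omega

/-- Removing a kink. -/
theorem khExactOn_kink (hw : AllPositive w) {ρ : PartialResolution w} {k₀ k : Fin w.crossings}
    (hlt : k₀ < k) (hidx : (w.get k₀).1.val = (w.get k).1.val) (h₀ : ρ k₀ = some true)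
    (hk : ρ k = none)
    (hb : ∀ t, k₀ < t → t < k → Far (w.get t).1.val (w.get k).1.val ∨ ρ t = some false) {i j : ℤ}
    (h : KhExactOn w (IsStateOf (Function.update ρ k (some true)) j) i) :
    KhExactOn w (IsStateOf ρ j) i := by
  refine khExactOn_of_kink hk (fun e he hek => ?_) h
  have hstrip : IsFreeStrip e k₀ k :=
    { lt := hlt
      index_eq := hidx
      not_vertical_left := by rw [hw.isVertical_iff, he k₀ true h₀]; simp
      not_vertical_right := by rw [hw.isVertical_iff, hek]; simp
      between := fun t h1 h2 => (hb t h1 h2).imp_right fun h' => by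
        rw [hw.isVertical_iff, he t false h'] }
  refine ⟨hstrip.not_conn_of_not_inStrip (by simp [InStrip]), fun l hl hlk => ?_⟩
  have hl0 : l ≠ k₀ := by
    rintro rfl
    rw [h₀] at hl
    exact absurd hl (by simp)
  have := not_inStrip_of_far (fun h1 h2 => (hb l h1 h2).resolve_right (by simp [hl])) hl0 hlk
  exact ⟨hstrip.not_conn_of_not_inStrip this.1, hstrip.not_conn_of_not_inStrip this.2⟩

/-- Pulling a strand across a cap. -/
theorem khExactOn_triangle (hw : AllPositive w) {ρ : PartialResolution w}
    {k₀ l k : Fin w.crossings} (hkl : k₀ < l) (hlk : l < k)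
    (hidx : (w.get k₀).1.val = (w.get k).1.val)
    (hidx' : (w.get l).1.val = (w.get k).1.val + 1 ∨ (w.get l).1.val + 1 = (w.get k).1.val)
    (h₀ : ρ k₀ = some true) (hl : ρ l = none) (hk : ρ k = none)
    (hb : ∀ t, k₀ < t → t < k → t ≠ l →
      Far (w.get t).1.val (w.get k).1.val ∨ ρ t = some false) {i j : ℤ}
    (h : KhExactOn w
      (IsStateOf (Function.update (Function.update ρ k (some false)) l (some true)) j) i) :
    KhExactOn w (IsStateOf ρ j) i := by
  have hkl' : k₀.val < l.val := hkl
  have hlk' : l.val < k.val := hlk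
  -- The end of `l` inside the strip is the bottom left one if `l` is one place to the right of `k`,
  -- and the top right one if it is one place to the left.
  obtain ⟨o, o', ho, hoin, ho'⟩ : ∃ o o', IsEndPair w l o o' ∧ InStrip k₀ k o ∧
      ¬ InStrip k₀ k o' := by
    rcases hidx' with h' | h'
    · refine ⟨_, _, .inl ⟨rfl, rfl⟩, ?_, ?_⟩ <;>
        simp only [InStrip, leftStrand_val, rightStrand_val, Fin.val_castSucc, Fin.val_succ] <;>
        omega
    · refine ⟨_, _, .inr ⟨rfl, rfl⟩, ?_, ?_⟩ <;>
        simp only [InStrip, leftStrand_val, rightStrand_val, Fin.val_castSucc, Fin.val_succ] <;>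
        omega
  refine khExactOn_of_triangle hlk.ne' hk hl ho (fun e he hek hel => ?_) h
  have hstrip : IsFreeStrip e k₀ k :=
    { lt := hkl.trans hlk
      index_eq := hidx
      not_vertical_left := by rw [hw.isVertical_iff, he k₀ true h₀]; simp
      not_vertical_right := by rw [hw.isVertical_iff, hek]; simp
      between := fun t h1 h2 => by
        by_cases htl : t = l
        · right
          rw [hw.isVertical_iff, htl, hel]
        · exact (hb t h1 h2 htl).imp_right fun h' => by rw [hw.isVertical_iff, he t false h'] }
  have hoo : ¬ Conn w e o o' := fun hc => ho' ((hstrip.inStrip_iff_of_conn hc).1 hoin)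
  refine ⟨hstrip.not_conn_of_not_inStrip (by simp [InStrip]), ?_, hstrip.conn_of_inStrip hoin,
    fun l' hl' hlk' hll' => ?_⟩
  · rcases ho with ⟨rfl, rfl⟩ | ⟨rfl, rfl⟩
    · exact hoo
    · exact fun hc => hoo hc.symm
  have hl0 : l' ≠ k₀ := by
    rintro rfl
    rw [h₀] at hl'
    exact absurd hl' (by simp)
  have := not_inStrip_of_far (fun h1 h2 => (hb l' h1 h2 hll').resolve_right (by simp [hl'])) hl0 hlk'
  exact ⟨hstrip.not_conn_of_not_inStrip this.1, hstrip.not_conn_of_not_inStrip this.2⟩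

end Strip

/-! ### Pushing a cup through the rows of the braid -/

section Rows

variable {m : ℕ} {w : BraidWord m}

/-- The letters of the braid word are the positive `σ₁, …, σ_M`, repeated cyclically. -/
def IsCyclic (w : BraidWord m) (M : ℕ) : Prop :=
  AllPositive w ∧ ∀ k : Fin w.crossings, (w.get k).1.val = k.val % M

/-- The number of crossings with a fixed `1`-resolution. -/
def onesCard (w : BraidWord m) (ρ : ℕ → Option Bool) : ℕ :=
  ((Finset.range w.crossings).filter fun t => ρ t = some true).card

/-- Exactness in degree `d` for the diagram partially resolved according to `ρ`. -/
def PartialExact (w : BraidWord m) (j : ℤ) (ρ : ℕ → Option Bool) (d : ℤ) : Prop :=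
  KhExactOn w (IsStateOf (fun k => ρ k.val) j) d

theorem onesCard_update_true {ρ : ℕ → Option Bool} {b : ℕ} (hb : b < w.crossings)
    (h : ρ b = none) : onesCard w (Function.update ρ b (some true)) = onesCard w ρ + 1 := by
  have : ((Finset.range w.crossings).filter fun t => Function.update ρ b (some true) t = some true) =
      insert b ((Finset.range w.crossings).filter fun t => ρ t = some true) := by
    ext t
    by_cases ht : t = b
    · subst ht; simp [hb]
    · simp [ht]
  rw [onesCard, onesCard, this, Finset.card_insert_of_notMem (by simp [h])]

theorem onesCard_update_false {ρ : ℕ → Option Bool} {b : ℕ}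
    (h : ρ b = none) : onesCard w (Function.update ρ b (some false)) = onesCard w ρ := by
  refine congrArg Finset.card (Finset.filter_congr fun t _ => ?_)
  by_cases ht : t = b
  · subst ht; simp [h]
  · simp [ht]

/-- Every state has at least as many 1's as are fixed by `ρ`, so there are no states in degree `d`.
All exactness proved below comes from this. -/
theorem partialExact_of_lt_onesCard {j : ℤ} {ρ : ℕ → Option Bool} {d : ℤ}
    (hd : d < onesCard w ρ) : PartialExact w j ρ d := by
  refine ExactOn.of_isEmpty fun x hx => ?_
  have : onesCard w ρ ≤ homDegree x := by
    rw [onesCard, homDegree]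
    refine Finset.card_le_card_of_surjOn Fin.val ?_
    intro t ht
    simp only [Finset.coe_filter, Finset.mem_range, Set.mem_ofPred_eq] at ht
    exact ⟨⟨t, ht.1⟩, by simpa using hx.1 ⟨t, ht.1⟩ true ht.2, rfl⟩
  omega

theorem update_comp_val (ρ : ℕ → Option Bool) (b : Fin w.crossings) (v : Option Bool) :
    (fun k : Fin w.crossings => Function.update ρ b.val v k.val) =
      Function.update (fun k : Fin w.crossings => ρ k.val) b v := by
  funext k
  by_cases h : k = b
  · subst h; simp
  · rw [Function.update_of_ne h, Function.update_of_ne (Fin.val_ne_of_ne h)]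

theorem PartialExact.kink {M : ℕ} (hw : IsCyclic w M) {j d : ℤ} {ρ : ℕ → Option Bool} {a b : ℕ}
    (hab : a < b) (hb : b < w.crossings) (hmod : a % M = b % M) (ha : ρ a = some true)
    (hρb : ρ b = none) (hbet : ∀ t, a < t → t < b → Far (t % M) (b % M) ∨ ρ t = some false)
    (h : PartialExact w j (Function.update ρ b (some true)) d) : PartialExact w j ρ d := by
  rw [PartialExact, show b = (⟨b, hb⟩ : Fin w.crossings).val from rfl, update_comp_val] at h
  refine khExactOn_kink hw.1 (k₀ := ⟨a, by omega⟩) (k := ⟨b, hb⟩) hab ?_ ha hρb ?_ h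
  · rw [hw.2, hw.2]; exact hmod
  · intro t h1 h2
    rw [hw.2, hw.2]
    exact hbet t.val h1 h2

theorem PartialExact.triangle {M : ℕ} (hw : IsCyclic w M) {j d : ℤ} {ρ : ℕ → Option Bool}
    {a l b : ℕ} (hal : a < l) (hlb : l < b) (hb : b < w.crossings) (hmod : a % M = b % M)
    (hmod' : l % M = b % M + 1 ∨ l % M + 1 = b % M) (ha : ρ a = some true) (hρl : ρ l = none)
    (hρb : ρ b = none)
    (hbet : ∀ t, a < t → t < b → t ≠ l → Far (t % M) (b % M) ∨ ρ t = some false)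
    (h : PartialExact w j (Function.update (Function.update ρ b (some false)) l (some true)) d) :
    PartialExact w j ρ d := by
  rw [PartialExact, show b = (⟨b, hb⟩ : Fin w.crossings).val from rfl,
    show l = (⟨l, by omega⟩ : Fin w.crossings).val from rfl, update_comp_val, update_comp_val] at h
  refine khExactOn_triangle hw.1 (k₀ := ⟨a, by omega⟩) (l := ⟨l, by omega⟩) (k := ⟨b, hb⟩) hal hlb
    ?_ ?_ ha hρl hρb ?_ h
  · rw [hw.2, hw.2]; exact hmod
  · rw [hw.2, hw.2]; exact hmod'
  · intro t h1 h2 h3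
    rw [hw.2, hw.2]
    exact hbet t.val h1 h2 fun h' => h3 (Fin.ext h')

theorem mod_eq_sub_of_dvd {M c t : ℕ} (hc : M ∣ c) (h1 : c ≤ t) (h2 : t < c + M) :
    t % M = t - c := by
  obtain ⟨q, rfl⟩ := hc
  obtain ⟨s, rfl⟩ := Nat.exists_eq_add_of_le h1
  rw [Nat.mul_add_mod, Nat.mod_eq_of_lt (by omega)]
  omega

/-- Moving a cap through a full row from the left to the right. -/
theorem PartialExact.sweep {M : ℕ} (hw : IsCyclic w M) {j d : ℤ} {c : ℕ} (hc : M ∣ c)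
    (hlen : c + 2 * M ≤ w.crossings) (q : ℕ) : ∀ (i : ℕ) (ρ : ℕ → Option Bool), i + q + 1 = M →
      ρ (c + i) = some true → (∀ t, c + i < t → t < c + M → ρ t = none) →
      (∀ t, c + M ≤ t → t < c + M + i → ρ t = some false) → (∀ t, c + M + i ≤ t → ρ t = none) →
      (∀ ρ' : ℕ → Option Bool, onesCard w ρ' = onesCard w ρ + q + 1 →
        ρ' (c + M + (M - 1)) = some true → (∀ t, c + 2 * M ≤ t → ρ' t = none) →
        PartialExact w j ρ' d) → PartialExact w j ρ d := by
  have hc' : M ∣ c + M := (Nat.dvd_add_self_right).2 hc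
  induction q with
  | zero =>
    intro i ρ hi h1 h2 h3 h4 H
    have hρb : ρ (c + M + i) = none := h4 _ le_rfl
    -- At the right edge no further crossing of this row lies in the way, and those of the next row
    -- before position `i` are 0-resolved. The crossing of the same index is a kink.
    refine PartialExact.kink hw (a := c + i) (b := c + M + i) (by omega) (by omega) ?_ h1 hρb ?_
      (H _ ?_ ?_ ?_)
    · rw [mod_eq_sub_of_dvd hc (by omega) (by omega), mod_eq_sub_of_dvd hc' (by omega) (by omega)]
      omega
    · intro t ht1 ht2
      exact .inr (h3 t (by omega) (by omega))
    · rw [onesCard_update_true (by omega) hρb]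
    · rw [show c + M + (M - 1) = c + M + i by omega, Function.update_self]
    · intro t ht
      rw [Function.update_of_ne (by omega), h4 t (by omega)]
  | succ q ih =>
    intro i ρ hi h1 h2 h3 h4 H
    have hρb : ρ (c + M + i) = none := h4 _ le_rfl
    have hρl : ρ (c + (i + 1)) = none := h2 _ (by omega) (by omega)
    have hρl' : Function.update ρ (c + M + i) (some false) (c + (i + 1)) = none := by
      rw [Function.update_of_ne (by omega), hρl]
    have mb : (c + M + i) % M = i := by
      rw [mod_eq_sub_of_dvd hc' (by omega) (by omega)]; omega
    -- The cup at position `i` meets position `i + 1` of its own row and then position `i` of the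
    -- next one. It moves one place to the right in the same row, leaving a vertical resolution
    -- behind in the next row.
    refine PartialExact.triangle hw (a := c + i) (l := c + (i + 1)) (b := c + M + i) (by omega)
      (by omega) (by omega) ?_ ?_ h1 hρl hρb ?_ (ih (i + 1) _ (by omega) ?_ ?_ ?_ ?_ fun ρ' hρ' => H ρ' ?_)
    · rw [mb, mod_eq_sub_of_dvd hc (by omega) (by omega)]
      omega
    · rw [mb, mod_eq_sub_of_dvd hc (by omega) (by omega)]
      omega
    · intro t ht1 ht2 ht3
      by_cases ht : t < c + M
      · left
        rw [mb, mod_eq_sub_of_dvd hc (by omega) (by omega), Far]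
        omega
      · exact .inr (h3 t (by omega) (by omega))
    · rw [Function.update_self]
    · intro t ht1 ht2
      rw [Function.update_of_ne (by omega), Function.update_of_ne (by omega), h2 t (by omega) ht2]
    · intro t ht1 ht2
      rw [Function.update_of_ne (by omega)]
      by_cases ht : t = c + M + i
      · rw [ht, Function.update_self]
      · rw [Function.update_of_ne ht, h3 t ht1 (by omega)]
    · intro t ht
      rw [Function.update_of_ne (by omega), Function.update_of_ne (by omega), h4 t (by omega)]
    · rw [hρ', onesCard_update_true (by omega) hρl', onesCard_update_false hρb]
      omega

/-- Moving a cap through `N` rows yields enough fixed `1`-resolutions. -/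
theorem partialExact_of_rows {M : ℕ} (hw : IsCyclic w M) {j d : ℤ} (N : ℕ) :
    ∀ (c i : ℕ) (ρ : ℕ → Option Bool), M ∣ c → w.crossings = c + M + N * M → i < M →
      ρ (c + i) = some true → (i + 1 < M → ρ (c + (i + 1)) = some false) →
      (∀ t, c + M ≤ t → ρ t = none) →
      d < (onesCard w ρ : ℤ) + (if i + 2 ≤ N then M + N - 1 else N : ℕ) →
      PartialExact w j ρ d := by
  -- With `N` rows left, a cup at position `i` takes `i` rows to reach the left edge and two more
  -- for the kink and the sweep. These two rows yield `M + 1` ones, and every other row is counted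
  -- once: hence `M + N - 1` if `i + 2 ≤ N`, and `N` otherwise. The induction is strong because a
  -- sweep uses up two rows.
  induction N using Nat.strong_induction_on with
  | _ N ih =>
  intro c i ρ hc hlen hi h1 h2 h3 hd
  have hc' : M ∣ c + M := (Nat.dvd_add_self_right).2 hc
  cases N with
  | zero =>
    refine partialExact_of_lt_onesCard ?_
    rw [if_neg (by omega)] at hd
    omega
  | succ N =>
  rw [Nat.succ_mul] at hlen
  cases i with
  | succ i =>
    have hρb : ρ (c + M + (i + 1)) = none := h3 _ (by omega)
    have hρl : ρ (c + M + i) = none := h3 _ (by omega)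
    have hρl' : Function.update ρ (c + M + (i + 1)) (some false) (c + M + i) = none := by
      rw [Function.update_of_ne (by omega), hρl]
    have mb : (c + M + (i + 1)) % M = i + 1 := by
      rw [mod_eq_sub_of_dvd hc' (by omega) (by omega)]; omega
    -- Position `i` of the next row comes before position `i + 1`, so the cup moves one place to the
    -- left on entering that row. The crossing to its right in the old row is harmless by `h2`, and
    -- the 0-resolution left at `i + 1` restores this condition in the new row.
    refine PartialExact.triangle hw (a := c + (i + 1)) (l := c + M + i) (b := c + M + (i + 1))
      (by omega) (by omega) (by omega) ?_ ?_ h1 hρl hρb ?_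
      (ih N (by omega) (c + M) i _ hc' (by omega) (by omega) ?_ ?_ ?_ ?_)
    · rw [mb, mod_eq_sub_of_dvd hc (by omega) (by omega)]
      omega
    · rw [mb, mod_eq_sub_of_dvd hc' (by omega) (by omega)]
      omega
    · intro t ht1 ht2 ht3
      rw [mb, Far]
      by_cases ht : t < c + M
      · by_cases ht' : t = c + (i + 1 + 1)
        · right
          rw [ht']
          exact h2 (by omega)
        · left
          rw [mod_eq_sub_of_dvd hc (by omega) (by omega)]
          omega
      · left
        rw [mod_eq_sub_of_dvd hc' (by omega) (by omega)]
        omega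
    · rw [Function.update_self]
    · intro _
      rw [Function.update_of_ne (by omega), Function.update_self]
    · intro t ht
      rw [Function.update_of_ne (by omega), Function.update_of_ne (by omega), h3 t (by omega)]
    · rw [onesCard_update_true (by omega) hρl', onesCard_update_false hρb]
      split_ifs at hd ⊢ <;> omega
  | zero =>
    have hρb : ρ (c + M) = none := h3 _ (by omega)
    have hlen0 : c + M < w.crossings := by omega
    have hones := onesCard_update_true hlen0 hρb
    have mb : (c + M) % M = 0 := by
      rw [mod_eq_sub_of_dvd hc' (by omega) (by omega)]; omega
    -- At the left edge there is no smaller index, so the next crossing that matters is a kink.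
    refine PartialExact.kink hw (a := c + 0) (b := c + M) (by omega) hlen0 ?_ h1 hρb ?_ ?_
    · rw [mb, mod_eq_sub_of_dvd hc (by omega) (by omega)]
      omega
    · intro t ht1 ht2
      rw [mb, Far]
      by_cases ht' : t = c + 1
      · right
        rw [ht']
        exact h2 (by omega)
      · left
        rw [mod_eq_sub_of_dvd hc (by omega) (by omega)]
        omega
    cases N with
    | zero =>
      refine partialExact_of_lt_onesCard ?_
      rw [hones]
      rw [if_neg (by omega)] at hd
      omega
    | succ N =>
      rw [Nat.succ_mul] at hlen
      -- The rest of the row containing the kink is still unresolved, so the new cup can be swept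
      -- through it to the right edge.
      refine PartialExact.sweep hw hc' (by omega) (M - 1) 0 _ (by omega) ?_ ?_ ?_ ?_ ?_
      · rw [add_zero, Function.update_self]
      · intro t ht1 ht2
        rw [Function.update_of_ne (by omega), h3 t (by omega)]
      · intro t ht1 ht2
        omega
      · intro t ht
        rw [Function.update_of_ne (by omega), h3 t (by omega)]
      · intro ρ' hρ' h1' h3'
        -- For the `N` rows that remain the weaker bound `N` suffices: `(M + 1) + N = M + (N + 2) -
        -- 1`.
        refine ih N (by omega) (c + M + M) (M - 1) ρ' ((Nat.dvd_add_self_right).2 hc') (by omega)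
          (by omega) h1' (fun h => by omega) (fun t ht => h3' t (by omega)) ?_
        rw [if_pos (by omega)] at hd
        split_ifs <;> omega

/-- The subcomplex spanned by the states with a `1`-resolution in the first row is exact in low
degrees. -/
theorem khExactOn_firstRow {M N : ℕ} (hw : IsCyclic w M) (hlen : w.crossings = M + N * M)
    (hN : M + 1 ≤ N) {j d : ℤ} (hd : d < (M : ℤ) + N) :
    KhExactOn w (fun x => (∃ k : Fin w.crossings, k.val < M ∧ x.1 k = true) ∧ qDegree x = j) d := by
  -- Add one layer at a time according to the position of the last 1 in the first row. The layer
  -- with this position equal to `s` is a partial resolution: free before `s`, 1 at `s`, and 0 after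
  -- it.
  have main : ∀ s ≤ M, KhExactOn w (fun x => ((∃ k : Fin w.crossings, k.val < M ∧ x.1 k = true) ∧
      qDegree x = j) ∧ ∀ k : Fin w.crossings, k.val < M → x.1 k = true → k.val < s) d := by
    intro s
    induction s with
    | zero =>
      intro _
      refine ExactOn.of_isEmpty ?_
      rintro x ⟨⟨⟨k, hk, hxk⟩, -⟩, h⟩
      exact absurd (h k hk hxk) (by omega)
    | succ s ih =>
      intro hs
      have hsl : s < w.crossings := by
        rw [hlen]; omega
      refine ExactOn.extension (fun x => x.1 ⟨s, hsl⟩ = true) ?_ diffCoeff_sq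
        (fun x y => homDegree_rel) (fun x y _ _ hx hD => le_of_diffCoeff_ne_zero hD hx)
        ((ih (by omega)).congr fun x => ?_) ?_
      · rintro x y z ⟨⟨⟨k, hk, hxk⟩, hq⟩, -⟩ ⟨-, hy⟩ hxz hzy
        exact ⟨⟨⟨k, hk, le_of_diffCoeff_ne_zero hxz hxk⟩,
          (qDegree_of_diffCoeff_ne_zero hxz).trans hq⟩,
          fun l hl hzl => hy l hl (le_of_diffCoeff_ne_zero hzy hzl)⟩
      · constructor
        · rintro ⟨h1, h2⟩
          refine ⟨⟨h1, fun k hk hxk => (h2 k hk hxk).trans (by omega)⟩, fun hxs => ?_⟩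
          exact absurd (h2 ⟨s, hsl⟩ (show s < M by omega) hxs) (lt_irrefl s)
        · rintro ⟨⟨h1, h2⟩, h3⟩
          refine ⟨h1, fun k hk hxk => ?_⟩
          have := h2 k hk hxk
          have hks : k.val ≠ s := by
            rintro rfl
            exact h3 hxk
          omega
      · let ρ : ℕ → Option Bool := fun t =>
          if t < s then none else if t = s then some true else if t < M then some false else none
        have h1 : 1 ≤ onesCard w ρ := by
          rw [onesCard, Nat.one_le_iff_ne_zero, Finset.card_ne_zero]
          exact ⟨s, by simp [hsl, ρ]⟩
        -- From `s < M` and `M + 1 ≤ N` follows `s + 2 ≤ N`, so the better bound `M + N - 1`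
        -- applies. The 1 fixed at `s` raises it to `M + N`.
        have := partialExact_of_rows (j := j) (d := d) hw N 0 s ρ (dvd_zero M) (by omega) (by omega)
          (by simp [ρ])
          (fun h => by simp only [ρ]; rw [if_neg (by omega), if_neg (by omega), if_pos (by omega)])
          (fun t ht => by
            simp only [ρ]; rw [if_neg (by omega), if_neg (by omega), if_neg (by omega)])
          (by rw [if_pos (by omega)]; omega)
        refine ExactOn.congr this fun x => ?_
        constructor
        · rintro ⟨h2, h3⟩
          have hxs : x.1 ⟨s, hsl⟩ = true := h2 ⟨s, hsl⟩ true (by simp [ρ])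
          refine ⟨⟨⟨⟨⟨s, hsl⟩, (show s < M by omega), hxs⟩, h3⟩, fun k hk hxk => ?_⟩, hxs⟩
          by_contra hks
          have := h2 k false (by
            simp only [ρ]; rw [if_neg (by omega), if_neg (by omega), if_pos hk])
          rw [hxk] at this
          exact absurd this (by simp)
        · rintro ⟨⟨⟨-, h2⟩, h3⟩, h4⟩
          refine ⟨fun k b hb => ?_, h2⟩
          simp only [ρ] at hb
          split_ifs at hb with c1 c2 c3
          · rw [show k = ⟨s, hsl⟩ from Fin.ext c2, h4]
            simpa using hb
          · have : x.1 k ≠ true := fun h' => by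
              have := h3 k c3 h'
              omega
            rw [← Option.some.inj hb]
            simpa using this
  exact (main M le_rfl).congr fun x => ⟨fun h => h.1, fun h => ⟨h, fun _ hk _ => hk⟩⟩

end Rows

end Khovanov

namespace Khovanov

/-! ### Prepending 0-resolved positive crossings -/

section Prefix

variable {m : ℕ} (u w : BraidWord m)

theorem crossings_append : BraidWord.crossings (u ++ w : BraidWord m) = u.crossings + w.crossings :=
  List.length_append

/-- A crossing of `w` as a crossing of `u ++ w`. -/
def shiftCrossing (k : Fin w.crossings) : Fin (BraidWord.crossings (u ++ w : BraidWord m)) :=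
  ⟨u.crossings + k.val, by rw [crossings_append]; omega⟩

/-- A point of `w` as a point of `u ++ w`. -/
def shiftPoint (p : Point w) : Point (u ++ w : BraidWord m) :=
  (⟨u.crossings + p.1.val, by rw [crossings_append]; omega⟩, p.2)

/-- Contraction of the levels of `u`. -/
def contractPoint (p : Point (u ++ w : BraidWord m)) : Point w :=
  (⟨p.1.val - u.crossings, by
    have := p.1.isLt
    have := crossings_append u w
    omega⟩, p.2)

/-- The resolution of `u ++ w` which is `0` on `u`. -/
def extendResolution (e : Resolution w) : Resolution (u ++ w : BraidWord m) := fun k =>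
  if h : k.val < u.crossings then false else
    e ⟨k.val - u.crossings, by
      have := k.isLt
      have := crossings_append u w
      omega⟩

variable {u w}

@[simp] theorem shiftCrossing_val (k : Fin w.crossings) :
    (shiftCrossing u w k).val = u.crossings + k.val := rfl

theorem get_shiftCrossing (k : Fin w.crossings) :
    List.get (u ++ w) (shiftCrossing u w k) = w.get k := by
  simp [shiftCrossing]

theorem shiftCrossing_injective : Function.Injective (shiftCrossing u w) := by
  intro k l h
  have := congrArg Fin.val h
  simp only [shiftCrossing_val] at this
  exact Fin.ext (by omega)

theorem exists_shiftCrossing {k : Fin (BraidWord.crossings (u ++ w : BraidWord m))}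
    (hk : ¬ k.val < u.crossings) : ∃ l, shiftCrossing u w l = k := by
  have := k.isLt
  have := crossings_append u w
  exact ⟨⟨k.val - u.crossings, by omega⟩, Fin.ext (by simp only [shiftCrossing_val]; omega)⟩

theorem extendResolution_shiftCrossing (e : Resolution w) (k : Fin w.crossings) :
    extendResolution u w e (shiftCrossing u w k) = e k := by
  rw [extendResolution, dif_neg (by simp)]
  congr 1
  exact Fin.ext (by simp)

theorem extendResolution_of_lt (e : Resolution w)
    {k : Fin (BraidWord.crossings (u ++ w : BraidWord m))} (hk : k.val < u.crossings) :
    extendResolution u w e k = false := dif_pos hk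

theorem extendResolution_injective : Function.Injective (extendResolution u w) := by
  intro e e' h
  funext k
  rw [← extendResolution_shiftCrossing (u := u) e, h, extendResolution_shiftCrossing]

theorem extendResolution_flip (e : Resolution w) (k : Fin w.crossings) :
    extendResolution u w (flip e k) = flip (extendResolution u w e) (shiftCrossing u w k) := by
  funext l
  by_cases hl : l.val < u.crossings
  · rw [flip_of_ne, extendResolution_of_lt _ hl, extendResolution_of_lt _ hl]
    rintro rfl
    simp at hl
  · obtain ⟨l, rfl⟩ := exists_shiftCrossing hl
    rw [extendResolution_shiftCrossing]
    by_cases hlk : l = k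
    · subst hlk
      rw [flip_self, flip_self, extendResolution_shiftCrossing]
    · rw [flip_of_ne _ hlk, flip_of_ne _ fun h => hlk (shiftCrossing_injective h),
        extendResolution_shiftCrossing]

theorem leftStrand_shiftCrossing (k : Fin w.crossings) :
    leftStrand (u ++ w : BraidWord m) (shiftCrossing u w k) = leftStrand w k :=
  Fin.ext (by rw [leftStrand_val, leftStrand_val, get_shiftCrossing])

theorem rightStrand_shiftCrossing (k : Fin w.crossings) :
    rightStrand (u ++ w : BraidWord m) (shiftCrossing u w k) = rightStrand w k :=
  Fin.ext (by rw [rightStrand_val, rightStrand_val, get_shiftCrossing])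

theorem isVertical_shiftCrossing (e : Resolution w) (k : Fin w.crossings) :
    isVertical (u ++ w : BraidWord m) (extendResolution u w e) (shiftCrossing u w k) ↔
      isVertical w e k := by
  rw [isVertical, isVertical, extendResolution_shiftCrossing, isPositive, isPositive,
    get_shiftCrossing]

@[simp] theorem contractPoint_shiftPoint (p : Point w) :
    contractPoint u w (shiftPoint u w p) = p := by
  obtain ⟨t, s⟩ := p
  simp [contractPoint, shiftPoint]

theorem shiftPoint_castSucc (k : Fin w.crossings) (s : Fin m) :
    shiftPoint u w (k.castSucc, s) = ((shiftCrossing u w k).castSucc, s) := rfl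

theorem shiftPoint_succ (k : Fin w.crossings) (s : Fin m) :
    shiftPoint u w (k.succ, s) = ((shiftCrossing u w k).succ, s) := rfl

theorem shiftPoint_bottomLeft (k : Fin w.crossings) :
    shiftPoint u w (bottomLeft w k) = bottomLeft (u ++ w : BraidWord m) (shiftCrossing u w k) := by
  rw [bottomLeft, bottomLeft, leftStrand_shiftCrossing, shiftPoint_castSucc]

theorem shiftPoint_topRight (k : Fin w.crossings) :
    shiftPoint u w (topRight w k) = topRight (u ++ w : BraidWord m) (shiftCrossing u w k) := by
  rw [topRight, topRight, rightStrand_shiftCrossing, shiftPoint_succ]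

theorem get_append_of_lt {k : Fin (BraidWord.crossings (u ++ w : BraidWord m))}
    (hk : k.val < u.crossings) : List.get (u ++ w) k = u.get ⟨k.val, hk⟩ := by
  simp [List.getElem_append_left hk]

theorem isVertical_extendResolution_of_lt (hu : AllPositive u) (e : Resolution w)
    {k : Fin (BraidWord.crossings (u ++ w : BraidWord m))} (hk : k.val < u.crossings) :
    isVertical (u ++ w : BraidWord m) (extendResolution u w e) k := by
  rw [isVertical, extendResolution_of_lt e hk, isPositive, get_append_of_lt hk, hu]
  simp

theorem conn_prefix_succ (hu : AllPositive u) (e : Resolution w)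
    {k : Fin (BraidWord.crossings (u ++ w : BraidWord m))} (hk : k.val < u.crossings) (s : Fin m) :
    Conn (u ++ w : BraidWord m) (extendResolution u w e) (k.castSucc, s) (k.succ, s) := by
  have hv := isVertical_extendResolution_of_lt hu e hk
  by_cases hl : s = leftStrand (u ++ w : BraidWord m) k
  · rw [hl]; exact .of_arc (.verticalLeft k hv)
  by_cases hr : s = rightStrand (u ++ w : BraidWord m) k
  · rw [hr]; exact .of_arc (.verticalRight k hv)
  exact .of_arc (.pass k s hl hr)

/-- Truncated subtraction contracts all levels of `u` to the lowest level of `w`; the vertical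
strands through `u` connect these levels. -/
theorem conn_shiftPoint_contractPoint (hu : AllPositive u) (e : Resolution w)
    (p : Point (u ++ w : BraidWord m)) :
    Conn (u ++ w : BraidWord m) (extendResolution u w e) p
      (shiftPoint u w (contractPoint u w p)) := by
  obtain ⟨t, s⟩ := p
  by_cases ht : u.crossings ≤ t.val
  · have : shiftPoint u w (contractPoint u w (t, s)) = (t, s) :=
      Prod.ext (Fin.ext (by simp only [shiftPoint, contractPoint]; omega)) rfl
    rw [this]
    exact .refl _ _
  · obtain ⟨d, hd⟩ : ∃ d, t.val + d = u.crossings := ⟨u.crossings - t.val, by omega⟩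
    have hsc : shiftPoint u w (contractPoint u w (t, s)) =
        (⟨u.crossings, by rw [crossings_append]; omega⟩, s) :=
      Prod.ext (Fin.ext (by simp only [shiftPoint, contractPoint]; omega)) rfl
    rw [hsc]
    clear ht hsc
    induction d generalizing t with
    | zero =>
      rw [show t = ⟨u.crossings, by rw [crossings_append]; omega⟩ from Fin.ext hd]
      exact .refl _ _
    | succ d ih =>
      let k : Fin (BraidWord.crossings (u ++ w : BraidWord m)) :=
        ⟨t.val, by have := crossings_append u w; omega⟩
      exact (conn_prefix_succ hu e (k := k) (show t.val < _ by omega) s).trans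
        (ih k.succ (by simp only [Fin.val_succ, k]; omega))

theorem conn_shiftPoint_of_arc (hu : AllPositive u) {e : Resolution w} {p q : Point w}
    (h : Arc w e p q) : Conn (u ++ w : BraidWord m) (extendResolution u w e)
      (shiftPoint u w p) (shiftPoint u w q) := by
  cases h with
  | closing s =>
    have h1 : shiftPoint u w (Fin.last _, s) = (Fin.last _, s) :=
      Prod.ext (Fin.ext (by simp only [shiftPoint, Fin.val_last, crossings_append])) rfl
    have h2 : contractPoint u w (0, s) = (0, s) :=
      Prod.ext (Fin.ext (by simp [contractPoint])) rfl
    rw [h1, ← h2]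
    exact (Conn.of_arc (.closing s)).trans (conn_shiftPoint_contractPoint hu e _)
  | pass k s hl hr =>
    rw [shiftPoint_castSucc, shiftPoint_succ]
    exact .of_arc (.pass _ s (by rwa [leftStrand_shiftCrossing])
      (by rwa [rightStrand_shiftCrossing]))
  | verticalLeft k hv =>
    rw [shiftPoint_castSucc, shiftPoint_succ, ← leftStrand_shiftCrossing (u := u)]
    exact .of_arc (.verticalLeft _ ((isVertical_shiftCrossing e k).2 hv))
  | verticalRight k hv =>
    rw [shiftPoint_castSucc, shiftPoint_succ, ← rightStrand_shiftCrossing (u := u)]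
    exact .of_arc (.verticalRight _ ((isVertical_shiftCrossing e k).2 hv))
  | cap k hv =>
    rw [shiftPoint_castSucc, shiftPoint_castSucc, ← leftStrand_shiftCrossing (u := u),
      ← rightStrand_shiftCrossing (u := u)]
    exact .of_arc (.cap _ ((isVertical_shiftCrossing e k).not.2 hv))
  | cup k hv =>
    rw [shiftPoint_succ, shiftPoint_succ, ← leftStrand_shiftCrossing (u := u),
      ← rightStrand_shiftCrossing (u := u)]
    exact .of_arc (.cup _ ((isVertical_shiftCrossing e k).not.2 hv))

theorem contractPoint_castSucc_shiftCrossing (k : Fin w.crossings) (s : Fin m) :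
    contractPoint u w ((shiftCrossing u w k).castSucc, s) = (k.castSucc, s) := by
  rw [← shiftPoint_castSucc, contractPoint_shiftPoint]

theorem contractPoint_succ_shiftCrossing (k : Fin w.crossings) (s : Fin m) :
    contractPoint u w ((shiftCrossing u w k).succ, s) = (k.succ, s) := by
  rw [← shiftPoint_succ, contractPoint_shiftPoint]

theorem contractPoint_succ_of_lt {k : Fin (BraidWord.crossings (u ++ w : BraidWord m))}
    (hk : k.val < u.crossings) (s : Fin m) :
    contractPoint u w (k.succ, s) = contractPoint u w (k.castSucc, s) :=
  Prod.ext (Fin.ext (by simp only [contractPoint, Fin.val_succ, Fin.val_castSucc]; omega)) rfl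

theorem conn_contractPoint_of_arc (hu : AllPositive u) {e : Resolution w}
    {p q : Point (u ++ w : BraidWord m)}
    (h : Arc (u ++ w : BraidWord m) (extendResolution u w e) p q) :
    Conn w e (contractPoint u w p) (contractPoint u w q) := by
  cases h with
  | closing s =>
    have h1 : contractPoint u w (Fin.last _, s) = (Fin.last _, s) :=
      Prod.ext (Fin.ext (by
        simp only [contractPoint, Fin.val_last, crossings_append]; omega)) rfl
    have h2 : contractPoint u w (0, s) = (0, s) :=
      Prod.ext (Fin.ext (by simp [contractPoint])) rfl
    rw [h1, h2]
    exact .of_arc (.closing s)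
  | pass k s hl hr =>
    by_cases hk : k.val < u.crossings
    · rw [contractPoint_succ_of_lt hk]; exact .refl _ _
    obtain ⟨k, rfl⟩ := exists_shiftCrossing hk
    rw [contractPoint_castSucc_shiftCrossing, contractPoint_succ_shiftCrossing]
    rw [leftStrand_shiftCrossing] at hl
    rw [rightStrand_shiftCrossing] at hr
    exact .of_arc (.pass k s hl hr)
  | verticalLeft k hv =>
    by_cases hk : k.val < u.crossings
    · rw [contractPoint_succ_of_lt hk]; exact .refl _ _
    obtain ⟨k, rfl⟩ := exists_shiftCrossing hk
    rw [contractPoint_castSucc_shiftCrossing, contractPoint_succ_shiftCrossing,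
      leftStrand_shiftCrossing]
    exact .of_arc (.verticalLeft k ((isVertical_shiftCrossing e k).1 hv))
  | verticalRight k hv =>
    by_cases hk : k.val < u.crossings
    · rw [contractPoint_succ_of_lt hk]; exact .refl _ _
    obtain ⟨k, rfl⟩ := exists_shiftCrossing hk
    rw [contractPoint_castSucc_shiftCrossing, contractPoint_succ_shiftCrossing,
      rightStrand_shiftCrossing]
    exact .of_arc (.verticalRight k ((isVertical_shiftCrossing e k).1 hv))
  | cap k hv =>
    by_cases hk : k.val < u.crossings
    · exact absurd (isVertical_extendResolution_of_lt hu e hk) hv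
    obtain ⟨k, rfl⟩ := exists_shiftCrossing hk
    rw [contractPoint_castSucc_shiftCrossing, contractPoint_castSucc_shiftCrossing,
      leftStrand_shiftCrossing, rightStrand_shiftCrossing]
    exact .of_arc (.cap k ((isVertical_shiftCrossing e k).not.1 hv))
  | cup k hv =>
    by_cases hk : k.val < u.crossings
    · exact absurd (isVertical_extendResolution_of_lt hu e hk) hv
    obtain ⟨k, rfl⟩ := exists_shiftCrossing hk
    rw [contractPoint_succ_shiftCrossing, contractPoint_succ_shiftCrossing,
      leftStrand_shiftCrossing, rightStrand_shiftCrossing]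
    exact .of_arc (.cup k ((isVertical_shiftCrossing e k).not.1 hv))

/-- The circles of a diagram do not change when vertically resolved crossings are added. -/
theorem conn_contractPoint_iff (hu : AllPositive u) (e : Resolution w)
    (p q : Point (u ++ w : BraidWord m)) :
    Conn w e (contractPoint u w p) (contractPoint u w q) ↔
      Conn (u ++ w : BraidWord m) (extendResolution u w e) p q := by
  constructor
  · intro h
    have h1 : Conn (u ++ w : BraidWord m) (extendResolution u w e)
        (shiftPoint u w (contractPoint u w p)) (shiftPoint u w (contractPoint u w q)) :=
      Conn.rec_equivalence (r := fun p q => Conn (u ++ w : BraidWord m) (extendResolution u w e)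
        (shiftPoint u w p) (shiftPoint u w q))
        ⟨fun _ => .refl _ _, fun h => h.symm, fun h h' => h.trans h'⟩
        (fun _ _ => conn_shiftPoint_of_arc hu) h
    exact (conn_shiftPoint_contractPoint hu e p).trans
      (h1.trans (conn_shiftPoint_contractPoint hu e q).symm)
  · exact Conn.rec_equivalence (r := fun p q => Conn w e (contractPoint u w p) (contractPoint u w q))
      ⟨fun _ => .refl _ _, fun h => h.symm, fun h h' => h.trans h'⟩
      fun _ _ => conn_contractPoint_of_arc hu

/-- A state of `w` as a state of `u ++ w`. -/
noncomputable def extendState (hu : AllPositive u) (x : State w) : State (u ++ w : BraidWord m) :=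
  mkState (extendResolution u w x.1) (fun p => label x (contractPoint u w p))
    fun p q h => label_congr x ((conn_contractPoint_iff hu x.1 p q).2 h)

variable (hu : AllPositive u)

theorem extendState_fst (x : State w) : (extendState hu x).1 = extendResolution u w x.1 := rfl

theorem label_extendState (x : State w) (p : Point (u ++ w : BraidWord m)) :
    label (extendState hu x) p = label x (contractPoint u w p) := rfl

theorem extendState_injective : Function.Injective (extendState (w := w) hu) := by
  intro x y h
  refine state_ext (extendResolution_injective (u := u) (congrArg Sigma.fst h)) fun p => ?_
  rw [← contractPoint_shiftPoint (u := u) p, ← label_extendState hu, h, label_extendState]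

/-- Its negation identifies the complement of the range with the states that have a 1-resolution in
`u`, the subcomplex to be divided out. -/
theorem mem_range_extendState (y : State (u ++ w : BraidWord m)) :
    y ∈ Set.range (extendState (w := w) hu) ↔
      ∀ k : Fin (BraidWord.crossings (u ++ w : BraidWord m)), k.val < u.crossings →
        y.1 k = false := by
  constructor
  · rintro ⟨x, rfl⟩ k hk
    exact extendResolution_of_lt _ hk
  · intro h
    have he : extendResolution u w (fun k => y.1 (shiftCrossing u w k)) = y.1 := by
      funext k
      by_cases hk : k.val < u.crossings
      · rw [extendResolution_of_lt _ hk, h k hk]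
      · obtain ⟨k, rfl⟩ := exists_shiftCrossing hk
        rw [extendResolution_shiftCrossing]
    refine ⟨mkState (fun k => y.1 (shiftCrossing u w k)) (fun p => label y (shiftPoint u w p))
      fun p q hpq => label_congr y ?_, state_ext he fun p => ?_⟩
    · rw [← contractPoint_shiftPoint (u := u) p, ← contractPoint_shiftPoint (u := u) q,
        conn_contractPoint_iff hu, he] at hpq
      exact hpq
    · rw [label_extendState, label_mkState]
      have := conn_shiftPoint_contractPoint hu (fun k => y.1 (shiftCrossing u w k)) p
      rw [he] at this
      exact (label_congr y this).symm

theorem filter_extendResolution (e : Resolution w)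
    (P : Fin (BraidWord.crossings (u ++ w : BraidWord m)) → Prop) [DecidablePred P] :
    (Finset.univ.filter fun k => P k ∧ extendResolution u w e k = true).card =
      (Finset.univ.filter fun k => P (shiftCrossing u w k) ∧ e k = true).card := by
  rw [← Finset.card_map ⟨shiftCrossing u w, shiftCrossing_injective⟩]
  congr 1
  ext k
  simp only [Finset.mem_filter, Finset.mem_univ, true_and, Finset.mem_map,
    Function.Embedding.coeFn_mk]
  constructor
  · rintro ⟨h1, h2⟩
    have hk : ¬ k.val < u.crossings := fun hk => by
      rw [extendResolution_of_lt _ hk] at h2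
      exact absurd h2 (by simp)
    obtain ⟨k, rfl⟩ := exists_shiftCrossing hk
    rw [extendResolution_shiftCrossing] at h2
    exact ⟨k, ⟨h1, h2⟩, rfl⟩
  · rintro ⟨k, ⟨h1, h2⟩, rfl⟩
    exact ⟨h1, by rw [extendResolution_shiftCrossing, h2]⟩

theorem homDegree_extendState (x : State w) : homDegree (extendState hu x) = homDegree x := by
  have := filter_extendResolution (u := u) x.1 fun _ => True
  simp only [true_and] at this
  exact this

theorem qDegree_extendState (x : State w) : qDegree (extendState hu x) = qDegree x := by
  rw [qDegree, qDegree, homDegree_extendState]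
  congr 1
  let F : Circles (u ++ w : BraidWord m) (extendState hu x).1 → Circles w x.1 :=
    liftCircles _ (fun p => circleAt w x.1 (contractPoint u w p))
      fun p q h => (conn_contractPoint_iff hu x.1 p q).2 h
  have hF : Function.Bijective F := by
    constructor
    · intro c c' h
      obtain ⟨p, rfl⟩ := exists_circleAt c
      obtain ⟨q, rfl⟩ := exists_circleAt c'
      exact (conn_contractPoint_iff hu x.1 p q).1 h
    · intro c
      obtain ⟨p, rfl⟩ := exists_circleAt c
      refine ⟨circleAt _ _ (shiftPoint u w p), ?_⟩
      show circleAt w x.1 (contractPoint u w (shiftPoint u w p)) = _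
      rw [contractPoint_shiftPoint]
  rw [← hF.sum_comp fun c => vDeg (x.2 c)]
  refine Finset.sum_congr rfl fun c _ => ?_
  obtain ⟨p, rfl⟩ := exists_circleAt c
  rfl

open Classical in
theorem edgeCoeff_eq (k : Fin w.crossings) (x y : State w) : edgeCoeff w k x y =
    if ∀ p, ¬ Conn w x.1 p (bottomLeft w k) → ¬ Conn w x.1 p (topRight w k) →
      label y p = label x p then
      if ¬ Conn w x.1 (bottomLeft w k) (topRight w k) then
        mulCoeff (label x (bottomLeft w k)) (label x (topRight w k)) (label y (bottomLeft w k))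
      else
        comulCoeff (label x (bottomLeft w k)) (label y (bottomLeft w k)) (label y (topRight w k))
    else 0 := by
  rfl

theorem edgeCoeff_extendState (k : Fin w.crossings) (x y : State w) :
    edgeCoeff (u ++ w : BraidWord m) (shiftCrossing u w k) (extendState hu x) (extendState hu y) =
      edgeCoeff w k x y := by
  classical
  rw [edgeCoeff_eq, edgeCoeff_eq]
  simp only [← shiftPoint_bottomLeft, ← shiftPoint_topRight, label_extendState, extendState_fst,
    ← conn_contractPoint_iff hu, contractPoint_shiftPoint]
  refine if_congr ⟨fun h p => ?_, fun h p => h _⟩ rfl rfl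
  have := h (shiftPoint u w p)
  rwa [contractPoint_shiftPoint] at this

theorem edgeSign_extendResolution (e : Resolution w) (k : Fin w.crossings) :
    edgeSign (extendResolution u w e) (shiftCrossing u w k) = edgeSign e k := by
  rw [edgeSign, edgeSign, filter_extendResolution e fun l => l < shiftCrossing u w k]
  have : ∀ l : Fin w.crossings, shiftCrossing u w l < shiftCrossing u w k ↔ l < k := fun l => by
    rw [Fin.lt_def, Fin.lt_def, shiftCrossing_val, shiftCrossing_val]
    omega
  simp only [this]

/-- Edges that change a crossing of `u` leave the range, and the signs agree because the prepended
entries are all 0. -/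
theorem diffCoeff_extendState (x y : State w) :
    diffCoeff (u ++ w : BraidWord m) (extendState hu x) (extendState hu y) = diffCoeff w x y := by
  rw [diffCoeff_eq_sum, diffCoeff_eq_sum]
  symm
  refine Finset.sum_of_injOn (shiftCrossing u w) shiftCrossing_injective.injOn (by simp) ?_ ?_
  · intro k _ hk
    have hk' : k.val < u.crossings := by
      by_contra hk'
      obtain ⟨l, rfl⟩ := exists_shiftCrossing hk'
      exact hk ⟨l, by simp, rfl⟩
    rw [edgeTerm, if_neg]
    rintro ⟨h1, h2⟩
    have h3 := congrFun h2 k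
    rw [flip_self, h1, extendState_fst, extendResolution_of_lt _ hk'] at h3
    exact absurd h3 (by simp)
  · intro k _
    rw [edgeTerm, edgeTerm, edgeCoeff_extendState, extendState_fst, extendState_fst,
      edgeSign_extendResolution, extendResolution_shiftCrossing, ← extendResolution_flip]
    simp only [extendResolution_injective.eq_iff]

end Prefix

/-! ### Dividing out a subcomplex that is exact in two degrees -/

section QuotientHomology

variable {m : ℕ} {w : BraidWord m}

open Classical in
/-- Extension of a chain by zero to a function on all basis vectors. -/
noncomputable def extendChain {i j : ℤ} (f : Chain w i j) (x : State w) : ℤ :=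
  if h : (homDegree x : ℤ) = i ∧ qDegree x = j then f ⟨x, h⟩ else 0

theorem extendChain_val {i j : ℤ} (f : Chain w i j) (x : StateOf w i j) :
    extendChain f x.1 = f x := dif_pos x.2

theorem extendChain_ne_zero {i j : ℤ} {f : Chain w i j} {x : State w} (h : extendChain f x ≠ 0) :
    (homDegree x : ℤ) = i ∧ qDegree x = j := by
  by_contra h'
  exact h (dif_neg h')

theorem extendChain_restrict {i j : ℤ} {F : State w → ℤ}
    (hF : ∀ x, F x ≠ 0 → (homDegree x : ℤ) = i ∧ qDegree x = j) :
    extendChain (fun x : StateOf w i j => F x.1) = F := by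
  funext x
  by_cases h : (homDegree x : ℤ) = i ∧ qDegree x = j
  · exact dif_pos h
  · rw [extendChain, dif_neg h]
    by_contra h'
    exact h (hF x (Ne.symm h'))

theorem diff_apply {i i' j : ℤ} (f : Chain w i j) (y : StateOf w i' j) :
    diff w i i' j f y = ∑ x, extendChain f x * diffCoeff w x y.1 := by
  rw [diff, Matrix.mulVecLin_apply, Matrix.mulVec, dotProduct]
  refine Finset.sum_of_injOn Subtype.val Subtype.val_injective.injOn (by simp) ?_ ?_
  · intro x _ hx
    rw [extendChain, dif_neg, zero_mul]
    exact fun h => hx ⟨⟨x, h⟩, by simp, rfl⟩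
  · intro x _
    rw [extendChain_val, Matrix.of_apply, mul_comm]

theorem extendChain_diff {i i' j : ℤ} (hi : i' = i + 1) (f : Chain w i j) :
    extendChain (diff w i i' j f) = fun y => ∑ x, extendChain f x * diffCoeff w x y := by
  rw [← extendChain_restrict (i := i') (j := j) (F := fun y => ∑ x, extendChain f x * diffCoeff w x y)]
  · congr 1
    funext y
    exact diff_apply f y
  · intro y hy
    obtain ⟨x, -, hx⟩ := Finset.exists_ne_zero_of_sum_ne_zero hy
    have h1 := extendChain_ne_zero (left_ne_zero_of_mul hx)
    have h2 := right_ne_zero_of_mul hx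
    rw [homDegree_of_diffCoeff_ne_zero h2, qDegree_of_diffCoeff_ne_zero h2, h1.1, h1.2]
    exact ⟨hi.symm, rfl⟩

theorem sum_extendChain_diff {i i' j : ℤ} (hi : i' = i + 1) (f : Chain w i j) (y : State w) :
    ∑ x, extendChain (diff w i i' j f) x * diffCoeff w x y = 0 := by
  rw [extendChain_diff hi]
  simp only [Finset.sum_mul, mul_assoc]
  rw [Finset.sum_comm]
  refine Finset.sum_eq_zero fun z _ => ?_
  rw [← Finset.mul_sum, diffCoeff_sq, mul_zero]

variable {m' : ℕ} {w' : BraidWord m'} (ι : State w → State w')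

/-- The restriction of chains along an embedding of the standard bases. -/
def restrictChain (hdeg : ∀ x, homDegree (ι x) = homDegree x) (hq : ∀ x, qDegree (ι x) = qDegree x)
    (i j : ℤ) : Chain w' i j →ₗ[ℤ] Chain w i j :=
  LinearMap.funLeft ℤ ℤ fun x : StateOf w i j =>
    (⟨ι x.1, by rw [hdeg, hq]; exact x.2⟩ : StateOf w' i j)

variable {ι} (hdeg : ∀ x, homDegree (ι x) = homDegree x)
  (hq : ∀ x, qDegree (ι x) = qDegree x)

theorem extendChain_restrictChain {i j : ℤ} (f : Chain w' i j) (x : State w) :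
    extendChain (restrictChain ι hdeg hq i j f) x = extendChain f (ι x) := by
  by_cases h : (homDegree x : ℤ) = i ∧ qDegree x = j
  · rw [extendChain, dif_pos h, extendChain, dif_pos (by rw [hdeg, hq]; exact h)]
    rfl
  · rw [extendChain, dif_neg h, extendChain, dif_neg (by rw [hdeg, hq]; exact h)]

/-- By `hsub` the complement of the range spans a subcomplex, so restriction is the projection to
the quotient complex and commutes with the differentials. -/
theorem diff_restrictChain (hι : Function.Injective ι)
    (hD : ∀ x y, diffCoeff w' (ι x) (ι y) = diffCoeff w x y)
    (hsub : ∀ x y, x ∉ Set.range ι → diffCoeff w' x (ι y) = 0) {i i' j : ℤ} (f : Chain w' i j) :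
    diff w i i' j (restrictChain ι hdeg hq i j f) =
      restrictChain ι hdeg hq i' j (diff w' i i' j f) := by
  funext y
  rw [diff_apply, show restrictChain ι hdeg hq i' j (diff w' i i' j f) y =
    diff w' i i' j f ⟨ι y.1, by rw [hdeg, hq]; exact y.2⟩ from rfl, diff_apply]
  refine Finset.sum_of_injOn ι hι.injOn (by simp) ?_ ?_
  · intro x _ hx
    rw [hsub x y.1 (by simpa using hx), mul_zero]
  · intro x _
    rw [extendChain_restrictChain, hD]

theorem restrictChain_surjective (hι : Function.Injective ι) (i j : ℤ) :
    Function.Surjective (restrictChain ι hdeg hq i j) := by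
  intro f
  refine ⟨fun x => Function.extend ι (extendChain f) 0 x.1, ?_⟩
  funext x
  rw [restrictChain, LinearMap.funLeft_apply]
  exact (hι.extend_apply _ _ x.1).trans (extendChain_val f x)

/-- A chain of the exact subcomplex that is a cycle is a boundary. -/
theorem exists_diff_eq_of_restrictChain_eq_zero
    (hsub : ∀ x y, x ∉ Set.range ι → diffCoeff w' x (ι y) = 0) {i i' j : ℤ} (hi : i' = i + 1)
    (hex : KhExactOn w' (fun x => x ∉ Set.range ι ∧ qDegree x = j) i') {z : Chain w' i' j}
    (hz : restrictChain ι hdeg hq i' j z = 0)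
    (hcz : ∀ y, ∑ x, extendChain z x * diffCoeff w' x y = 0) :
    ∃ g : Chain w' i j, restrictChain ι hdeg hq i j g = 0 ∧ diff w' i i' j g = z := by
  have hzι : ∀ x, extendChain z (ι x) = 0 := by
    intro x
    rw [← extendChain_restrictChain hdeg hq, hz, extendChain]
    split_ifs <;> rfl
  obtain ⟨g, hg, hgz⟩ := hex (extendChain z) (fun x hx => by
    refine ⟨⟨?_, (extendChain_ne_zero hx).2⟩, (extendChain_ne_zero hx).1⟩
    rintro ⟨y, rfl⟩
    exact hx (hzι y)) fun y _ => hcz y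
  have hgF : extendChain (fun x : StateOf w' i j => g x.1) = g :=
    extendChain_restrict fun x hx => ⟨(hg x hx).2.trans (by omega), (hg x hx).1.2⟩
  refine ⟨fun x => g x.1, ?_, ?_⟩
  · funext x
    rw [restrictChain, LinearMap.funLeft_apply]
    by_contra h
    exact (hg _ h).1.1 ⟨_, rfl⟩
  · funext y
    rw [diff_apply, hgF]
    by_cases hy : y.1 ∈ Set.range ι
    · obtain ⟨y0, hy0⟩ := hy
      rw [← extendChain_val z y, ← hy0, hzι]
      refine Finset.sum_eq_zero fun x _ => ?_
      by_contra h
      exact right_ne_zero_of_mul h (hsub x y0 (hg x (left_ne_zero_of_mul h)).1.1)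
    · rw [hgz y.1 ⟨hy, y.2.2⟩, extendChain_val]

/-- Dividing out a subcomplex that is exact in two consecutive degrees does not change the homology
in the lower one. -/
theorem nonempty_homology_equiv (hι : Function.Injective ι)
    (hdeg : ∀ x, homDegree (ι x) = homDegree x) (hq : ∀ x, qDegree (ι x) = qDegree x)
    (hD : ∀ x y, diffCoeff w' (ι x) (ι y) = diffCoeff w x y)
    (hsub : ∀ x y, x ∉ Set.range ι → diffCoeff w' x (ι y) = 0) {i j : ℤ}
    (hex : KhExactOn w' (fun x => x ∉ Set.range ι ∧ qDegree x = j) i)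
    (hex' : KhExactOn w' (fun x => x ∉ Set.range ι ∧ qDegree x = j) (i + 1)) :
    Nonempty (Homology w' i j ≃ₗ[ℤ] Homology w i j) := by
  let R := restrictChain ι hdeg hq
  have hdR : ∀ {i i' : ℤ} (f : Chain w' i j), diff w i i' j (R i j f) = R i' j (diff w' i i' j f) :=
    fun f => diff_restrictChain hdeg hq hι hD hsub f
  have hR : ∀ z ∈ LinearMap.ker (diff w' i (i + 1) j), R i j z ∈ LinearMap.ker (diff w i (i + 1) j) := by
    intro z hz
    rw [LinearMap.mem_ker] at hz ⊢
    rw [hdR, hz, map_zero]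
  let φ : LinearMap.ker (diff w' i (i + 1) j) →ₗ[ℤ] Homology w i j :=
    (Submodule.mkQ _) ∘ₗ (R i j).restrict hR
  have hφ : Function.Surjective φ := by
    intro c
    obtain ⟨⟨z, hz⟩, rfl⟩ := Submodule.mkQ_surjective _ c
    obtain ⟨f, hf⟩ := restrictChain_surjective hdeg hq hι i j z
    -- The lift `f` of the cycle need not be a cycle, but its differential is a cycle of the
    -- subcomplex. Exactness in degree `i + 1` provides the correction.
    obtain ⟨g, hg0, hg⟩ := exists_diff_eq_of_restrictChain_eq_zero hdeg hq hsub rfl hex'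
      (z := diff w' i (i + 1) j f)
      (by rw [← diff_restrictChain hdeg hq hι hD hsub, hf]; exact hz)
      (sum_extendChain_diff rfl f)
    refine ⟨⟨f - g, by rw [LinearMap.mem_ker, map_sub, hg, sub_self]⟩, ?_⟩
    refine congrArg (Submodule.mkQ _) (Subtype.ext ?_)
    show R i j (f - g) = z
    rw [map_sub]
    show restrictChain ι hdeg hq i j f - restrictChain ι hdeg hq i j g = z
    rw [hf, hg0, sub_zero]
  have hker : LinearMap.ker φ =
      (LinearMap.range (diff w' (i - 1) i j)).submoduleOf (LinearMap.ker (diff w' i (i + 1) j)) := by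
    ext ⟨z, hz⟩
    show φ ⟨z, hz⟩ = 0 ↔ z ∈ LinearMap.range (diff w' (i - 1) i j)
    have h1 : φ ⟨z, hz⟩ = 0 ↔ R i j z ∈ LinearMap.range (diff w (i - 1) i j) := by
      show Submodule.mkQ _ _ = 0 ↔ _
      rw [Submodule.mkQ_apply, Submodule.Quotient.mk_eq_zero]
      rfl
    rw [h1]
    constructor
    · rintro ⟨c, hc⟩
      -- After subtracting the boundary of a lift of `c`, the cycle `z` lies in the subcomplex,
      -- where exactness in degree `i` makes it a boundary.
      obtain ⟨f, hf⟩ := restrictChain_surjective hdeg hq hι (i - 1) j c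
      have hcy : ∀ y, ∑ x, extendChain (z - diff w' (i - 1) i j f) x * diffCoeff w' x y = 0 := by
        intro y
        have h2 : ∀ x, extendChain (z - diff w' (i - 1) i j f) x =
            extendChain z x - extendChain (diff w' (i - 1) i j f) x := by
          intro x
          simp only [extendChain]
          split_ifs
          · rfl
          · simp
        simp only [h2, sub_mul, Finset.sum_sub_distrib]
        rw [sum_extendChain_diff (by omega), sub_zero]
        rw [LinearMap.mem_ker] at hz
        have h3 := congrFun (extendChain_diff rfl z) y
        rw [hz] at h3
        rw [← h3, extendChain]
        split_ifs <;> rfl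
      obtain ⟨g, -, hg⟩ := exists_diff_eq_of_restrictChain_eq_zero hdeg hq hsub
        (i := i - 1) (by omega) hex (z := z - diff w' (i - 1) i j f)
        (by rw [map_sub, ← diff_restrictChain hdeg hq hι hD hsub, hf, hc]; exact sub_self _) hcy
      exact ⟨f + g, by rw [map_add, hg]; exact add_sub_cancel _ _⟩
    · rintro ⟨c, hc⟩
      exact ⟨R (i - 1) j c, by rw [hdR, hc]⟩
  exact ⟨(Submodule.quotEquivOfEq _ _ hker.symm).trans (φ.quotKerEquivOfSurjective hφ)⟩

end QuotientHomology

end Khovanov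

namespace Khovanov

/-! ### Stability of the homology of torus braids -/

section Torus

variable (m n : ℕ)

/-- The braid word `σ₁ σ₂ ⋯ σ_{m-1}`. -/
def torusRow : BraidWord m := (List.finRange (m - 1)).map fun i => (i, true)

theorem torusBraid_succ : torusBraid m (n + 1) = torusRow m ++ torusBraid m n := rfl

theorem crossings_torusRow : (torusRow m).crossings = m - 1 := by
  rw [torusRow, BraidWord.crossings, List.length_map, List.length_finRange]

theorem crossings_torusBraid : (torusBraid m n).crossings = n * (m - 1) := by
  induction n with
  | zero => rw [Nat.zero_mul]; rfl
  | succ n ih =>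
    rw [torusBraid_succ, crossings_append, crossings_torusRow, ih]
    ring

theorem get_torusRow (k : Fin (torusRow m).crossings) :
    ((torusRow m).get k).1.val = k.val ∧ ((torusRow m).get k).2 = true := by
  have hk : k.val < m - 1 := lt_of_lt_of_eq k.isLt (crossings_torusRow m)
  have : (torusRow m).get k = (⟨k.val, hk⟩, true) := by
    rw [List.get_eq_getElem]
    refine (List.getElem_map _).trans ?_
    rw [List.getElem_finRange]
    rfl
  rw [this]
  exact ⟨rfl, rfl⟩

theorem allPositive_torusRow : AllPositive (torusRow m) := fun k => (get_torusRow m k).2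

theorem isCyclic_torusBraid : IsCyclic (torusBraid m n) (m - 1) := by
  suffices h : ∀ k : Fin (torusBraid m n).crossings, ((torusBraid m n).get k).2 = true ∧
      ((torusBraid m n).get k).1.val = k.val % (m - 1) from ⟨fun k => (h k).1, fun k => (h k).2⟩
  induction n with
  | zero => intro k; exact k.elim0
  | succ n ih =>
    intro k
    change Fin (BraidWord.crossings (torusRow m ++ torusBraid m n : BraidWord m)) at k
    change (List.get (torusRow m ++ torusBraid m n) k).2 = true ∧
      (List.get (torusRow m ++ torusBraid m n) k).1.val = k.val % (m - 1)
    by_cases hk : k.val < (torusRow m).crossings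
    · rw [get_append_of_lt hk]
      obtain ⟨h1, h2⟩ := get_torusRow m ⟨k.val, hk⟩
      refine ⟨h2, h1.trans (Nat.mod_eq_of_lt ?_).symm⟩
      rwa [crossings_torusRow] at hk
    · obtain ⟨k, rfl⟩ := exists_shiftCrossing hk
      rw [get_shiftCrossing, shiftCrossing_val, crossings_torusRow, Nat.add_mod_left]
      exact ih k

theorem nMinus_torusBraid : nMinus (torusBraid m n) = 0 := by
  rw [nMinus, Finset.card_eq_zero, Finset.filter_eq_empty_iff]
  intro k _
  rw [isPositive, (isCyclic_torusBraid m n).1 k]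
  simp

theorem nPlus_torusBraid : nPlus (torusBraid m n) = n * (m - 1) := by
  rw [nPlus, Finset.filter_true_of_mem (p := fun k => isPositive (torusBraid m n) k = true)
    fun k _ => (isCyclic_torusBraid m n).1 k, Finset.card_univ,
    Fintype.card_fin, crossings_torusBraid]

/-- The unnormalized homology of the standard diagram of `T_{m,n}` is stable in low degrees. -/
theorem nonempty_homology_torusBraid_equiv {m n : ℕ} (hm : 1 ≤ m) (hmn : m ≤ n) {i j : ℤ}
    (hi : i ≤ (m : ℤ) + n - 3) :
    Nonempty (Homology (torusBraid m (n + 1)) i j ≃ₗ[ℤ] Homology (torusBraid m n) i j) := by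
  have hu := allPositive_torusRow m
  have hcyc : IsCyclic (torusRow m ++ torusBraid m n) (m - 1) := isCyclic_torusBraid m (n + 1)
  -- With `M = m - 1` and `N = n`, the condition `d < M + N` means `d ≤ m + n - 2`, and `M + 1 ≤ N`
  -- is `m ≤ n`. Exactness is needed at `i` and `i + 1`, which is why stability holds only up to `m
  -- + n - 3`.
  have hex : ∀ d : ℤ, d ≤ (m : ℤ) + n - 2 → KhExactOn (torusRow m ++ torusBraid m n : BraidWord m)
      (fun x => x ∉ Set.range (extendState (w := torusBraid m n) hu) ∧ qDegree x = j) d := by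
    intro d hd
    refine ExactOn.congr (khExactOn_firstRow hcyc (N := n) ?_ (by omega)
      (j := j) (d := d) (by omega)) fun x => and_congr_left' ?_
    · rw [crossings_append, crossings_torusRow, crossings_torusBraid]
    · have h1 := (mem_range_extendState hu x).not
      rw [h1, not_forall]
      refine exists_congr fun k => ?_
      rw [crossings_torusRow, Classical.not_imp, Bool.not_eq_false]
  rw [torusBraid_succ]
  exact nonempty_homology_equiv (extendState_injective hu) (homDegree_extendState hu)
    (qDegree_extendState hu) (diffCoeff_extendState hu) (fun x y hx => by
      by_contra hD
      refine hx ((mem_range_extendState hu x).2 fun k hk => ?_)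
      by_contra hxk
      have h2 := le_of_diffCoeff_ne_zero hD (by simpa using hxk)
      rw [extendState_fst, extendResolution_of_lt _ hk] at h2
      exact absurd h2 (by simp)) (hex i (by omega)) (hex (i + 1) (by omega))

theorem khovanovRank_torusBraid (i j : ℤ) : khovanovRank (torusBraid m n) i j =
    Module.finrank ℚ (TensorProduct ℤ ℚ
      (Homology (torusBraid m n) i (j - ((n * (m - 1) : ℕ) : ℤ)))) := by
  rw [khovanovRank, nMinus_torusBraid, nPlus_torusBraid, Nat.cast_zero, mul_zero,
    add_zero, add_zero]

theorem khovanovRank_torusBraid_succ {m n : ℕ} (hm : 1 ≤ m) (hmn : m ≤ n) {i : ℤ}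
    (hi : i ≤ (m : ℤ) + n - 3) (j : ℤ) :
    khovanovRank (torusBraid m (n + 1)) i (j + (((n + 1) * (m - 1) : ℕ) : ℤ)) =
      khovanovRank (torusBraid m n) i (j + ((n * (m - 1) : ℕ) : ℤ)) := by
  rw [khovanovRank_torusBraid, khovanovRank_torusBraid, add_sub_cancel_right, add_sub_cancel_right]
  obtain ⟨e⟩ := nonempty_homology_torusBraid_equiv (j := j) hm hmn hi
  exact (e.baseChange ℤ ℚ _ _).finrank_eq

end Torus

/-! ### Coefficients of the Poincaré polynomials and their limit -/

section Poincare

open LaurentPolynomial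

theorem coeff_poincare {m : ℕ} (w : BraidWord m) (i j : ℤ) :
    ((poincare w).coeff i).coeff j = khovanovRank w i j := by
  classical
  have hsub : (Function.support fun p : ℤ × ℤ => khovanovRank w p.1 p.2 •
      (T p.1 * C (T p.2) : LaurentPolynomial (LaurentPolynomial ℤ))) ⊆
      (finite_support_khovanovRank w).toFinset := by
    intro p hp
    rw [Set.Finite.coe_toFinset]
    intro h
    apply hp
    simp only at h ⊢
    rw [h, zero_smul]
  have hterm : ∀ p : ℤ × ℤ, ((T p.1 * C (T p.2) :
      LaurentPolynomial (LaurentPolynomial ℤ)).coeff i).coeff j =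
      if p = (i, j) then 1 else 0 := by
    rintro ⟨a, b⟩
    rw [T_mul, ← single_eq_C_mul_T, AddMonoidAlgebra.coeff_single, Finsupp.single_apply]
    by_cases ha : a = i
    · by_cases hb : b = j
      · simp [ha, hb]
      · simp [ha, hb]
    · simp [ha]
  rw [poincare, finsum_eq_sum_of_support_subset _ hsub, AddMonoidAlgebra.coeff_sum,
    Finsupp.finsetSum_apply, AddMonoidAlgebra.coeff_sum, Finsupp.finsetSum_apply]
  simp only [AddMonoidAlgebra.coeff_smul_apply, hterm]
  simp +contextual [eq_comm]

/-- Together with `khovanovRank_torusBraid` this shows that the two shifts by `n (m - 1)` cancel: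
the coefficients of `P_{m,n}` are the ranks of the unnormalized homology. -/
theorem coeff_torusPoincare {m : ℕ} (hm : 1 ≤ m) (n : ℕ) (i j : ℤ) :
    ((torusPoincare m n).coeff i).coeff j =
      khovanovRank (torusBraid m n) i (j + ((n * (m - 1) : ℕ) : ℤ)) := by
  have h1 : (torusPoincare m n).coeff i =
      T (-(((m : ℤ) - 1) * (n : ℤ))) * (poincare (torusBraid m n)).coeff i := by
    rw [torusPoincare, ← single_eq_C, AddMonoidAlgebra.coeff_single_mul_eq_mul_coeff i]
    intro a _
    rw [zero_add]
  have h2 : -(((m : ℤ) - 1) * (n : ℤ)) + (j + ((n * (m - 1) : ℕ) : ℤ)) = j := by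
    push_cast [Nat.cast_sub hm]
    ring
  rw [h1, T, AddMonoidAlgebra.coeff_single_mul_eq_mul_coeff (j + ((n * (m - 1) : ℕ) : ℤ)), one_mul,
    coeff_poincare]
  intro a _
  constructor
  · intro h; omega
  · rintro rfl; exact h2

theorem coeff_torusPoincare_succ {m n : ℕ} (hm : 1 ≤ m) (hmn : m ≤ n) {i : ℤ}
    (hi : i ≤ (m : ℤ) + n - 3) :
    (torusPoincare m (n + 1)).coeff i = (torusPoincare m n).coeff i := by
  refine LaurentPolynomial.ext fun j => ?_
  rw [coeff_torusPoincare hm, coeff_torusPoincare hm, khovanovRank_torusBraid_succ hm hmn hi]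

theorem coeff_torusPoincare_of_le {m n n' : ℕ} (hm : 1 ≤ m) (hmn : m ≤ n) (hnn : n ≤ n') {i : ℤ}
    (hi : i ≤ (m : ℤ) + n - 3) :
    (torusPoincare m n').coeff i = (torusPoincare m n).coeff i := by
  induction n', hnn using Nat.le_induction with
  | base => rfl
  | succ k hk ih => rw [coeff_torusPoincare_succ hm (by omega) (by omega), ih]

theorem coeff_torusPoincare_of_neg {m : ℕ} (hm : 1 ≤ m) (n : ℕ) {i : ℤ} (hi : i < 0) :
    (torusPoincare m n).coeff i = 0 := by
  refine LaurentPolynomial.ext fun j => ?_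
  rw [coeff_torusPoincare hm, khovanovRank_torusBraid]
  have : IsEmpty (StateOf (torusBraid m n) i (j + ((n * (m - 1) : ℕ) : ℤ) - ((n * (m - 1) : ℕ) : ℤ))) :=
    ⟨fun x => by have := x.2.1; omega⟩
  have hsub : Subsingleton (Homology (torusBraid m n) i
      (j + ((n * (m - 1) : ℕ) : ℤ) - ((n * (m - 1) : ℕ) : ℤ))) :=
    (Submodule.mkQ_surjective _).subsingleton
  rw [Module.finrank_zero_of_subsingleton]
  rfl

/-- The stable coefficient of `t ^ i`. -/
noncomputable def stableCoeff (m : ℕ) (i : ℤ) : LaurentPolynomial ℤ :=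
  (torusPoincare m (m + i.toNat + 3)).coeff i

theorem coeff_torusPoincare_eq_stableCoeff {m n : ℕ} (hm : 1 ≤ m) (hmn : m ≤ n) {i : ℤ}
    (hi : i ≤ (m : ℤ) + n - 3) : (torusPoincare m n).coeff i = stableCoeff m i := by
  -- Both `n` and the index in `stableCoeff`, which is large enough for the degree `i`, are compared
  -- with their maximum.
  have h1 := coeff_torusPoincare_of_le hm hmn (le_max_left n (m + i.toNat + 3)) hi
  have h2 := coeff_torusPoincare_of_le hm (n := m + i.toNat + 3) (by omega)
    (le_max_right n (m + i.toNat + 3)) (i := i) (by omega)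
  rw [stableCoeff, ← h1, ← h2]

end Poincare

end Khovanov

theorem theorem26 (m : ℕ) (hm : 1 ≤ m) :
    ∃ P : LaurentSeries (LaurentPolynomial ℤ),
      Khovanov.IsStableLimit (fun n : ℕ => Khovanov.torusPoincare m n) P ∧
      ∀ n : ℕ, m ≤ n → ∀ i : ℤ, i ≤ (m : ℤ) + (n : ℤ) - 3 →
        (Khovanov.torusPoincare m n).coeff i = P.coeff i := by
  -- A Laurent series needs support bounded below; there are no states, hence no homology, in
  -- negative homological degree.
  have hbdd : BddBelow (Function.support (Khovanov.stableCoeff m)) := by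
    refine ⟨0, fun i hi => ?_⟩
    by_contra h
    exact hi (Khovanov.coeff_torusPoincare_of_neg hm _ (not_le.1 h))
  have hP : ∀ n : ℕ, m ≤ n → ∀ i : ℤ, i ≤ (m : ℤ) + (n : ℤ) - 3 →
      (Khovanov.torusPoincare m n).coeff i =
        (HahnSeries.ofSuppBddBelow (Khovanov.stableCoeff m) hbdd).coeff i := by
    intro n hn i hi
    rw [HahnSeries.coeff_ofSuppBddBelow]
    exact Khovanov.coeff_torusPoincare_eq_stableCoeff hm hn hi
  refine ⟨HahnSeries.ofSuppBddBelow (Khovanov.stableCoeff m) hbdd, fun N => ?_, hP⟩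
  filter_upwards [Filter.eventually_ge_atTop (m + N.toNat + 3)] with n hn i hi
  exact hP n (by omega) i (by omega)
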